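/- Let $k$ be a field of characteristic zero. Graded vector spaces are $\mathbb Z$-graded over $k$, $V[n]^p=V^{n+p}$, and the Koszul sign rule is used throughout. Let $\mathfrak g$ be an $L_\infty$-algebra, i.e. a graded vector space with graded symmetric brackets $l_n:S^n(\mathfrak g[1])\to\mathfrak g[1]$, $n\ge 1$, of degree $1$, satisfying the higher Jacobi identities. (Source.) The brackets $l_n$ extend to graded symmetric degree-one multiderivations of the graded commutative algebra $S(\mathfrak g[-1])$ (with degrees taken in $S(\mathfrak g[-1])[2]\supset\mathfrak g[1]$), hence to the completion $\widehat S(\mathfrak g[-1])=\prod_{n\ge0}S^n(\mathfrak g[-1])$; still denoted $l_n: S^n(\widehat S(\mathfrak g[-1])[2])\to \widehat S(\mathfrak g[-1])[2]$, they make $\widehat S(\mathfrak g[-1])[1]$ an $L_\infty$-algebra. (Target.) On $\mathcal B^+=\prod_{m,n\ge1}\mathrm{Hom}(S^m(\mathfrak g[1]),S^n(\mathfrak g[-1]))[2]$ let $[f,g]=f\circ g-(-1)^{|f||g|}g\circ f$ be the big bracket, where $$(f\circ g)(x_1\cdots x_m)=\sum_{\sigma}(-1)^{\varepsilon}f\bigl(x_{\sigma(1)}\cdots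 x_{\sigma(i)}\,g(x_{\sigma(i+1)}\cdots x_{\sigma(m)})_{(1)}\bigr)\,g(x_{\sigma(i+1)}\cdots x_{\sigma(m)})_{(2)},$$ the sum being over all $(i,m-i)$-shuffles $\sigma$, $0\le i\le m$; $(-1)^\varepsilon$ is the Koszul sign of $\sigma$ times $(-1)^{|g|(|x_{\sigma(1)}|+\dots+|x_{\sigma(i)}|)}$, and $a\mapsto a_{(1)}\otimes a_{(2)}$ is the comultiplication of $S(\mathfrak g[-1])$ followed by the projection of the first factor to $\mathfrak g[-1]$. With $d=[l_1+l_2+\cdots,-]$, $\mathcal B^+$ is a dg Lie algebra. For $n\ge1$, $x_1,\dots,x_n\in\widehat S(\mathfrak g[-1])[2]$ and $y=y_1\cdots y_p\in S^p(\mathfrak g[1])$, $p\ge1$, put $$\varphi_n(x_1\odot\dots\odot x_n)(y):=l_{n+p}(x_1\odot\dots\odot x_n\odot y_1\odot\dots\odot y_p).$$ **Theorem.** The maps $\varphi_n:S^n(\widehat S(\mathfrak g[-1])[2])\to\mathcal B^+[1]$ are well defined, of degree zero, and define an $L_\infty$-morphism from the $L_\infty$-algebra $\widehat S(\mathfrak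 g[-1])[1]$ to the dg Lie algebra $\mathcal B^+$, i.e. they are the components of a morphism of dg coalgebras $S(\widehat S(\mathfrak g[-1])[2])\to S(\mathcal B^+[1])$, where the codifferential of $S(\mathcal B^+[1])$ has the components $a\mapsto -da$ and $a\odot b\mapsto(-1)^{|a|}[a,b]$ ($|a|$ the degree in $\mathcal B^+$). Explicitly, for homogeneous $x_i$ and all $n\ge1$, $$-d\varphi_n(x_1\odot\dots\odot x_n)-\frac12\sum_{i=1}^{n-1}\sum_{\sigma\in \mathrm{Sh}_{i,n-i}}(-1)^{|x_\sigma|+|x_{\sigma(1)}|+\dots+|x_{\sigma(i)}|}\bigl[\varphi_i(x_{\sigma(1)}\odot\dots\odot x_{\sigma(i)}),\varphi_{n-i}(x_{\sigma(i+1)}\odot\dots\odot x_{\sigma(n)})\bigr]$$ $$=\sum_{m=1}^n\sum_{\tau\in \mathrm{Sh}_{m,n-m}}(-1)^{|x_\tau|}\varphi_{n-m+1}\bigl(l_m(x_{\tau(1)}\odot\dots\odot x_{\tau(m)})\odot x_{\tau(m+1)}\odot\dots\odot x_{\tau(n)}\bigr),$$ with degrees $|x_i|$ in $\widehat S(\mathfrak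 g[-1])[2]$ and $(-1)^{|x_\sigma|}$ the Koszul sign of $\sigma$. In particular, if $l_n=0$ for $n\ne2$ (a graded Lie algebra), then $\varphi_n=0$ for $n\ge2$, $d\varphi_1=0$, and $[\varphi_1(x),\varphi_1(y)]=\varphi_1([x,y])$, where $[x,y]=(-1)^{|x|}l_2(x\odot y)$, with $|x|$ the degree in $\widehat S(\mathfrak g[-1])[1]$, is the Lie bracket of $\widehat S(\mathfrak g[-1])[1]$. Consequently, let $r\in\lambda\widehat S(\mathfrak g[-1])[1][[\lambda]]$ be an $r_\infty$-matrix, i.e. an element of degree one with $\sum_{n\ge1}\frac1{n!}l_n(r\odot\dots\odot r)=0$. Then $\mu'=\varphi(e^r)=\sum_{n\ge1}\frac1{n!}\varphi_n(r\odot\dots\odot r)$ is a degree-one element of $\lambda\mathcal B^+[[\lambda]]$ with $d\mu'+\frac12[\mu',\mu']=0$, and $\mu=\mu'+l_1+l_2+\cdots\in\mathcal B^+[[\lambda]]$ has degree one and satisfies $[\mu,\mu]=0$, i.e. it is a ($\lambda$-dependent) $L_\infty$-bialgebra structure on $\mathfrak g$ (a triangular $L_\infty$-bialgebra). -/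

import Mathlib

open scoped TensorProduct

noncomputable section

namespace RInf

universe u v w

/-! ### Graded spaces, Koszul signs, `L_∞`-algebras, dg Lie algebras, `L_∞`-morphisms

A graded vector space is a family of subspaces `𝒱 p` (the homogeneous elements of degree `p`) of an
ambient vector space.  As usual, identities with Koszul signs are stated for homogeneous elements.
A linear map out of `S^n (V)` is a multilinear map in `n` variables that is symmetric in the
graded sense. -/

section General

variable {k : Type u} [Field k] {E : Type v} [AddCommGroup E] [Module k E]
  {M : Type w} [AddCommGroup M] [Module k M]

/-- The translation `V[n]`, with `V[n]^p = V^(n+p)`. -/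
def shift (𝒱 : ℤ → Submodule k E) (n : ℤ) : ℤ → Submodule k E := fun p => 𝒱 (n + p)

/-- The Koszul sign of the unshuffle `x₁ ⋯ xₙ ↦ x_S x_{Sᶜ}` for elements of degrees `d`.  The
`(p, n - p)`-shuffles correspond to the subsets `S` of `{1, …, n}` with `p` elements. -/
def koszul {n : ℕ} (d : Fin n → ℤ) (S : Finset (Fin n)) : ℤˣ :=
  ∏ i ∈ S, ∏ j ∈ Sᶜ with j < i, (d i * d j).negOnePow

/-- The subfamily `x_S`, in increasing order of the indices. -/
def sub {n : ℕ} (x : Fin n → E) (S : Finset (Fin n)) : Fin S.card → E :=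
  fun i => x (S.orderEmbOfFin rfl i)

/-- Graded symmetry of a multilinear map: exchanging two neighbours of degrees `p`, `q` produces
the sign `(-1)^(p q)`. -/
def IsGradedSymm (𝒱 : ℤ → Submodule k E) {n : ℕ}
    (F : MultilinearMap k (fun _ : Fin n => E) M) : Prop :=
  ∀ (d : Fin n → ℤ) (x : Fin n → E), (∀ i, x i ∈ 𝒱 (d i)) →
    ∀ i j : Fin n, (i : ℕ) + 1 = j →
      F (x ∘ Equiv.swap i j) = (d i * d j).negOnePow • F x

/-- An `L_∞`-algebra structure on the graded space `V`: brackets `l n : S^n (V[1]) → V[1]`,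
`n ≥ 1`, of degree one that satisfy the higher Jacobi identities (that is, the coderivation of
`S (V[1])` with corestrictions `l n` squares to zero). -/
structure IsLInfinity (𝒱 : ℤ → Submodule k E)
    (l : ∀ n : ℕ, MultilinearMap k (fun _ : Fin n => E) E) : Prop where
  zero : l 0 = 0
  symm : ∀ n, IsGradedSymm (shift 𝒱 1) (l n)
  degree : ∀ (n : ℕ) (d : Fin n → ℤ) (x : Fin n → E), (∀ i, x i ∈ shift 𝒱 1 (d i)) →
    l n x ∈ shift 𝒱 1 (∑ i, d i + 1)
  jacobi : ∀ (n : ℕ) (d : Fin n → ℤ) (x : Fin n → E), (∀ i, x i ∈ shift 𝒱 1 (d i)) →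
    ∑ S : Finset (Fin n), koszul d S •
      l (Sᶜ.card + 1) (Fin.cons (l S.card (sub x S)) (sub x Sᶜ)) = 0

/-- A dg Lie algebra structure on the graded space `ℬ`.  Here `br a b` is the bracket of
elements of degrees `a` and `b`, and `dd a` is the differential on elements of degree `a`. -/
structure IsDGLie (ℬ : ℤ → Submodule k M) (br : ℤ → ℤ → M →ₗ[k] M →ₗ[k] M)
    (dd : ℤ → M →ₗ[k] M) : Prop where
  bracket_mem : ∀ a b f g, f ∈ ℬ a → g ∈ ℬ b → br a b f g ∈ ℬ (a + b)
  d_mem : ∀ a f, f ∈ ℬ a → dd a f ∈ ℬ (a + 1)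
  antisymm : ∀ a b f g, f ∈ ℬ a → g ∈ ℬ b →
    br a b f g = -((a * b).negOnePow • br b a g f)
  jacobi : ∀ a b c f g h, f ∈ ℬ a → g ∈ ℬ b → h ∈ ℬ c →
    br a (b + c) f (br b c g h) =
      br (a + b) c (br a b f g) h + (a * b).negOnePow • br b (a + c) g (br a c f h)
  d_sq : ∀ a f, f ∈ ℬ a → dd (a + 1) (dd a f) = 0
  leibniz : ∀ a b f g, f ∈ ℬ a → g ∈ ℬ b →
    dd (a + b) (br a b f g) =
      br (a + 1) b (dd a f) g + a.negOnePow • br a (b + 1) f (dd b g)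

/-- The maps `φ n : S^n (V[1]) → ℬ[1]`, `n ≥ 1`, are the corestrictions of a morphism of dg
coalgebras `S (V[1]) → S (ℬ[1])`, that is, they define an `L_∞`-morphism from the `L_∞`-algebra
`(V, l)` to the dg Lie algebra `(ℬ, br, dd)`.  The codifferential of `S (ℬ[1])` is the usual one:
its corestrictions are `a ↦ -d a` and `a ⊙ b ↦ (-1)^|a| [a, b]`, where `|a|` is the degree
of `a` in `ℬ`. -/
structure IsLInfinityMorphism (𝒱 : ℤ → Submodule k E)
    (l : ∀ n : ℕ, MultilinearMap k (fun _ : Fin n => E) E)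
    (ℬ : ℤ → Submodule k M) (br : ℤ → ℤ → M →ₗ[k] M →ₗ[k] M) (dd : ℤ → M →ₗ[k] M)
    (φ : ∀ n : ℕ, MultilinearMap k (fun _ : Fin n => E) M) : Prop where
  source : IsLInfinity 𝒱 l
  target : IsDGLie ℬ br dd
  symm : ∀ n, 1 ≤ n → IsGradedSymm (shift 𝒱 1) (φ n)
  degree : ∀ n, 1 ≤ n → ∀ (d : Fin n → ℤ) (x : Fin n → E), (∀ i, x i ∈ shift 𝒱 1 (d i)) →
    φ n x ∈ shift ℬ 1 (∑ i, d i)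
  compat : ∀ n, 1 ≤ n → ∀ (d : Fin n → ℤ) (x : Fin n → E), (∀ i, x i ∈ shift 𝒱 1 (d i)) →
    -dd (1 + ∑ i, d i) (φ n x)
      + (2⁻¹ : k) • ∑ S : Finset (Fin n) with S.Nonempty ∧ Sᶜ.Nonempty,
          koszul d S • (1 + ∑ i ∈ S, d i).negOnePow •
            br (1 + ∑ i ∈ S, d i) (1 + ∑ i ∈ Sᶜ, d i)
              (φ S.card (sub x S)) (φ Sᶜ.card (sub x Sᶜ))
    = ∑ S : Finset (Fin n) with S.Nonempty,
        koszul d S • φ (Sᶜ.card + 1) (Fin.cons (l S.card (sub x S)) (sub x Sᶜ))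

/-- For a formal power series `r = ∑ λ^i r_i` with `r_0 = 0`, the coefficients of
`∑_{n ≥ 1} (1/n!) F_n (r ⊙ ⋯ ⊙ r)`.  (The terms with `n > N` do not contribute to `λ^N`.) -/
def expSeries (F : ∀ n : ℕ, MultilinearMap k (fun _ : Fin n => E) M) (r : ℕ → E) : ℕ → M :=
  fun N => ∑ n ∈ Finset.Icc 1 N, ((n.factorial : k)⁻¹) •
    ∑ ν ∈ Finset.Nat.antidiagonalTuple n N, F n (fun i => r (ν i))

end General

section Graded

variable {k : Type u} [Field k] {g : Type v} [AddCommGroup g] [Module k g]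
  (𝒢 : ℤ → Submodule k g)

/-! ### The graded symmetric algebra `S (g[-1])` -/

/-- The relations `x y = (-1)^(|x| |y|) y x` for homogeneous `x, y ∈ g[-1]`. -/
inductive SymRel : TensorAlgebra k g → TensorAlgebra k g → Prop
  | swap (p q : ℤ) (x y : g) (hx : x ∈ shift 𝒢 (-1) p) (hy : y ∈ shift 𝒢 (-1) q) :
      SymRel (TensorAlgebra.ι k x * TensorAlgebra.ι k y)
        ((p * q).negOnePow • (TensorAlgebra.ι k y * TensorAlgebra.ι k x))

/-- The graded commutative algebra `S (g[-1])`. -/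
def Sym : Type (max u v) := RingQuot (SymRel 𝒢)

instance : Ring (Sym 𝒢) := inferInstanceAs (Ring (RingQuot (SymRel 𝒢)))

instance : Algebra k (Sym 𝒢) := inferInstanceAs (Algebra k (RingQuot (SymRel 𝒢)))

/-- The quotient map from the tensor algebra. -/
def symMk : TensorAlgebra k g →ₐ[k] Sym 𝒢 := RingQuot.mkAlgHom k (SymRel 𝒢)

/-- The inclusion of the generators. -/
def gen : g →ₗ[k] Sym 𝒢 :=
  (symMk 𝒢).toLinearMap ∘ₗ TensorAlgebra.ι k

/-- The elements of degree `p` in `S^n (g[-1])`. -/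
def symPart (n : ℕ) (p : ℤ) : Submodule k (Sym 𝒢) :=
  Submodule.span k {a | ∃ (d : Fin n → ℤ) (x : Fin n → g),
    (∀ i, x i ∈ shift 𝒢 (-1) (d i)) ∧ ∑ i, d i = p ∧ a = (List.ofFn fun i => gen 𝒢 (x i)).prod}

/-- The elements of degree `p` in `S (g[-1])`. -/
def symDeg (p : ℤ) : Submodule k (Sym 𝒢) := ⨆ n, symPart 𝒢 n p

/-- The degree `p` part of `Ŝ (g[-1]) = ∏ₙ S^n (g[-1])`; an element is the sequence of its
components. -/
def hatDeg (p : ℤ) : Submodule k (ℕ → Sym 𝒢) where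
  carrier := {a | ∀ n, a n ∈ symPart 𝒢 n p}
  add_mem' ha hb n := add_mem (ha n) (hb n)
  zero_mem' _ := zero_mem _
  smul_mem' c _ ha n := Submodule.smul_mem _ c (ha n)

/-- The inclusion of `g[-1]` in `Ŝ (g[-1])` (up to translation, of `g[1]` in `Ŝ (g[-1])[2]`). -/
def hatGen : g →ₗ[k] (ℕ → Sym 𝒢) := LinearMap.single k (fun _ : ℕ => Sym 𝒢) 1 ∘ₗ gen 𝒢

theorem gen_swap {p q : ℤ} {x y : g} (hx : x ∈ shift 𝒢 (-1) p) (hy : y ∈ shift 𝒢 (-1) q) :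
    gen 𝒢 x * gen 𝒢 y = (p * q).negOnePow • (gen 𝒢 y * gen 𝒢 x) := by
  have h : symMk 𝒢 _ = symMk 𝒢 _ := RingQuot.mkAlgHom_rel k (SymRel.swap p q x y hx hy)
  simpa [gen, Units.smul_def] using h

/-- The algebra morphism out of `S (g[-1])` that extends a linear map `f` on the generators. -/
def symLift {R : Type*} [Ring R] [Algebra k R] (f : g →ₗ[k] R)
    (hf : ∀ (p q : ℤ) (x y : g), x ∈ shift 𝒢 (-1) p → y ∈ shift 𝒢 (-1) q →
      f x * f y = (p * q).negOnePow • (f y * f x)) : Sym 𝒢 →ₐ[k] R :=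
  RingQuot.liftAlgHom k ⟨TensorAlgebra.lift k f, by
    rintro _ _ ⟨p, q, x, y, hx, hy⟩
    simpa [Units.smul_def] using hf p q x y hx hy⟩

variable [DirectSum.Decomposition 𝒢]

/-- The projection of `g` onto its part of parity `e` with respect to the degree in `g[1]`, or,
what is the same, in `g[-1]`. -/
def par (e : Fin 2) : g →ₗ[k] g :=
  DirectSum.toModule k ℤ g (fun i => if (i + 1) % 2 = (e : ℤ) then (𝒢 i).subtype else 0) ∘ₗ
    (DirectSum.decomposeLinearEquiv 𝒢).toLinearMap

/-- The parity involution `x ↦ (-1)^|x| x` of `g[-1]`. -/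
def parInv : g →ₗ[k] g := par 𝒢 0 - par 𝒢 1

theorem par_of_mem {i : ℤ} {x : g} (hx : x ∈ 𝒢 i) (e : Fin 2) :
    par 𝒢 e x = if (i + 1) % 2 = (e : ℤ) then x else 0 := by
  have h := DirectSum.decompose_of_mem 𝒢 hx
  simp only [par, LinearMap.comp_apply, LinearEquiv.coe_coe,
    DirectSum.decomposeLinearEquiv_apply, h]
  erw [DirectSum.toModule_lof]
  split_ifs <;> simp

theorem par_even {p : ℤ} {x : g} (hx : x ∈ shift 𝒢 (-1) p) (hp : Even p) :
    par 𝒢 0 x = x ∧ par 𝒢 1 x = 0 := by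
  have h := par_of_mem 𝒢 hx
  have : (-1 + p + 1) % 2 = 0 := by rw [Int.even_iff] at hp; omega
  rw [h, h, this]
  simp

theorem par_odd {p : ℤ} {x : g} (hx : x ∈ shift 𝒢 (-1) p) (hp : Odd p) :
    par 𝒢 0 x = 0 ∧ par 𝒢 1 x = x := by
  have h := par_of_mem 𝒢 hx
  have : (-1 + p + 1) % 2 = 1 := by rw [Int.odd_iff] at hp; omega
  rw [h, h, this]
  simp

theorem parInv_mem {p : ℤ} {x : g} (hx : x ∈ shift 𝒢 (-1) p) :
    parInv 𝒢 x = p.negOnePow • x := by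
  rcases Int.even_or_odd p with hp | hp
  · obtain ⟨h0, h1⟩ := par_even 𝒢 hx hp
    simp [parInv, h0, h1, Int.negOnePow_even p hp]
  · obtain ⟨h0, h1⟩ := par_odd 𝒢 hx hp
    simp [parInv, h0, h1, Int.negOnePow_odd p hp, Units.smul_def]

theorem parInv_parInv (x : g) : parInv 𝒢 (parInv 𝒢 x) = x := by
  induction x using DirectSum.Decomposition.inductionOn 𝒢 with
  | zero => simp
  | homogeneous x =>
    rename_i i
    have hx : (x : g) ∈ shift 𝒢 (-1) (i + 1) := by
      simp [shift]
    rw [parInv_mem 𝒢 hx, Units.smul_def, map_zsmul, parInv_mem 𝒢 hx, Units.smul_def, smul_smul]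
    simp
  | add x y hx hy => simp [hx, hy]

/-- The parity involution `a ↦ (-1)^|a| a` of `S (g[-1])`. -/
def symInv : Sym 𝒢 →ₐ[k] Sym 𝒢 :=
  symLift 𝒢 (gen 𝒢 ∘ₗ parInv 𝒢) (by
    intro p q x y hx hy
    simp only [LinearMap.comp_apply, parInv_mem 𝒢 hx, parInv_mem 𝒢 hy, Units.smul_def, map_zsmul,
      smul_mul_assoc, mul_smul_comm]
    rw [gen_swap 𝒢 hx hy, Units.smul_def]
    simp only [smul_smul]
    congr 1
    ring)

/-- Left multiplication by a generator `v` on `g[-1] ⊗ S (g[-1])`, with the Koszul sign: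
`x ⊗ a ↦ (-1)^(|v| |x|) x ⊗ v a`. -/
def tensorMul : g →ₗ[k] Module.End k (g ⊗[k] Sym 𝒢) :=
  let T := TensorProduct.mapBilinear (RingHom.id k) g (Sym 𝒢) g (Sym 𝒢)
  T LinearMap.id ∘ₗ LinearMap.mul k (Sym 𝒢) ∘ₗ gen 𝒢 ∘ₗ par 𝒢 0 +
    T (parInv 𝒢) ∘ₗ LinearMap.mul k (Sym 𝒢) ∘ₗ gen 𝒢 ∘ₗ par 𝒢 1

theorem tensorMul_tmul {p q : ℤ} {v x : g} (hv : v ∈ shift 𝒢 (-1) p)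
    (hx : x ∈ shift 𝒢 (-1) q) (a : Sym 𝒢) :
    tensorMul 𝒢 v (x ⊗ₜ a) = (p * q).negOnePow • (x ⊗ₜ[k] (gen 𝒢 v * a)) := by
  rcases Int.even_or_odd p with hp | hp
  · obtain ⟨h0, h1⟩ := par_even 𝒢 hv hp
    simp [tensorMul, h0, h1, Int.negOnePow_even _ (hp.mul_right q)]
  · obtain ⟨h0, h1⟩ := par_odd 𝒢 hv hp
    have : (p * q).negOnePow = q.negOnePow := by
      rcases Int.even_or_odd q with hq | hq
      · rw [Int.negOnePow_even _ hq, Int.negOnePow_even _ (hq.mul_left p)]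
      · rw [Int.negOnePow_odd _ hq, Int.negOnePow_odd _ (hp.mul hq)]
    simp [tensorMul, h0, h1, this, parInv_mem 𝒢 hx, Units.smul_def, TensorProduct.smul_tmul',
      ← Int.cast_smul_eq_zsmul k]

theorem tensorMul_swap {p q : ℤ} {v w : g} (hv : v ∈ shift 𝒢 (-1) p)
    (hw : w ∈ shift 𝒢 (-1) q) (t : g ⊗[k] Sym 𝒢) :
    tensorMul 𝒢 v (tensorMul 𝒢 w t) = (p * q).negOnePow • tensorMul 𝒢 w (tensorMul 𝒢 v t) := by
  induction t using TensorProduct.induction_on with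
  | zero => simp
  | add s t hs ht => simp only [map_add, hs, ht, smul_add]
  | tmul x a =>
    induction x using DirectSum.Decomposition.inductionOn 𝒢 with
    | zero => simp
    | add x y hx hy => simp only [TensorProduct.add_tmul, map_add, hx, hy, smul_add]
    | homogeneous x =>
      rename_i i
      have hx : (x : g) ∈ shift 𝒢 (-1) (i + 1) := by simp [shift]
      rw [tensorMul_tmul 𝒢 hw hx, tensorMul_tmul 𝒢 hv hx]
      simp only [Units.smul_def, map_zsmul]
      rw [tensorMul_tmul 𝒢 hw hx, tensorMul_tmul 𝒢 hv hx, ← mul_assoc, ← mul_assoc,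
        gen_swap 𝒢 hv hw]
      simp only [Units.smul_def, smul_mul_assoc, ← Int.cast_smul_eq_zsmul k,
        TensorProduct.tmul_smul, smul_smul]
      congr 1
      ring

/-- Auxiliary for `coprod`: the operator `(b, t) ↦ (v b, v ⊗ b + v t)`. -/
def coprodAux : g →ₗ[k] Module.End k (Sym 𝒢 × (g ⊗[k] Sym 𝒢)) where
  toFun v := LinearMap.prod (LinearMap.mul k (Sym 𝒢) (gen 𝒢 v) ∘ₗ LinearMap.fst k _ _)
    (TensorProduct.mk k g (Sym 𝒢) v ∘ₗ LinearMap.fst k _ _ +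
      tensorMul 𝒢 v ∘ₗ LinearMap.snd k _ _)
  map_add' v w := by
    ext <;> simp
  map_smul' c v := by
    ext <;> simp [TensorProduct.smul_tmul']

theorem coprodAux_swap (p q : ℤ) (x y : g) (hx : x ∈ shift 𝒢 (-1) p)
    (hy : y ∈ shift 𝒢 (-1) q) :
    coprodAux 𝒢 x * coprodAux 𝒢 y = (p * q).negOnePow • (coprodAux 𝒢 y * coprodAux 𝒢 x) := by
  refine LinearMap.ext fun ⟨b, t⟩ => ?_
  have e : ((p * q).negOnePow : ℤ) * ((p * q).negOnePow : ℤ) = 1 := by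
    rw [← Units.val_mul]; simp
  have h (v : g) (c : Sym 𝒢 × (g ⊗[k] Sym 𝒢)) :
      coprodAux 𝒢 v c = (gen 𝒢 v * c.1, v ⊗ₜ c.1 + tensorMul 𝒢 v c.2) := rfl
  simp only [Units.smul_def, Module.End.mul_apply, LinearMap.smul_apply, h, map_add]
  rw [tensorMul_swap 𝒢 hx hy, tensorMul_tmul 𝒢 hx hy, tensorMul_tmul 𝒢 hy hx, ← mul_assoc,
    ← mul_assoc, gen_swap 𝒢 hx hy, mul_comm q p]
  refine Prod.ext ?_ ?_
  · simp only [Prod.smul_mk, Units.smul_def, smul_mul_assoc]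
  · simp only [Prod.smul_mk, Units.smul_def, smul_add, smul_smul, e, one_smul]
    abel

/-- The comultiplication of `S (g[-1])` followed by the projection to the cogenerators in the
first tensor factor: `x₁ ⋯ xₙ ↦ ∑ᵢ ± xᵢ ⊗ x₁ ⋯ x̂ᵢ ⋯ xₙ` with Koszul signs.  It is the linear map
`δ` with `δ 1 = 0` and `δ (v a) = v ⊗ a + v δ(a)` for `v ∈ g[-1]`, where `v` acts on
`g[-1] ⊗ S (g[-1])` by `v (x ⊗ a) = (-1)^(|v| |x|) x ⊗ v a`. -/
def coprod : Sym 𝒢 →ₗ[k] g ⊗[k] Sym 𝒢 :=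
  LinearMap.snd k _ _ ∘ₗ LinearMap.applyₗ ((1 : Sym 𝒢), (0 : g ⊗[k] Sym 𝒢)) ∘ₗ
    (symLift 𝒢 (coprodAux 𝒢) (coprodAux_swap 𝒢)).toLinearMap

/-- The pairing `(h, x ⊗ b) ↦ h(x) b`. -/
def pairing : (g →ₗ[k] Sym 𝒢) →ₗ[k] g ⊗[k] Sym 𝒢 →ₗ[k] Sym 𝒢 :=
  LinearMap.mk₂ k (fun h t => TensorProduct.lift (LinearMap.mul k (Sym 𝒢) ∘ₗ h) t)
    (by
      intro h h' t
      induction t using TensorProduct.induction_on with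
      | zero => simp
      | add s t hs ht => rw [map_add, map_add, map_add, hs, ht]; abel
      | tmul x a => simp)
    (by
      intro c h t
      induction t using TensorProduct.induction_on with
      | zero => simp
      | add s t hs ht => rw [map_add, map_add, hs, ht, smul_add]
      | tmul x a => simp)
    (by simp) (by simp)

/-! ### The brackets of `g` extended as multiderivations -/

/-- Multilinear maps from `n` copies of `g[1]` to `S (g[-1])`. -/
abbrev Mult (n : ℕ) : Type (max u v) := MultilinearMap k (fun _ : Fin n => g) (Sym 𝒢)

/-- For homogeneous `x₁, …, xₙ` with degrees `d` in `g[1]`,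
`twist s F (x₁, …, xₙ) = s(d) F (x₁, …, xₙ)`, where the sign `s(d)` depends only on the parities
of the degrees. -/
def twist {n : ℕ} (s : (Fin n → ℤ) → ℤˣ) (F : Mult 𝒢 n) : Mult 𝒢 n :=
  ∑ e : Fin n → Fin 2, s (fun i => ((e i : ℕ) : ℤ)) • F.compLinearMap (fun i => par 𝒢 (e i))

/-- `F (-, x₁, …, xₙ)` as a linear map in the first variable. -/
def firstArg {n : ℕ} (F : Mult 𝒢 (n + 1)) :
    MultilinearMap k (fun _ : Fin n => g) (g →ₗ[k] Sym 𝒢) where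
  toFun x :=
    { toFun := fun y => F.curryLeft y x
      map_add' := by simp
      map_smul' := by simp }
  map_update_add' := by intro _ x i y z; ext; simp [-MultilinearMap.curryLeft_apply]; rfl
  map_update_smul' := by intro _ x i c y; ext; simp [-MultilinearMap.curryLeft_apply]; rfl

/-- Insertion of `a ∈ S (g[-1])` in the first slot of `F`, extended as a derivation in it:
`(x₁, …, xₙ) ↦ F (a, x₁, …, xₙ) = ∑ (-1)^(|a₂| (|x₁| + ⋯ + |xₙ|)) F (a₁, x₁, …, xₙ) a₂`, where
`∑ a₁ ⊗ a₂ = coprod a`. -/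
def insertArg (n : ℕ) : Sym 𝒢 →ₗ[k] Mult 𝒢 (n + 1) →ₗ[k] Mult 𝒢 n :=
  LinearMap.mk₂ k
    (fun a F => ∑ e : Fin n → Fin 2,
      (((pairing 𝒢).flip (LinearMap.lTensor g
        ((symInv 𝒢) ^ (∑ i, (e i : ℕ))).toLinearMap (coprod 𝒢 a))).compMultilinearMap
          (firstArg 𝒢 F)).compLinearMap (fun i => par 𝒢 (e i)))
    (by intro a b F; ext x; simp [Finset.sum_add_distrib])
    (by intro c a F; ext x; simp [Finset.smul_sum])
    (by
      intro a F G; ext x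
      simp only [sum_apply, add_apply, ← Finset.sum_add_distrib]
      refine Finset.sum_congr rfl fun e _ => ?_
      simp only [MultilinearMap.compLinearMap_apply, LinearMap.compMultilinearMap_apply,
        ← map_add]
      rfl)
    (by
      intro c a F; ext x
      simp only [sum_apply, smul_apply, Finset.smul_sum]
      refine Finset.sum_congr rfl fun e _ => ?_
      simp only [MultilinearMap.compLinearMap_apply, LinearMap.compMultilinearMap_apply,
        ← map_smul]
      rfl)

/-- The extension of `F : S^n (g[1]) → S (g[-1])[2]` to a multiderivation of `S (g[-1])`:
`(a, …, c) ↦ ∑ ± F (a₁, …, c₁) a₂ ⋯ c₂`, with Koszul signs. -/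
def ext : ∀ n : ℕ, Mult 𝒢 n →ₗ[k] MultilinearMap k (fun _ : Fin n => Sym 𝒢) (Sym 𝒢)
  | 0 =>
    { toFun := fun F => MultilinearMap.constOfIsEmpty k _ (F Fin.elim0)
      map_add' := fun _ _ => rfl
      map_smul' := fun _ _ => rfl }
  | n + 1 =>
    { toFun := fun F => LinearMap.uncurryLeft (ext n ∘ₗ (insertArg 𝒢 n).flip F)
      map_add' := by intro F G; ext x; simp
      map_smul' := by intro c F; ext x; simp }

variable (l : ∀ n : ℕ, MultilinearMap k (fun _ : Fin n => g) g)

/-- The brackets of `g`, with values in `S (g[-1])`, extended as multiderivations of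
`S (g[-1])`. -/
def symBracket (n : ℕ) : MultilinearMap k (fun _ : Fin n => Sym 𝒢) (Sym 𝒢) :=
  ext 𝒢 n ((gen 𝒢).compMultilinearMap (l n))

/-- The brackets of `Ŝ (g[-1])[1]`, the extension of `symBracket` to the completion: the bracket of
components in `S^(ν₁ + 1), …, S^(νₙ + 1)` lies in `S^(ν₁ + ⋯ + νₙ + 1)`, and the bracket vanishes if
one of the entries is in `S^0`. -/
def hatBracket (n : ℕ) : MultilinearMap k (fun _ : Fin n => ℕ → Sym 𝒢) (ℕ → Sym 𝒢) :=
  MultilinearMap.pi fun q => match q with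
    | 0 => 0
    | q + 1 => ∑ ν ∈ Finset.Nat.antidiagonalTuple n q,
        (symBracket 𝒢 l n).compLinearMap fun i => LinearMap.proj (ν i + 1)

/-- The maps `L n` are graded symmetric multiderivations of degree one of `S (g[-1])` (with
respect to the degree in `S (g[-1])[2]`) which extend the brackets `l n`. -/
structure IsMultiderivationExtension
    (L : ∀ n : ℕ, MultilinearMap k (fun _ : Fin n => Sym 𝒢) (Sym 𝒢)) : Prop where
  extends_bracket : ∀ n x, L n (fun i => gen 𝒢 (x i)) = gen 𝒢 (l n x)
  symm : ∀ n, IsGradedSymm (shift (symDeg 𝒢) 2) (L n)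
  degree : ∀ (n : ℕ) (d : Fin n → ℤ) (a : Fin n → Sym 𝒢),
    (∀ i, a i ∈ shift (symDeg 𝒢) 2 (d i)) → L n a ∈ shift (symDeg 𝒢) 2 (∑ i, d i + 1)
  leibniz : ∀ (n : ℕ) (d : Fin n → ℤ) (a : Fin n → Sym 𝒢) (p : ℤ) (b c : Sym 𝒢),
    (∀ i, a i ∈ shift (symDeg 𝒢) 2 (d i)) → b ∈ symDeg 𝒢 p →
    L (n + 1) (Fin.snoc (α := fun _ => Sym 𝒢) a (b * c)) =
      L (n + 1) (Fin.snoc (α := fun _ => Sym 𝒢) a b) * c +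
      (p * (1 + ∑ i, d i)).negOnePow • (b * L (n + 1) (Fin.snoc (α := fun _ => Sym 𝒢) a c))

/-! ### The big bracket -/

/-- The space that contains `∏_{m, n} Hom (S^m (g[1]), S^n (g[-1]))[2]`; the component with
indices `m, n` of `f` is `f m n`. -/
abbrev Big : Type (max u v) := ∀ m _n : ℕ, Mult 𝒢 m

/-- The elements of degree `e` of `ℬ⁺ = ∏_{m, n ≥ 1} Hom (S^m (g[1]), S^n (g[-1]))[2]`. -/
def bigPlus (e : ℤ) : Submodule k (Big 𝒢) where
  carrier := {f | ∀ m n : ℕ, ((m = 0 ∨ n = 0) → f m n = 0) ∧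
    IsGradedSymm (shift 𝒢 1) (f m n) ∧
    ∀ (d : Fin m → ℤ) (x : Fin m → g), (∀ i, x i ∈ shift 𝒢 1 (d i)) →
      f m n x ∈ symPart 𝒢 n (2 + (∑ i, d i + e))}
  add_mem' := by
    intro f f' hf hf' m n
    refine ⟨fun h => ?_, fun d x hx i j hij => ?_, fun d x hx => ?_⟩
    · simp [(hf m n).1 h, (hf' m n).1 h]
    · simp [(hf m n).2.1 d x hx i j hij, (hf' m n).2.1 d x hx i j hij]
    · exact add_mem ((hf m n).2.2 d x hx) ((hf' m n).2.2 d x hx)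
  zero_mem' := by
    intro m n
    refine ⟨fun h => rfl, fun d x hx i j hij => ?_, fun d x hx => zero_mem _⟩
    simp
  smul_mem' := by
    intro c f hf m n
    refine ⟨fun h => ?_, fun d x hx i j hij => ?_, fun d x hx => ?_⟩
    · simp [(hf m n).1 h]
    · simp [(hf m n).2.1 d x hx i j hij, smul_comm c]
    · exact Submodule.smul_mem _ c ((hf m n).2.2 d x hx)

/-- `x ↦ F (x_S, G (x_{Sᶜ})₁) G (x_{Sᶜ})₂`, where `∑ G₁ ⊗ G₂ = coprod G`. -/
def circTerm {n : ℕ} (S : Finset (Fin n)) :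
    Mult 𝒢 (S.card + 1) →ₗ[k] Mult 𝒢 Sᶜ.card →ₗ[k] Mult 𝒢 n :=
  LinearMap.mk₂ k
    (fun F G => (MultilinearMap.curryFinFinset k (Sym 𝒢) g rfl rfl).symm
      (LinearMap.compMultilinearMap
        { toFun := fun h => (pairing 𝒢 h ∘ₗ coprod 𝒢).compMultilinearMap G
          map_add' := by intro h h'; ext x; simp
          map_smul' := by intro c h; ext x; simp } F.curryRight))
    (by
      intro F F' G; ext x
      have h : ∀ u, (F + F').curryRight u = F.curryRight u + F'.curryRight u := fun _ => rfl
      simp [h])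
    (by
      intro c F G; ext x
      have h : ∀ u, (c • F).curryRight u = c • F.curryRight u := fun _ => rfl
      simp [h])
    (by intro F G G'; ext x; simp)
    (by intro c F G; ext x; simp)

/-- The circle product `f ∘ h` for `h` of degree `e`:
`(f ∘ h)(x₁ ⋯ xₘ) = ∑ ± f (x_S h(x_{Sᶜ})₁) h(x_{Sᶜ})₂`, the sum over all unshuffles, with the Koszul
sign of the unshuffle and the sign of the exchange of `h` and `x_S`. -/
def circ (e : ℤ) : Big 𝒢 →ₗ[k] Big 𝒢 →ₗ[k] Big 𝒢 :=
  LinearMap.mk₂ k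
    (fun f h m n => ∑ S : Finset (Fin m), ∑ ab ∈ Finset.HasAntidiagonal.antidiagonal (n + 1),
      twist 𝒢 (fun d => koszul d S * (e * ∑ i ∈ S, d i).negOnePow)
        (circTerm 𝒢 S (f (S.card + 1) ab.1) (h Sᶜ.card ab.2)))
    (by
      intro f f' h; funext m n; ext x
      simp [twist, Finset.sum_add_distrib])
    (by
      intro c f h; funext m n; ext x
      simp [twist, Finset.smul_sum, smul_comm c])
    (by
      intro f h h'; funext m n; ext x
      simp [twist, Finset.sum_add_distrib])
    (by
      intro c f h; funext m n; ext x
      simp [twist, Finset.smul_sum, smul_comm c])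

/-- The big bracket `[f, h] = f ∘ h - (-1)^(a b) h ∘ f` of `f` of degree `a` and `h` of
degree `b`. -/
def bigBracket (a b : ℤ) : Big 𝒢 →ₗ[k] Big 𝒢 →ₗ[k] Big 𝒢 :=
  LinearMap.mk₂ k (fun f h => circ 𝒢 b f h - (a * b).negOnePow • circ 𝒢 a h f)
    (by intro f f' h; simp only [map_add, LinearMap.add_apply, smul_add]; abel)
    (by intro c f h; simp only [map_smul, LinearMap.smul_apply, smul_sub, smul_comm c])
    (by intro f h h'; simp only [map_add, LinearMap.add_apply, smul_add]; abel)
    (by intro c f h; simp only [map_smul, LinearMap.smul_apply, smul_sub, smul_comm c])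

/-- The element `l₁ + l₂ + ⋯` of `ℬ⁺`. -/
def bigElement : Big 𝒢 := fun m n => if n = 1 then (gen 𝒢).compMultilinearMap (l m) else 0

/-- The differential `[l₁ + l₂ + ⋯, -]` on elements of degree `a`. -/
def bigD (a : ℤ) : Big 𝒢 →ₗ[k] Big 𝒢 := bigBracket 𝒢 1 a (bigElement 𝒢 l)

/-- The maps `φₙ (x₁ ⊙ ⋯ ⊙ xₙ)(y) = l_{n+p} (x₁ ⊙ ⋯ ⊙ xₙ ⊙ N(y))`, `y ∈ S^p (g[1])`, `p ≥ 1`, where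
`N (y₁ ⋯ yₚ) = y₁ ⊙ ⋯ ⊙ yₚ` (and no component for `p = 0`). -/
def phi (n : ℕ) : MultilinearMap k (fun _ : Fin n => ℕ → Sym 𝒢) (Big 𝒢) :=
  MultilinearMap.pi fun p => MultilinearMap.pi fun q =>
    if p = 0 then 0 else
      ((LinearMap.proj q : (ℕ → Sym 𝒢) →ₗ[k] Sym 𝒢).compMultilinearMapₗ k ∘ₗ
        MultilinearMap.compLinearMapₗ (fun _ : Fin p => hatGen 𝒢)).compMultilinearMap
          ((hatBracket 𝒢 l (n + p)).domDomCongr finSumFinEquiv.symm).currySum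

theorem phi_apply (n : ℕ) (x : Fin n → ℕ → Sym 𝒢) (p q : ℕ) (hp : p ≠ 0) (y : Fin p → g) :
    phi 𝒢 l n x p q y =
      hatBracket 𝒢 l (n + p) (Fin.append x (fun i => hatGen 𝒢 (y i))) q := by
  have h : Sum.elim x (fun i => hatGen 𝒢 (y i)) ∘ finSumFinEquiv.symm =
      Fin.append x (fun i => hatGen 𝒢 (y i)) := by
    funext i
    refine Fin.addCases (fun j => ?_) (fun j => ?_) i <;> simp
  rw [← h]
  simp [phi, hp]
  rfl

/-! ### `r_∞`-matrices and `L_∞`-bialgebras -/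

/-- The power series `r = ∑ λ^i r_i` is an `r_∞`-matrix: an element of degree one of
`λ Ŝ (g[-1])[1][[λ]]` with `l₁(r) + (1/2!) l₂(r ⊙ r) + (1/3!) l₃(r ⊙ r ⊙ r) + ⋯ = 0`. -/
def IsRInfinityMatrix (r : ℕ → ℕ → Sym 𝒢) : Prop :=
  r 0 = 0 ∧ (∀ i, r i ∈ shift (hatDeg 𝒢) 1 1) ∧ ∀ N, expSeries (hatBracket 𝒢 l) r N = 0

/-- The power series `μ = ∑ λ^i μ_i` of elements of degree one of `ℬ⁺` satisfies `[μ, μ] = 0`: it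
is an `L_∞`-bialgebra structure, depending on `λ`. -/
def IsLInfinityBialgebra (μ : ℕ → Big 𝒢) : Prop :=
  (∀ i, μ i ∈ bigPlus 𝒢 1) ∧
    ∀ N, ∑ ij ∈ Finset.HasAntidiagonal.antidiagonal N,
      bigBracket 𝒢 1 1 (μ ij.1) (μ ij.2) = 0

/-- The power series `μ' = φ (e^r) = φ₁(r) + (1/2!) φ₂(r ⊙ r) + ⋯`. -/
def transfer (r : ℕ → ℕ → Sym 𝒢) : ℕ → Big 𝒢 := expSeries (phi 𝒢 l) r

end Graded

end RInf

end

open scoped TensorProduct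

noncomputable section

namespace RInf

universe u v w

set_option linter.unusedSectionVars false

/-! ### Signs and subsets of `Fin n` -/

section Combinatorics

/-! The construction is an instance of higher derived brackets. Enlarge `ℬ⁺` to `bigHom`, which also
admits maps of arity zero. With the big bracket this is a graded Lie algebra. Its arity-zero
elements form a copy of `Ŝ (g[-1])[2]`, without the component `S^0`, and commute with one another.
The element `l = l₁ + l₂ + ⋯` satisfies `[l, l] = 0`, since this equation is the system of higher
Jacobi identities. Bracketing from the right with an arity-zero element inserts it as a derivation
(`bigIns_isDerivedAction`). Hence `[⋯[[l, x₁], x₂], ⋯, xₙ]` is `l` with `x₁, …, xₙ` inserted: its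
arity-zero part is the bracket of `x₁, …, xₙ` in `Ŝ`, and its part of positive arity is `φₙ`
(`iter_bigIns_eq`).

Now insert `x₁, …, xₙ` into `[l, l] = 0`. Insertions are graded derivations of the bracket, so a sum
over unshuffles of brackets of elements `φ + emb L` vanishes. Brackets of two embedded elements are
zero, and a mixed term inserts `L (x_S)` into a further iterated bracket (`derived_identity`). In
arity zero the brackets `[φ, φ]` do not contribute, because `ℬ⁺` is closed under the bracket, and
what remains is the `L_∞`-structure on `Ŝ`. In positive arity one obtains the morphism equation; the
empty and the full subset contribute `d φₙ`, because `φ₀ = l`. The statements on graded Lie algebras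
are the same computation with one or two insertions.

For a series `r` of degree zero in `Ŝ (g[-1])[2]`, the exponential of the action of `r` sends `l` to
`l + φ(e^r)` plus the embedded Maurer-Cartan expression of `r`. If `r` is an `r_∞`-matrix, then `μ =
exp(r) l` (`transfer_add_single`), and `[μ, μ]` is the exponential applied to `[l, l] = 0`
(`seriesBr_exp`).

The remaining input is the Jacobi identity of the big bracket. Triple shuffles are avoided: filling
the first argument with `y` is a graded derivation of the circle product (`contract_famCirc`), and a
family of maps is determined by its iterated contractions, so symmetry and the Jacobi identity
reduce to arity zero. There the circle product applies a derivation of `S (g[-1])` to an element.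
The commutator of two derivations is a derivation determined on generators, and the second-order
terms that are left over are symmetric and cancel (`ev0_famJac`). -/

theorem map_units_smul {A B F : Type*} [AddCommGroup A] [AddCommGroup B] [FunLike F A B]
    [AddMonoidHomClass F A B] (f : F) (s : ℤˣ) (x : A) : f (s • x) = s • f x := by
  rw [Units.smul_def, Units.smul_def, map_zsmul]

theorem units_smul_comm {k A : Type*} [Ring k] [AddCommGroup A] [Module k A] (s : ℤˣ) (c : k)
    (x : A) : s • c • x = c • s • x := by
  rw [Units.smul_def, Units.smul_def, smul_comm]

theorem linear_units_smul_apply {k A B : Type*} [Field k] [AddCommGroup A] [Module k A]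
    [AddCommGroup B] [Module k B] (s : ℤˣ) (f : A →ₗ[k] B) (x : A) : (s • f) x = s • f x :=
  rfl

theorem units_smul_mem {k A : Type*} [Ring k] [AddCommGroup A] [Module k A]
    {P : Submodule k A} (s : ℤˣ) {x : A} (hx : x ∈ P) : s • x ∈ P := by
  rw [Units.smul_def]
  exact zsmul_mem hx _

/-- Comparisons of Koszul signs are reduced by this to propositional statements about parities,
mostly settled by `tauto`. -/
theorem negOnePow_congr {a b : ℤ} (h : Even a ↔ Even b) : a.negOnePow = b.negOnePow := by
  rw [Int.negOnePow_eq_iff, Int.even_sub]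
  exact h

/-- The subset `{i + 1 | i ∈ S}` of `{0, …, n}`. -/
def succSet {n : ℕ} (S : Finset (Fin n)) : Finset (Fin (n + 1)) := S.map (Fin.succEmb n)

/-- The subset `{0} ∪ {i + 1 | i ∈ S}` of `{0, …, n}`. -/
def consSet {n : ℕ} (S : Finset (Fin n)) : Finset (Fin (n + 1)) := insert 0 (succSet S)

variable {n : ℕ} (S : Finset (Fin n))

@[simp] theorem succ_mem_succSet (i : Fin n) : i.succ ∈ succSet S ↔ i ∈ S := by
  simp [succSet]

@[simp] theorem zero_notMem_succSet : (0 : Fin (n + 1)) ∉ succSet S := by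
  simp [succSet]

@[simp] theorem succ_mem_consSet (i : Fin n) : i.succ ∈ consSet S ↔ i ∈ S := by
  simp [consSet]

@[simp] theorem zero_mem_consSet : (0 : Fin (n + 1)) ∈ consSet S := by
  simp [consSet]

@[simp] theorem compl_succSet : (succSet S)ᶜ = consSet Sᶜ := by
  ext i
  refine Fin.cases ?_ (fun i => ?_) i <;> simp

@[simp] theorem compl_consSet : (consSet S)ᶜ = succSet Sᶜ := by
  ext i
  refine Fin.cases ?_ (fun i => ?_) i <;> simp

theorem card_succSet : (succSet S).card = S.card := by simp [succSet]

theorem card_consSet : (consSet S).card = S.card + 1 := by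
  rw [consSet, Finset.card_insert_of_notMem (zero_notMem_succSet S), card_succSet]

theorem eq_succSet_or_consSet (T : Finset (Fin (n + 1))) :
    ∃ S, T = succSet S ∨ T = consSet S := by
  refine ⟨Finset.univ.filter fun i => i.succ ∈ T, ?_⟩
  by_cases h : (0 : Fin (n + 1)) ∈ T
  · right
    ext i
    refine Fin.cases ?_ (fun i => ?_) i <;> simp [h]
  · left
    ext i
    refine Fin.cases ?_ (fun i => ?_) i <;> simp [h]

theorem succSet_injective : Function.Injective (succSet (n := n)) := by
  intro S T h
  ext i
  rw [← succ_mem_succSet, h, succ_mem_succSet]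

theorem consSet_injective : Function.Injective (consSet (n := n)) := by
  intro S T h
  ext i
  rw [← succ_mem_consSet, h, succ_mem_consSet]

/-- This is the induction step for sums over unshuffles: the first argument goes either to the first
block or to the second. It matches the two terms of the Leibniz rule for a derivation. -/
theorem sum_finset_fin_succ {A : Type*} [AddCommMonoid A] (Q : Finset (Fin (n + 1)) → A) :
    ∑ T, Q T = ∑ S, Q (consSet S) + ∑ S, Q (succSet S) := by
  rw [← Finset.sum_image (f := Q) (fun _ _ _ _ h => consSet_injective h),
    ← Finset.sum_image (f := Q) (fun _ _ _ _ h => succSet_injective h), ← Finset.sum_union]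
  · congr 1
    ext T
    obtain ⟨S, rfl | rfl⟩ := eq_succSet_or_consSet T <;> simp
  · rw [Finset.disjoint_left]
    rintro _ h h'
    simp only [Finset.mem_image, Finset.mem_univ, true_and] at h h'
    obtain ⟨S, rfl⟩ := h
    obtain ⟨T, hT⟩ := h'
    exact zero_notMem_succSet T (hT ▸ zero_mem_consSet S)

theorem sum_succSet {A : Type*} [AddCommMonoid A] (d : Fin (n + 1) → A) :
    ∑ i ∈ succSet S, d i = ∑ i ∈ S, d i.succ := by
  simp [succSet]

theorem sum_consSet {A : Type*} [AddCommMonoid A] (d : Fin (n + 1) → A) :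
    ∑ i ∈ consSet S, d i = d 0 + ∑ i ∈ S, d i.succ := by
  rw [consSet, Finset.sum_insert (zero_notMem_succSet S), sum_succSet]

/-- The first element already stands in front, so it passes nothing. -/
theorem koszul_consSet (d : Fin (n + 1) → ℤ) :
    koszul d (consSet S) = koszul (fun i => d i.succ) S := by
  unfold koszul
  rw [compl_consSet, consSet, Finset.prod_insert (zero_notMem_succSet S)]
  rw [Finset.filter_false_of_mem (by simp), Finset.prod_empty, one_mul, succSet,
    Finset.prod_map]
  refine Finset.prod_congr rfl fun i _ => ?_
  rw [succSet, Finset.filter_map, Finset.prod_map]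
  simp [Function.comp_def]

theorem prod_negOnePow {ι : Type*} (S : Finset ι) (d : ι → ℤ) :
    ∏ i ∈ S, (d i).negOnePow = (∑ i ∈ S, d i).negOnePow := by
  classical
  induction S using Finset.induction_on with
  | empty => simp
  | insert i S hi ih => rw [Finset.prod_insert hi, Finset.sum_insert hi, Int.negOnePow_add, ih]

/-- The first element belongs to the second block and has to pass all of `x_S`. -/
theorem koszul_succSet (d : Fin (n + 1) → ℤ) :
    koszul d (succSet S) =
      koszul (fun i => d i.succ) S * (d 0 * ∑ i ∈ S, d i.succ).negOnePow := by
  unfold koszul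
  rw [compl_succSet, consSet, Finset.mul_sum, ← prod_negOnePow, ← Finset.prod_mul_distrib,
    succSet, Finset.prod_map]
  refine Finset.prod_congr rfl fun i _ => ?_
  rw [Finset.filter_insert, if_pos (by simp),
    Finset.prod_insert (fun h => zero_notMem_succSet _ (Finset.mem_filter.1 h).1), succSet,
    Finset.filter_map, Finset.prod_map, mul_comm]
  simp [Function.comp_def, mul_comm]

theorem koszul_fin_zero (d : Fin 0 → ℤ) (T : Finset (Fin 0)) : koszul d T = 1 := by
  simp [koszul, Finset.eq_empty_of_isEmpty T]

/-- The two unshuffles differ by the exchange of the blocks `x_S` and `x_{Sᶜ}`. -/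
theorem koszul_compl {n : ℕ} (d : Fin n → ℤ) (T : Finset (Fin n)) :
    koszul d Tᶜ = koszul d T * ((∑ i ∈ T, d i) * ∑ i ∈ Tᶜ, d i).negOnePow := by
  induction n with
  | zero => simp [koszul_fin_zero, Finset.eq_empty_of_isEmpty T]
  | succ n ih =>
    obtain ⟨S, rfl | rfl⟩ := eq_succSet_or_consSet T
    · rw [compl_succSet, koszul_succSet, koszul_consSet, sum_consSet, sum_succSet, ih, mul_assoc,
        ← Int.negOnePow_add]
      congr 1
      apply negOnePow_congr
      simp only [Int.even_add, Int.even_mul]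
      tauto
    · rw [compl_consSet, koszul_succSet, koszul_consSet, sum_consSet, sum_succSet, ih, mul_assoc,
        ← Int.negOnePow_add]
      congr 1
      apply negOnePow_congr
      simp only [Int.even_add, Int.even_mul]
      tauto

theorem koszul_empty (d : Fin n → ℤ) : koszul d ∅ = 1 := by simp [koszul]

theorem koszul_univ (d : Fin n → ℤ) : koszul d Finset.univ = 1 := by simp [koszul]

/-! ### Families of functions of all arities evaluated on subfamilies -/

variable {E : Type*}

/-- The type of `sub x S` depends on `S.card`, so an equality of cardinalities cannot be rewritten
in it in isolation. A family `P` over all arities absorbs the dependence, and the increasing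
enumeration of `S` is unique. -/
theorem apply_sub {M : Type*} (P : ∀ n : ℕ, (Fin n → E) → M) {N : ℕ} (x : Fin n → E)
    (f : Fin N → Fin n) (hf : StrictMono f) (hS : ∀ i, f i ∈ S) (hN : S.card = N) :
    P S.card (sub x S) = P N (x ∘ f) := by
  subst hN
  rw [Finset.orderEmbOfFin_unique rfl hS hf]
  rfl

theorem apply_sub_succSet {M : Type*} (P : ∀ n : ℕ, (Fin n → E) → M) (x : Fin (n + 1) → E) :
    P (succSet S).card (sub x (succSet S)) = P S.card (sub (fun i => x i.succ) S) := by
  rw [apply_sub (succSet S) P x (fun i => (S.orderEmbOfFin rfl i).succ) _ _ (card_succSet S)]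
  · rfl
  · exact fun i j h => Fin.succ_lt_succ_iff.2 ((S.orderEmbOfFin rfl).strictMono h)
  · intro i
    simp

theorem apply_sub_consSet {M : Type*} (P : ∀ n : ℕ, (Fin n → E) → M) (x : Fin (n + 1) → E) :
    P (consSet S).card (sub x (consSet S)) =
      P (S.card + 1) (Fin.cons (x 0) (sub (fun i => x i.succ) S)) := by
  rw [apply_sub (consSet S) P x (Fin.cons 0 fun i => (S.orderEmbOfFin rfl i).succ) _ _
    (card_consSet S)]
  · congr 1
    funext i
    refine Fin.cases ?_ (fun i => ?_) i <;> simp [sub]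
  · intro i j
    refine Fin.cases ?_ (fun i => ?_) i <;> refine Fin.cases ?_ (fun j => ?_) j <;> simp
  · intro i
    refine Fin.cases ?_ (fun i => ?_) i <;> simp

theorem apply_sub_univ {M : Type*} (P : ∀ n : ℕ, (Fin n → E) → M) (x : Fin n → E) :
    P (Finset.univ : Finset (Fin n)).card (sub x Finset.univ) = P n x := by
  rw [apply_sub Finset.univ P x id strictMono_id (by simp) (by simp)]
  rfl

theorem apply_sub_empty {M : Type*} (P : ∀ n : ℕ, (Fin n → E) → M) (x : Fin n → E) (z : Fin 0 → E) :
    P (∅ : Finset (Fin n)).card (sub x ∅) = P 0 z := by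
  rw [apply_sub ∅ P x Fin.elim0 (fun i => i.elim0) (fun i => i.elim0) (by simp)]
  congr 1
  exact Subsingleton.elim _ _

theorem sub_mem {k : Type*} [Field k] {E : Type*} [AddCommGroup E] [Module k E]
    {𝒱 : ℤ → Submodule k E} {d : Fin n → ℤ} {x : Fin n → E} (hx : ∀ i, x i ∈ 𝒱 (d i)) (i) :
    sub x S i ∈ 𝒱 (sub d S i) := hx _

theorem sum_sub (d : Fin n → ℤ) : ∑ i, sub d S i = ∑ i ∈ S, d i := by
  conv_rhs => rw [← Finset.sum_coe_sort]
  exact Fintype.sum_equiv (S.orderIsoOfFin rfl).toEquiv _ _ (fun i => rfl)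

end Combinatorics

/-! ### Iterated actions -/

section Iter

variable {E M : Type*}

/-- The iterated action `x₁, …, xₙ, F ↦ xₙ ⋯ x₁ F`. -/
def iter (act : E → M → M) : ∀ n : ℕ, (Fin n → E) → M → M
  | 0, _, F => F
  | n + 1, x, F => iter act n (fun i => x i.succ) (act (x 0) F)

theorem iter_cons (act : E → M → M) {n : ℕ} (a : E) (x : Fin n → E) (F : M) :
    iter act (n + 1) (Fin.cons a x) F = iter act n x (act a F) := by
  simp [iter]

theorem iter_snoc (act : E → M → M) {n : ℕ} (x : Fin n → E) (a : E) (F : M) :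
    iter act (n + 1) (Fin.snoc (α := fun _ => E) x a) F = act a (iter act n x F) := by
  induction n generalizing F with
  | zero => simp [iter, Fin.snoc]
  | succ n ih =>
    have h : Fin.snoc (α := fun _ => E) x a =
        Fin.cons (x 0) (Fin.snoc (α := fun _ => E) (fun i => x i.succ) a) := by
      rw [Fin.cons_snoc_eq_snoc_cons]
      congr 1
      exact (Fin.cons_self_tail x).symm
    rw [h, iter_cons, ih]
    rfl

theorem iter_append (act : E → M → M) {n m : ℕ} (x : Fin n → E) (y : Fin m → E) (F : M) :
    iter act (n + m) (Fin.append x y) F = iter act m y (iter act n x F) := by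
  induction m with
  | zero =>
    have h : Fin.append x y = x := by
      rw [Subsingleton.elim y Fin.elim0, Fin.append_elim0]
      rfl
    rw [h]
    rfl
  | succ m ih =>
    have h : y = Fin.snoc (α := fun _ => E) (Fin.init y) (y (Fin.last m)) := by simp
    rw [h, iter_snoc, ← ih, Fin.append_snoc]
    exact iter_snoc act _ _ _

theorem iter_units_smul {k : Type*} [Field k] [AddCommGroup M] [Module k M] (act : E → M →ₗ[k] M)
    {n : ℕ} (x : Fin n → E) (s : ℤˣ) (F : M) :
    iter (fun a F => act a F) n x (s • F) = s • iter (fun a F => act a F) n x F := by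
  induction n generalizing F with
  | zero => rfl
  | succ n ih => simp only [iter, map_units_smul, ih]

theorem iter_add {k : Type*} [Field k] [AddCommGroup M] [Module k M] (act : E → M →ₗ[k] M)
    {n : ℕ} (x : Fin n → E) (F G : M) :
    iter (fun a F => act a F) n x (F + G) =
      iter (fun a F => act a F) n x F + iter (fun a F => act a F) n x G := by
  induction n generalizing F G with
  | zero => rfl
  | succ n ih => simp only [iter, map_add, ih]

variable {k : Type*} [Field k] [AddCommGroup E] [Module k E] [AddCommGroup M] [Module k M]

/-- The operators `act a` for homogeneous `a` commute in the graded sense on the homogeneous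
elements of `M`. -/
structure GradedAction (𝒱 : ℤ → Submodule k E) (ℳ : ℤ → Submodule k M)
    (act : E → M →ₗ[k] M) : Prop where
  mem : ∀ {e p a F}, F ∈ ℳ e → a ∈ 𝒱 p → act a F ∈ ℳ (e + p)
  swap : ∀ {e p q a b F}, F ∈ ℳ e → a ∈ 𝒱 p → b ∈ 𝒱 q →
    act b (act a F) = (p * q).negOnePow • act a (act b F)

namespace GradedAction

variable {𝒱 : ℤ → Submodule k E} {ℳ : ℤ → Submodule k M} {act : E → M →ₗ[k] M}

theorem iter_mem (h : GradedAction 𝒱 ℳ act) {n : ℕ} {d : Fin n → ℤ} {x : Fin n → E}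
    (hx : ∀ i, x i ∈ 𝒱 (d i)) {e : ℤ} {F : M} (hF : F ∈ ℳ e) :
    iter (fun a F => act a F) n x F ∈ ℳ (e + ∑ i, d i) := by
  induction n generalizing e F with
  | zero => simpa [iter] using hF
  | succ n ih =>
    rw [Fin.sum_univ_succ, ← add_assoc]
    exact ih (fun i => hx i.succ) (h.mem hF (hx 0))

/-- The operator of `b` is moved inwards past those of all `xᵢ`, collecting one sign for each. -/
theorem act_iter (h : GradedAction 𝒱 ℳ act) {n : ℕ} {d : Fin n → ℤ} {x : Fin n → E}
    (hx : ∀ i, x i ∈ 𝒱 (d i)) {e q : ℤ} {F : M} (hF : F ∈ ℳ e) {b : E} (hb : b ∈ 𝒱 q) :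
    act b (iter (fun a F => act a F) n x F) =
      (q * ∑ i, d i).negOnePow • iter (fun a F => act a F) n x (act b F) := by
  induction n generalizing e F with
  | zero => simp [iter]
  | succ n ih =>
    simp only [iter]
    rw [ih (fun i => hx i.succ) (h.mem hF (hx 0)), h.swap hF (hx 0) hb, iter_units_smul, smul_smul,
      ← Int.negOnePow_add, Fin.sum_univ_succ]
    congr 2
    ring

theorem iter_swap (h : GradedAction 𝒱 ℳ act) {n : ℕ} {d : Fin n → ℤ} {x : Fin n → E}
    (hx : ∀ i, x i ∈ 𝒱 (d i)) {e : ℤ} {F : M} (hF : F ∈ ℳ e) {i j : Fin n}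
    (hij : (i : ℕ) + 1 = j) :
    iter (fun a F => act a F) n (x ∘ Equiv.swap i j) F =
      (d i * d j).negOnePow • iter (fun a F => act a F) n x F := by
  induction n generalizing e F with
  | zero => exact i.elim0
  | succ n ih =>
    obtain ⟨j, rfl⟩ : ∃ j', j = Fin.succ j' :=
      ⟨_, (Fin.succ_pred j (by rintro rfl; simp at hij)).symm⟩
    -- Either the two neighbours are the first two arguments, where the axiom `swap` applies
    -- directly, or both lie in the tail and the induction hypothesis applies.
    rcases Fin.eq_zero_or_eq_succ i with rfl | ⟨i, rfl⟩
    · obtain ⟨n, rfl⟩ : ∃ m, n = m + 1 := ⟨n - 1, by have := j.pos; omega⟩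
      have hj : j = 0 := by
        apply Fin.ext
        simp only [Fin.val_succ, Fin.val_zero] at hij ⊢
        omega
      subst hj
      have h2 (m : Fin n) : Equiv.swap (0 : Fin (n + 2)) (Fin.succ 0) m.succ.succ = m.succ.succ :=
        Equiv.swap_apply_of_ne_of_ne (Fin.succ_ne_zero _)
          (fun h => Fin.succ_ne_zero _ (Fin.succ_injective _ h))
      simp only [iter, Function.comp_apply, Equiv.swap_apply_left, Equiv.swap_apply_right, h2]
      rw [h.swap hF (hx _) (hx _), iter_units_smul, mul_comm]
    · have h0 : Equiv.swap i.succ j.succ 0 = 0 :=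
        Equiv.swap_apply_of_ne_of_ne (Fin.succ_ne_zero _).symm (Fin.succ_ne_zero _).symm
      have h2 (m : Fin n) : Equiv.swap i.succ j.succ m.succ = (Equiv.swap i j m).succ := by
        simp only [Equiv.swap_apply_def, Fin.succ_inj]
        split_ifs <;> rfl
      simp only [iter, Function.comp_apply, h0, h2]
      exact ih (fun i => hx i.succ) (h.mem hF (hx 0)) (by simpa using hij)

end GradedAction

end Iter

/-! ### The graded symmetric algebra -/

section SymmetricAlgebra

variable {k : Type u} [Field k] {g : Type v} [AddCommGroup g] [Module k g]
  {𝒢 : ℤ → Submodule k g}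

theorem mem_shift_one {p : ℤ} {y : g} : y ∈ shift 𝒢 1 p ↔ y ∈ shift 𝒢 (-1) (2 + p) := by
  have : (1 : ℤ) + p = -1 + (2 + p) := by ring
  simp only [shift, this]

theorem one_mem_symPart : (1 : Sym 𝒢) ∈ symPart 𝒢 0 0 :=
  Submodule.subset_span ⟨Fin.elim0, Fin.elim0, fun i => i.elim0, by simp, by simp⟩

/-- Monomials are built by left multiplication with generators, which is the recursion that
characterizes `coprod`. The number of factors and the degree are arguments of the motive, because
both change in each step. -/
theorem symPart_induction {C : ℕ → ℤ → Sym 𝒢 → Prop} (one : C 0 0 1)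
    (mul : ∀ n p q v a, v ∈ shift 𝒢 (-1) p → a ∈ symPart 𝒢 n q → C n q a →
      C (n + 1) (p + q) (gen 𝒢 v * a))
    (zero : ∀ n p, C n p 0) (add : ∀ n p a b, C n p a → C n p b → C n p (a + b))
    (smul : ∀ n p (c : k) a, C n p a → C n p (c • a)) {n : ℕ} {p : ℤ} {a : Sym 𝒢}
    (ha : a ∈ symPart 𝒢 n p) : C n p a := by
  have key : ∀ (n : ℕ) (d : Fin n → ℤ) (x : Fin n → g), (∀ i, x i ∈ shift 𝒢 (-1) (d i)) →
      C n (∑ i, d i) (List.ofFn fun i => gen 𝒢 (x i)).prod := by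
    intro n
    induction n with
    | zero => intro d x _; simpa using one
    | succ n ih =>
      intro d x hx
      rw [List.ofFn_succ, List.prod_cons, Fin.sum_univ_succ]
      exact mul _ _ _ _ _ (hx 0) (Submodule.subset_span ⟨_, _, fun i => hx i.succ, rfl, rfl⟩)
        (ih _ _ fun i => hx i.succ)
  refine Submodule.span_induction ?_ (zero n p) (fun a b _ _ => add n p a b)
    (fun c a _ => smul n p c a) ha
  rintro _ ⟨d, x, hx, rfl, rfl⟩
  exact key n d x hx

theorem gen_mul_mem_symPart {n : ℕ} {p q : ℤ} {v : g} {a : Sym 𝒢} (hv : v ∈ shift 𝒢 (-1) p)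
    (ha : a ∈ symPart 𝒢 n q) : gen 𝒢 v * a ∈ symPart 𝒢 (n + 1) (p + q) := by
  refine Submodule.span_induction (p := fun a _ => gen 𝒢 v * a ∈ symPart 𝒢 (n + 1) (p + q))
    ?_ ?_ ?_ ?_ ha
  · rintro _ ⟨d, x, hx, rfl, rfl⟩
    refine Submodule.subset_span ⟨Fin.cons p d, Fin.cons v x, ?_, ?_, ?_⟩
    · intro i
      refine Fin.cases ?_ (fun i => ?_) i
      · simpa using hv
      · simpa using hx i
    · simp [Fin.sum_univ_succ]
    · simp [List.ofFn_succ]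
  · simp
  · intro a b _ _ ha hb
    rw [mul_add]
    exact add_mem ha hb
  · intro c a _ ha
    rw [mul_smul_comm]
    exact Submodule.smul_mem _ c ha

theorem gen_mem_symPart {p : ℤ} {v : g} (hv : v ∈ shift 𝒢 (-1) p) :
    gen 𝒢 v ∈ symPart 𝒢 1 p := by
  simpa using gen_mul_mem_symPart hv one_mem_symPart

theorem mul_mem_symPart {m n : ℕ} {p q : ℤ} {a b : Sym 𝒢} (ha : a ∈ symPart 𝒢 m p)
    (hb : b ∈ symPart 𝒢 n q) : a * b ∈ symPart 𝒢 (m + n) (p + q) := by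
  refine symPart_induction (C := fun m p a => a * b ∈ symPart 𝒢 (m + n) (p + q))
    ?_ ?_ ?_ ?_ ?_ ha
  · simpa using hb
  · intro m p r v a hv _ h
    have h' := gen_mul_mem_symPart hv h
    rwa [← add_assoc, ← mul_assoc, add_right_comm m n 1] at h'
  · simp
  · intro m p a a' h h'
    rw [add_mul]
    exact add_mem h h'
  · intro m p c a h
    rw [smul_mul_assoc]
    exact Submodule.smul_mem _ c h

theorem symPart_le_symDeg (n : ℕ) (p : ℤ) : symPart 𝒢 n p ≤ symDeg 𝒢 p :=
  le_iSup (fun n => symPart 𝒢 n p) n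

theorem gen_mul_mem_symDeg {p q : ℤ} {v : g} {a : Sym 𝒢} (hv : v ∈ shift 𝒢 (-1) p)
    (ha : a ∈ symDeg 𝒢 q) : gen 𝒢 v * a ∈ symDeg 𝒢 (p + q) := by
  refine Submodule.iSup_induction (fun n => symPart 𝒢 n q)
    (motive := fun a => gen 𝒢 v * a ∈ symDeg 𝒢 (p + q)) ha ?_ ?_ ?_
  · exact fun n a ha => symPart_le_symDeg _ _ (gen_mul_mem_symPart hv ha)
  · simp
  · intro a b ha hb
    rw [mul_add]
    exact add_mem ha hb

theorem symDeg_induction {C : ℤ → Sym 𝒢 → Prop} (one : C 0 1)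
    (mul : ∀ p q v a, v ∈ shift 𝒢 (-1) p → a ∈ symDeg 𝒢 q → C q a →
      C (p + q) (gen 𝒢 v * a))
    (zero : ∀ p, C p 0) (add : ∀ p a b, C p a → C p b → C p (a + b))
    (smul : ∀ p (c : k) a, C p a → C p (c • a)) {p : ℤ} {a : Sym 𝒢}
    (ha : a ∈ symDeg 𝒢 p) : C p a := by
  refine Submodule.iSup_induction (fun n => symPart 𝒢 n p) (motive := C p) ha ?_ (zero p) (add p)
  exact fun n a ha => symPart_induction (C := fun _ => C) one
    (fun n p q v a hv ha h => mul p q v a hv (symPart_le_symDeg _ _ ha) h)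
    (fun _ => zero) (fun _ => add) (fun _ => smul) ha

theorem mul_mem_symDeg {p q : ℤ} {a b : Sym 𝒢} (ha : a ∈ symDeg 𝒢 p)
    (hb : b ∈ symDeg 𝒢 q) : a * b ∈ symDeg 𝒢 (p + q) := by
  refine symDeg_induction (C := fun p a => a * b ∈ symDeg 𝒢 (p + q)) ?_ ?_ ?_ ?_ ?_ ha
  · simpa using hb
  · intro p r v a hv _ h
    rw [mul_assoc, add_assoc]
    exact gen_mul_mem_symDeg hv h
  · simp
  · intro p a a' h h'
    rw [add_mul]
    exact add_mem h h'
  · intro p c a h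
    rw [smul_mul_assoc]
    exact Submodule.smul_mem _ c h

theorem units_smul_mul (s : ℤˣ) (a b : Sym 𝒢) : (s • a) * b = s • (a * b) := by
  simp only [Units.smul_def, smul_mul_assoc]

theorem mul_units_smul (s : ℤˣ) (a b : Sym 𝒢) : a * (s • b) = s • (a * b) := by
  simp only [Units.smul_def, mul_smul_comm]

theorem gen_mul_comm {p q : ℤ} {v : g} {a : Sym 𝒢} (hv : v ∈ shift 𝒢 (-1) p)
    (ha : a ∈ symDeg 𝒢 q) : gen 𝒢 v * a = (p * q).negOnePow • (a * gen 𝒢 v) := by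
  refine symDeg_induction (C := fun q a => gen 𝒢 v * a = (p * q).negOnePow • (a * gen 𝒢 v))
    ?_ ?_ ?_ ?_ ?_ ha
  · simp
  · intro r q w a hw _ h
    rw [← mul_assoc, gen_swap 𝒢 hv hw, units_smul_mul, mul_assoc, h, mul_units_smul, smul_smul,
      ← Int.negOnePow_add, mul_add, mul_assoc]
  · simp
  · intro q a b ha hb
    rw [mul_add, add_mul, ha, hb, smul_add]
  · intro q c a h
    rw [mul_smul_comm, smul_mul_assoc, h, units_smul_comm]

theorem symDeg_mul_comm {p q : ℤ} {a b : Sym 𝒢} (ha : a ∈ symDeg 𝒢 p) (hb : b ∈ symDeg 𝒢 q) :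
    a * b = (p * q).negOnePow • (b * a) := by
  refine symDeg_induction (C := fun p a => a * b = (p * q).negOnePow • (b * a)) ?_ ?_ ?_ ?_ ?_ ha
  · simp
  · intro r p w a hw _ h
    rw [mul_assoc, h, mul_units_smul, ← mul_assoc, gen_mul_comm hw hb, units_smul_mul, smul_smul,
      ← Int.negOnePow_add, mul_assoc, add_mul, add_comm]
  · simp
  · intro q a b ha hb
    rw [mul_add, add_mul, ha, hb, smul_add]
  · intro q c a h
    rw [mul_smul_comm, smul_mul_assoc, h, units_smul_comm]

/-- The elements of degree `p` of `g[-1] ⊗ P`, for a family of subspaces `P` of `S (g[-1])`. -/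
def tens (P : ℤ → Submodule k (Sym 𝒢)) (p : ℤ) : Submodule k (g ⊗[k] Sym 𝒢) :=
  Submodule.span k {t | ∃ (q r : ℤ) (x : g) (b : Sym 𝒢), x ∈ shift 𝒢 (-1) q ∧ b ∈ P r ∧
    q + r = p ∧ t = x ⊗ₜ b}

theorem tmul_mem_tens {P : ℤ → Submodule k (Sym 𝒢)} {q r : ℤ} {x : g} {b : Sym 𝒢}
    (hx : x ∈ shift 𝒢 (-1) q) (hb : b ∈ P r) : x ⊗ₜ[k] b ∈ tens P (q + r) :=
  Submodule.subset_span ⟨q, r, x, b, hx, hb, rfl, rfl⟩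

theorem tens_mono {P Q : ℤ → Submodule k (Sym 𝒢)} (h : ∀ p, P p ≤ Q p) (p : ℤ) :
    tens P p ≤ tens Q p := by
  refine Submodule.span_mono ?_
  rintro _ ⟨q, r, x, b, hx, hb, e, rfl⟩
  exact ⟨q, r, x, b, hx, h _ hb, e, rfl⟩

/-- A linear map `g[-1] → S (g[-1])` of degree `c` with values in `P`. -/
def HasDegree (P : ℤ → Submodule k (Sym 𝒢)) (c : ℤ) (φ : g →ₗ[k] Sym 𝒢) : Prop :=
  ∀ q x, x ∈ shift 𝒢 (-1) q → φ x ∈ P (q + c)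

variable [DirectSum.Decomposition 𝒢]

theorem homogeneous_induction {C : g → Prop} (zero : C 0)
    (hom : ∀ p x, x ∈ shift 𝒢 1 p → C x) (add : ∀ x y, C x → C y → C (x + y)) (x : g) : C x := by
  induction x using DirectSum.Decomposition.inductionOn 𝒢 with
  | zero => exact zero
  | homogeneous x =>
    rename_i i
    exact hom (i - 1) _ (by simp [shift])
  | add x y hx hy => exact add x y hx hy

theorem pairing_tmul (φ : g →ₗ[k] Sym 𝒢) (x : g) (b : Sym 𝒢) :
    pairing 𝒢 φ (x ⊗ₜ b) = φ x * b := by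
  simp [pairing]

theorem symLift_gen {R : Type*} [Ring R] [Algebra k R] (f : g →ₗ[k] R) (hf) (v : g) :
    symLift 𝒢 f hf (gen 𝒢 v) = f v := by
  refine (RingQuot.liftAlgHom_mkAlgHom_apply k (TensorAlgebra.lift k f) _ _).trans ?_
  simp

theorem sym_induction {C : Sym 𝒢 → Prop} (algebraMap : ∀ c : k, C (algebraMap k (Sym 𝒢) c))
    (gen : ∀ v, C (gen 𝒢 v)) (mul : ∀ a b, C a → C b → C (a * b))
    (add : ∀ a b, C a → C b → C (a + b)) (a : Sym 𝒢) : C a := by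
  obtain ⟨t, rfl⟩ : ∃ t, symMk 𝒢 t = a := RingQuot.mkAlgHom_surjective k (SymRel 𝒢) a
  induction t using TensorAlgebra.induction with
  | algebraMap c => rw [AlgHom.commutes]; exact algebraMap c
  | ι v => exact gen v
  | mul s t hs ht => rw [map_mul]; exact mul _ _ hs ht
  | add s t hs ht => rw [map_add]; exact add _ _ hs ht

theorem coprod_one : coprod 𝒢 1 = 0 := by
  simp [coprod]

theorem coprod_gen_mul (v : g) (a : Sym 𝒢) :
    coprod 𝒢 (gen 𝒢 v * a) = v ⊗ₜ a + tensorMul 𝒢 v (coprod 𝒢 a) := by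
  -- The first component of the operator attached to `a` is left multiplication by `a`. Evaluation
  -- at `(1, 0)` therefore gives the pair `(a, coprod a)`, and the recursion can be read off from
  -- the second component.
  have h : ∀ a c, (symLift 𝒢 (coprodAux 𝒢) (coprodAux_swap 𝒢) a c).1 = a * c.1 := by
    intro a
    induction a using sym_induction with
    | algebraMap c => intro b; simp [Algebra.algebraMap_eq_smul_one]
    | gen v => intro b; rw [symLift_gen]; rfl
    | mul a b ha hb => intro c; rw [map_mul, Module.End.mul_apply, ha, hb, mul_assoc]
    | add a b ha hb => intro c; rw [map_add, LinearMap.add_apply, Prod.fst_add, ha, hb, add_mul]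
  have h2 : coprod 𝒢 (gen 𝒢 v * a) =
      (coprodAux 𝒢 v (symLift 𝒢 (coprodAux 𝒢) (coprodAux_swap 𝒢) a (1, 0))).2 := by
    rw [← symLift_gen (coprodAux 𝒢) (coprodAux_swap 𝒢) v]
    simp [coprod]
  rw [h2]
  change v ⊗ₜ[k] (symLift 𝒢 (coprodAux 𝒢) (coprodAux_swap 𝒢) a (1, 0)).1 + _ = _
  rw [h, mul_one]
  rfl

theorem coprod_gen (v : g) : coprod 𝒢 (gen 𝒢 v) = v ⊗ₜ 1 := by
  simpa [coprod_one] using coprod_gen_mul v (1 : Sym 𝒢)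

theorem tensorMul_mem_tens {P Q : ℤ → Submodule k (Sym 𝒢)} {p q : ℤ} {v : g}
    (hv : v ∈ shift 𝒢 (-1) p) (h : ∀ r b, b ∈ P r → gen 𝒢 v * b ∈ Q (p + r)) {t : g ⊗[k] Sym 𝒢}
    (ht : t ∈ tens P q) : tensorMul 𝒢 v t ∈ tens Q (p + q) := by
  refine Submodule.span_induction (p := fun t _ => tensorMul 𝒢 v t ∈ tens Q (p + q))
    ?_ ?_ ?_ ?_ ht
  · rintro _ ⟨q, r, x, b, hx, hb, rfl, rfl⟩
    rw [tensorMul_tmul 𝒢 hv hx, add_left_comm]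
    exact units_smul_mem _ (tmul_mem_tens hx (h _ _ hb))
  · simp
  · intro s t _ _ hs ht
    rw [map_add]
    exact add_mem hs ht
  · intro c t _ ht
    rw [map_smul]
    exact Submodule.smul_mem _ c ht

theorem coprod_symPart {n : ℕ} {p : ℤ} {a : Sym 𝒢} (ha : a ∈ symPart 𝒢 n p) :
    (n = 0 → coprod 𝒢 a = 0) ∧ ∀ m, n = m + 1 → coprod 𝒢 a ∈ tens (symPart 𝒢 m) p := by
  refine symPart_induction (C := fun n p a => (n = 0 → coprod 𝒢 a = 0) ∧
    ∀ m, n = m + 1 → coprod 𝒢 a ∈ tens (symPart 𝒢 m) p) ?_ ?_ ?_ ?_ ?_ ha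
  · simp [coprod_one]
  · rintro n p q v a hv ha ⟨h0, h1⟩
    refine ⟨by simp, fun m hm => ?_⟩
    obtain rfl : n = m := by omega
    rw [coprod_gen_mul]
    refine add_mem (tmul_mem_tens hv ha) ?_
    rcases n with _ | n
    · rw [h0 rfl, map_zero]
      exact zero_mem _
    · exact tensorMul_mem_tens hv (fun r b hb => gen_mul_mem_symPart hv hb) (h1 n rfl)
  · simp
  · rintro n p a b ⟨h0, h1⟩ ⟨h0', h1'⟩
    refine ⟨fun h => ?_, fun m hm => ?_⟩
    · rw [map_add, h0 h, h0' h, add_zero]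
    · rw [map_add]
      exact add_mem (h1 m hm) (h1' m hm)
  · rintro n p c a ⟨h0, h1⟩
    refine ⟨fun h => ?_, fun m hm => ?_⟩
    · rw [map_smul, h0 h, smul_zero]
    · rw [map_smul]
      exact Submodule.smul_mem _ c (h1 m hm)

theorem coprod_mem_tens_symDeg {p : ℤ} {a : Sym 𝒢} (ha : a ∈ symDeg 𝒢 p) :
    coprod 𝒢 a ∈ tens (symDeg 𝒢) p := by
  refine Submodule.iSup_induction (fun n => symPart 𝒢 n p)
    (motive := fun a => coprod 𝒢 a ∈ tens (symDeg 𝒢) p) ha ?_ ?_ ?_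
  · intro n a ha
    rcases n with _ | n
    · rw [(coprod_symPart ha).1 rfl]
      exact zero_mem _
    · exact tens_mono (symPart_le_symDeg n) _ ((coprod_symPart ha).2 n rfl)
  · simp
  · intro a b ha hb
    rw [map_add]
    exact add_mem ha hb

theorem pairing_mem {P Q R : ℤ → Submodule k (Sym 𝒢)}
    (hmul : ∀ p q a b, a ∈ P p → b ∈ Q q → a * b ∈ R (p + q)) {c p : ℤ} {φ : g →ₗ[k] Sym 𝒢}
    (hφ : HasDegree P c φ) {t : g ⊗[k] Sym 𝒢} (ht : t ∈ tens Q p) :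
    pairing 𝒢 φ t ∈ R (p + c) := by
  refine Submodule.span_induction (p := fun t _ => pairing 𝒢 φ t ∈ R (p + c)) ?_ ?_ ?_ ?_ ht
  · rintro _ ⟨q, r, x, b, hx, hb, rfl, rfl⟩
    rw [pairing_tmul, add_right_comm]
    exact hmul _ _ _ _ (hφ _ _ hx) hb
  · simp
  · intro s t _ _ hs ht
    rw [map_add]
    exact add_mem hs ht
  · intro c t _ ht
    rw [map_smul]
    exact Submodule.smul_mem _ c ht

/-- The extension of a linear map `φ` on the generators to a derivation of `S (g[-1])`. -/
def der (φ : g →ₗ[k] Sym 𝒢) : Sym 𝒢 →ₗ[k] Sym 𝒢 := pairing 𝒢 φ ∘ₗ coprod 𝒢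

theorem der_apply (φ : g →ₗ[k] Sym 𝒢) (a : Sym 𝒢) : der φ a = pairing 𝒢 φ (coprod 𝒢 a) := rfl

theorem der_gen (φ : g →ₗ[k] Sym 𝒢) (v : g) : der φ (gen 𝒢 v) = φ v := by
  rw [der_apply, coprod_gen, pairing_tmul, mul_one]

theorem der_add (φ ψ : g →ₗ[k] Sym 𝒢) (a : Sym 𝒢) : der (φ + ψ) a = der φ a + der ψ a := by
  simp only [der_apply, map_add, LinearMap.add_apply]

theorem der_sub (φ ψ : g →ₗ[k] Sym 𝒢) (a : Sym 𝒢) : der (φ - ψ) a = der φ a - der ψ a := by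
  simp only [der_apply, map_sub, LinearMap.sub_apply]

theorem der_units_smul (s : ℤˣ) (φ : g →ₗ[k] Sym 𝒢) (a : Sym 𝒢) :
    der (s • φ) a = s • der φ a := by
  simp only [der_apply, map_units_smul]
  rfl

theorem der_mem_symPart {m n : ℕ} {c p : ℤ} {φ : g →ₗ[k] Sym 𝒢} {a : Sym 𝒢}
    (hφ : HasDegree (symPart 𝒢 m) c φ) (ha : a ∈ symPart 𝒢 (n + 1) p) :
    der φ a ∈ symPart 𝒢 (m + n) (p + c) :=
  pairing_mem (fun _ _ _ _ => mul_mem_symPart) hφ ((coprod_symPart ha).2 n rfl)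

theorem der_mem_symDeg {c p : ℤ} {φ : g →ₗ[k] Sym 𝒢} {a : Sym 𝒢}
    (hφ : HasDegree (symDeg 𝒢) c φ) (ha : a ∈ symDeg 𝒢 p) : der φ a ∈ symDeg 𝒢 (p + c) :=
  pairing_mem (fun _ _ _ _ => mul_mem_symDeg) hφ (coprod_mem_tens_symDeg ha)

/-- Two signs combine: `v` passes `x` inside the coproduct, and passes `φ x` in the product. The
degrees of `x` and `φ x` differ by `c`, which leaves `c p`. -/
theorem der_gen_mul {c p : ℤ} {φ : g →ₗ[k] Sym 𝒢} (hφ : HasDegree (symDeg 𝒢) c φ) {v : g}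
    (hv : v ∈ shift 𝒢 (-1) p) (a : Sym 𝒢) :
    der φ (gen 𝒢 v * a) = φ v * a + (c * p).negOnePow • (gen 𝒢 v * der φ a) := by
  rw [der_apply, coprod_gen_mul, map_add, pairing_tmul, der_apply]
  congr 1
  induction coprod 𝒢 a using TensorProduct.induction_on with
  | zero => simp
  | add s t hs ht => simp only [map_add, mul_add, smul_add, hs, ht]
  | tmul x b =>
    induction x using homogeneous_induction (𝒢 := 𝒢) with
    | zero => simp
    | add x y hx hy => simp only [TensorProduct.add_tmul, map_add, mul_add, smul_add, hx, hy]
    | hom q x hx =>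
      rw [mem_shift_one] at hx
      rw [tensorMul_tmul 𝒢 hv hx, map_units_smul, pairing_tmul, pairing_tmul, ← mul_assoc,
        ← mul_assoc, gen_mul_comm hv (hφ _ _ hx), units_smul_mul, smul_smul, ← Int.negOnePow_add]
      congr 1
      apply negOnePow_congr
      simp only [Int.even_add, Int.even_mul]
      tauto

theorem der_mul {c p : ℤ} {φ : g →ₗ[k] Sym 𝒢} (hφ : HasDegree (symDeg 𝒢) c φ) {a : Sym 𝒢}
    (ha : a ∈ symDeg 𝒢 p) (b : Sym 𝒢) :
    der φ (a * b) = der φ a * b + (c * p).negOnePow • (a * der φ b) := by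
  refine symDeg_induction
    (C := fun p a => der φ (a * b) = der φ a * b + (c * p).negOnePow • (a * der φ b))
    ?_ ?_ ?_ ?_ ?_ ha
  · simp [der_apply, coprod_one]
  · intro p q v a hv ha h
    rw [mul_assoc, der_gen_mul hφ hv, h, der_gen_mul hφ hv, mul_add, add_mul, smul_add,
      mul_units_smul, units_smul_mul, smul_smul, ← Int.negOnePow_add, ← mul_add]
    simp only [mul_assoc, add_assoc]
  · simp
  · intro p a a' h h'
    rw [add_mul, map_add, h, h', map_add, add_mul, add_mul, smul_add]
    abel
  · intro p c a h
    simp only [smul_mul_assoc, map_smul, h, smul_add, units_smul_comm]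

/-- The graded commutator of two derivations is again a derivation, and a derivation is determined
by its values on generators. The induction carries this out one generator at a time. -/
theorem der_der {a b p : ℤ} {φ ψ : g →ₗ[k] Sym 𝒢} (hφ : HasDegree (symDeg 𝒢) a φ)
    (hψ : HasDegree (symDeg 𝒢) b ψ) {u : Sym 𝒢} (hu : u ∈ symDeg 𝒢 p) :
    der φ (der ψ u) - (a * b).negOnePow • der ψ (der φ u) =
      der (der φ ∘ₗ ψ - (a * b).negOnePow • (der ψ ∘ₗ φ)) u := by
  have hdeg : HasDegree (symDeg 𝒢) (a + b) (der φ ∘ₗ ψ - (a * b).negOnePow • (der ψ ∘ₗ φ)) := by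
    intro q x hx
    refine _root_.sub_mem ?_ (units_smul_mem _ ?_)
    · have := der_mem_symDeg hφ (hψ _ _ hx)
      rwa [add_assoc, add_comm b a] at this
    · have := der_mem_symDeg hψ (hφ _ _ hx)
      rwa [add_assoc] at this
  refine symDeg_induction (C := fun p u => der φ (der ψ u) - (a * b).negOnePow • der ψ (der φ u) =
      der (der φ ∘ₗ ψ - (a * b).negOnePow • (der ψ ∘ₗ φ)) u) ?_ ?_ ?_ ?_ ?_ hu
  · simp [der_apply, coprod_one]
  · intro p q v u hv hu h
    rw [der_gen_mul hdeg hv, ← h, der_gen_mul hφ hv, der_gen_mul hψ hv]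
    simp only [map_add, map_units_smul]
    rw [der_gen_mul hφ hv, der_gen_mul hψ hv, der_mul hφ (hψ _ _ hv), der_mul hψ (hφ _ _ hv)]
    have e : ((a * b).negOnePow • (der ψ ∘ₗ φ)) v = (a * b).negOnePow • der ψ (φ v) := rfl
    simp only [LinearMap.sub_apply, LinearMap.comp_apply, e, mul_add, add_mul, Int.negOnePow_add,
      mul_comm b a, sub_mul, mul_sub, units_smul_mul, mul_units_smul]
    -- The signs have been split into products of a few independent ones. Once each of these is
    -- fixed as `1` or `-1`, the identity is linear in the remaining terms.
    rcases Int.units_eq_one_or (a * b).negOnePow with h1 | h1 <;>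
    rcases Int.units_eq_one_or (a * p).negOnePow with h2 | h2 <;>
    rcases Int.units_eq_one_or (b * p).negOnePow with h3 | h3 <;>
    · simp only [h1, h2, h3, one_smul, mul_one, Units.neg_smul, mul_neg, neg_neg]
      abel
  · simp
  · intro p u u' h h'
    simp only [map_add, smul_add, ← h, ← h']
    abel
  · intro p c u h
    simp only [map_smul, ← h, units_smul_comm, smul_sub]

end SymmetricAlgebra

/-! ### Families of multilinear maps and the circle product -/

section Families

variable {k : Type u} [Field k] {g : Type v} [AddCommGroup g] [Module k g]
  (𝒢 : ℤ → Submodule k g)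

/-- Families of multilinear maps on `g` with values in `S (g[-1])`, one in each arity. -/
abbrev Fam : Type (max u v) := ∀ m : ℕ, Mult 𝒢 m

variable {𝒢}

/-- Insertion of `y` as the first argument. -/
def contract (y : g) : Fam 𝒢 →ₗ[k] Fam 𝒢 where
  toFun F m := (F (m + 1)).curryLeft y
  map_add' _ _ := rfl
  map_smul' _ _ := rfl

/-- The value of the member of arity zero. -/
def ev0 : Fam 𝒢 →ₗ[k] Sym 𝒢 where
  toFun F := F 0 Fin.elim0
  map_add' _ _ := rfl
  map_smul' _ _ := rfl

/-- The member of arity one as a linear map. -/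
def ev1 : Fam 𝒢 →ₗ[k] g →ₗ[k] Sym 𝒢 where
  toFun F :=
    { toFun := fun y => ev0 (contract y F)
      map_add' := fun y z => congrArg (fun f => f Fin.elim0) (map_add (F 1).curryLeft y z)
      map_smul' := fun c y => congrArg (fun f => f Fin.elim0) (map_smul (F 1).curryLeft c y) }
  map_add' _ _ := rfl
  map_smul' _ _ := rfl

/-- The member of arity two as a bilinear map. -/
def ev2 (F : Fam 𝒢) : g →ₗ[k] g →ₗ[k] Sym 𝒢 where
  toFun y := ev1 (contract y F)
  map_add' y z := by
    rw [← map_add]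
    exact congrArg ev1 (funext fun m => map_add (F (m + 1)).curryLeft y z)
  map_smul' c y := by
    rw [RingHom.id_apply, ← map_smul]
    exact congrArg ev1 (funext fun m => map_smul (F (m + 1)).curryLeft c y)

theorem ev1_apply (F : Fam 𝒢) (y : g) : ev1 F y = ev0 (contract y F) := rfl

theorem contract_apply (F : Fam 𝒢) (y : g) (m : ℕ) (x : Fin m → g) :
    contract y F m x = F (m + 1) (Fin.cons y x) := rfl

theorem apply_eq_contract (F : Fam 𝒢) (m : ℕ) (x : Fin (m + 1) → g) :
    F (m + 1) x = contract (x 0) F m (fun i => x i.succ) := by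
  rw [contract_apply]
  congr 1
  exact (Fin.cons_self_tail x).symm

/-- Successive contractions fill all arguments, so arity-zero values of iterated contractions
recover the whole family. This is the basis of all inductions on the arity. -/
theorem apply_eq_iter (F : Fam 𝒢) (m : ℕ) (x : Fin m → g) :
    F m x = ev0 (iter (fun y F => contract y F) m x F) := by
  induction m generalizing F with
  | zero => rw [Subsingleton.elim x Fin.elim0]; rfl
  | succ m ih => rw [apply_eq_contract, ih]; rfl

theorem cons_mem {E : Type*} [AddCommGroup E] [Module k E] {𝒱 : ℤ → Submodule k E} {m : ℕ}
    {p : ℤ} {y : E} (hy : y ∈ 𝒱 p) {d : Fin m → ℤ} {x : Fin m → E} (hx : ∀ i, x i ∈ 𝒱 (d i)) :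
    ∀ i, (Fin.cons y x : Fin (m + 1) → E) i ∈ 𝒱 ((Fin.cons p d : Fin (m + 1) → ℤ) i) := by
  intro i
  refine Fin.cases ?_ (fun i => ?_) i
  · simpa using hy
  · simpa using hx i

/-- The families of graded symmetric maps of degree `e` with values in `P`. -/
def famHom (P : ℤ → Submodule k (Sym 𝒢)) (e : ℤ) : Submodule k (Fam 𝒢) where
  carrier := {F | ∀ m, IsGradedSymm (shift 𝒢 1) (F m) ∧
    ∀ (d : Fin m → ℤ) (x : Fin m → g), (∀ i, x i ∈ shift 𝒢 1 (d i)) →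
      F m x ∈ P (2 + (∑ i, d i + e))}
  add_mem' := by
    intro f f' hf hf' m
    refine ⟨fun d x hx i j hij => ?_, fun d x hx => ?_⟩
    · simp [(hf m).1 d x hx i j hij, (hf' m).1 d x hx i j hij]
    · exact add_mem ((hf m).2 d x hx) ((hf' m).2 d x hx)
  zero_mem' := by
    intro m
    refine ⟨fun d x hx i j hij => ?_, fun d x hx => zero_mem _⟩
    simp
  smul_mem' := by
    intro c f hf m
    refine ⟨fun d x hx i j hij => ?_, fun d x hx => ?_⟩
    · simp [(hf m).1 d x hx i j hij, smul_comm c]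
    · exact Submodule.smul_mem _ c ((hf m).2 d x hx)

theorem famHom_mono {P Q : ℤ → Submodule k (Sym 𝒢)} (h : ∀ p, P p ≤ Q p) (e : ℤ) :
    famHom P e ≤ famHom Q e :=
  fun _ hF m => ⟨(hF m).1, fun d x hx => h _ ((hF m).2 d x hx)⟩

theorem ev0_mem {P : ℤ → Submodule k (Sym 𝒢)} {e : ℤ} {F : Fam 𝒢} (hF : F ∈ famHom P e) :
    ev0 F ∈ P (2 + e) := by
  have := (hF 0).2 Fin.elim0 Fin.elim0 (fun i => i.elim0)
  rwa [Finset.univ_eq_empty, Finset.sum_empty, zero_add] at this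

variable [DirectSum.Decomposition 𝒢]

/-- Homogeneous elements span `g`, and this can be used in one variable after the other. -/
theorem mult_ext {m : ℕ} {A : Type*} [AddCommGroup A] [Module k A]
    {F G : MultilinearMap k (fun _ : Fin m => g) A}
    (h : ∀ (d : Fin m → ℤ) (x : Fin m → g), (∀ i, x i ∈ shift 𝒢 1 (d i)) → F x = G x) :
    F = G := by
  induction m with
  | zero =>
    ext x
    exact h Fin.elim0 x (fun i => i.elim0)
  | succ m ih =>
    have key : ∀ y, F.curryLeft y = G.curryLeft y := by
      intro y
      induction y using homogeneous_induction (𝒢 := 𝒢) with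
      | zero => rw [map_zero, map_zero]
      | add y z hy hz => rw [map_add, map_add, hy, hz]
      | hom p y hy =>
        exact ih fun d x hx => h (Fin.cons p d) (Fin.cons y x) (cons_mem hy hx)
    ext x
    have := congrArg (fun f => f (Fin.tail x)) (key (x 0))
    simpa using this

theorem fam_apply_succ_eq_zero {F : Fam 𝒢} {m : ℕ}
    (h : ∀ p y, y ∈ shift 𝒢 1 p → contract y F m = 0) : F (m + 1) = 0 := by
  refine mult_ext (𝒢 := 𝒢) fun d x hx => ?_
  rw [apply_eq_contract, h _ _ (hx 0)]
  rfl

/-- Graded symmetry in the first two arguments says that contractions commute up to sign. The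
converse direction is `le_famHom`. -/
theorem contract_gradedAction (P : ℤ → Submodule k (Sym 𝒢)) :
    GradedAction (shift 𝒢 1) (famHom P) (contract (𝒢 := 𝒢)) where
  mem := by
    intro e p y F hF hy m
    refine ⟨fun d x hx i j hij => ?_, fun d x hx => ?_⟩
    · have hx' := cons_mem hy hx
      have := (hF (m + 1)).1 _ _ hx' i.succ j.succ (by simpa using hij)
      rw [contract_apply, contract_apply]
      simp only [Fin.cons_succ] at this
      rw [← this]
      congr 1
      funext l
      refine Fin.cases ?_ (fun l => ?_) l
      · rw [Function.comp_apply, Equiv.swap_apply_of_ne_of_ne (Fin.succ_ne_zero _).symm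
          (Fin.succ_ne_zero _).symm]
        simp
      · have h2 : Equiv.swap i.succ j.succ l.succ = (Equiv.swap i j l).succ := by
          simp only [Equiv.swap_apply_def, Fin.succ_inj]
          split_ifs <;> rfl
        rw [Function.comp_apply, h2]
        simp
    · have hx' := cons_mem hy hx
      have := (hF (m + 1)).2 _ _ hx'
      rw [contract_apply]
      convert this using 2
      rw [Fin.sum_univ_succ]
      simp only [Fin.cons_zero, Fin.cons_succ]
      ring
  swap := by
    intro e p q y z F hF hy hz
    funext m
    refine mult_ext (𝒢 := 𝒢) fun d x hx => ?_
    have := (hF (m + 2)).1 _ _ (cons_mem hz (cons_mem hy hx)) 0 (Fin.succ 0) (by simp)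
    change F (m + 2) (Fin.cons y (Fin.cons z x : Fin (m + 1) → g)) =
      (p * q).negOnePow • F (m + 2) (Fin.cons z (Fin.cons y x : Fin (m + 1) → g))
    rw [mul_comm]
    refine Eq.trans ?_ this
    congr 1
    funext l
    refine Fin.cases ?_ (fun l => Fin.cases ?_ (fun l => ?_) l) l
    · rw [Function.comp_apply, Equiv.swap_apply_left]
      rfl
    · rw [Function.comp_apply, Equiv.swap_apply_right]
      rfl
    · rw [Function.comp_apply, Equiv.swap_apply_of_ne_of_ne (Fin.succ_ne_zero _)
        (fun h => Fin.succ_ne_zero _ (Fin.succ_injective _ h))]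
      rfl

theorem contract_mem {P : ℤ → Submodule k (Sym 𝒢)} {e p : ℤ} {F : Fam 𝒢} (hF : F ∈ famHom P e)
    {y : g} (hy : y ∈ shift 𝒢 1 p) : contract y F ∈ famHom P (e + p) :=
  (contract_gradedAction P).mem hF hy

/-- A family of spaces that is stable under graded commuting contractions consists of graded
symmetric maps. -/
theorem le_famHom {P : ℤ → Submodule k (Sym 𝒢)} {ℳ : ℤ → Submodule k (Fam 𝒢)}
    (h : GradedAction (shift 𝒢 1) ℳ (contract (𝒢 := 𝒢))) (h0 : ∀ e F, F ∈ ℳ e → ev0 F ∈ P (2 + e))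
    (e : ℤ) : ℳ e ≤ famHom P e := by
  intro F hF m
  refine ⟨fun d x hx i j hij => ?_, fun d x hx => ?_⟩
  · rw [apply_eq_iter, apply_eq_iter, h.iter_swap hx hF hij, map_units_smul]
  · rw [apply_eq_iter, add_comm _ e]
    exact h0 _ _ (h.iter_mem hx hF)

theorem ev1_hasDegree {P : ℤ → Submodule k (Sym 𝒢)} {e : ℤ} {F : Fam 𝒢} (hF : F ∈ famHom P e) :
    HasDegree P e (ev1 F) := by
  intro q x hx
  -- Degree `q` in `g[-1]` is degree `q - 2` in `g[1]`; the `2` in the definition of `famHom`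
  -- compensates for it.
  have hx' : x ∈ shift 𝒢 1 (q - 2) := by
    rw [mem_shift_one]
    simpa using hx
  have := ev0_mem (contract_mem hF hx')
  rw [ev1_apply]
  convert this using 2
  ring

/-- Only the parities of the homogeneous arguments contribute to a sum over all parities. -/
theorem sum_par_apply {n : ℕ} (K : (Fin n → Fin 2) → Mult 𝒢 n) {d : Fin n → ℤ} {x : Fin n → g}
    (hx : ∀ i, x i ∈ shift 𝒢 1 (d i)) :
    (∑ e : Fin n → Fin 2, (K e).compLinearMap (fun i => par 𝒢 (e i))) x =
      K (fun i => if Even (d i) then 0 else 1) x := by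
  have hpar (i : Fin n) (e : Fin 2) := par_of_mem 𝒢 (hx i) e
  have h2 (i : Fin n) : (1 + d i + 1) % 2 = d i % 2 := by omega
  simp only [h2] at hpar
  let e0 : Fin n → Fin 2 := fun i => if Even (d i) then 0 else 1
  have he0 (i : Fin n) (e : Fin 2) : d i % 2 = (e : ℤ) ↔ e = e0 i := by
    have : d i % 2 = 0 ∨ d i % 2 = 1 := by omega
    rcases this with h | h <;> fin_cases e <;> simp [e0, h, Int.even_iff]
  simp only [he0] at hpar
  rw [sum_apply, Finset.sum_eq_single e0]
  · rw [MultilinearMap.compLinearMap_apply]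
    congr 1
    funext i
    rw [hpar, if_pos rfl]
  · intro e _ he
    obtain ⟨i, hi⟩ := Function.ne_iff.1 he
    rw [MultilinearMap.compLinearMap_apply]
    apply (K e).map_coord_zero i
    rw [hpar, if_neg hi]
  · simp

/-- `twist` evaluates `s` only on the representatives `0` and `1` of the parities, hence the
condition `hs`. -/
theorem twist_apply {n : ℕ} {s : (Fin n → ℤ) → ℤˣ}
    (hs : ∀ d d' : Fin n → ℤ, (∀ i, Even (d i) ↔ Even (d' i)) → s d = s d') (F : Mult 𝒢 n)
    {d : Fin n → ℤ} {x : Fin n → g} (hx : ∀ i, x i ∈ shift 𝒢 1 (d i)) :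
    twist 𝒢 s F x = s d • F x := by
  refine (sum_par_apply (fun e => s (fun i => ((e i : ℕ) : ℤ)) • F) hx).trans ?_
  rw [← hs (fun i => (((if Even (d i) then 0 else 1 : Fin 2) : ℕ) : ℤ)) d]
  · rfl
  · intro i
    split_ifs with h <;> simp [h]

/-- The circle product, for families with values in `S (g[-1])`. -/
def famCirc (e : ℤ) : Fam 𝒢 →ₗ[k] Fam 𝒢 →ₗ[k] Fam 𝒢 :=
  LinearMap.mk₂ k (fun F H m =>
    ∑ S : Finset (Fin m), twist 𝒢 (fun d => koszul d S * (e * ∑ i ∈ S, d i).negOnePow)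
      (circTerm 𝒢 S (F (S.card + 1)) (H Sᶜ.card)))
    (by
      intro f f' h; funext m; ext x
      simp [twist, Finset.sum_add_distrib])
    (by
      intro c f h; funext m; ext x
      simp [twist, Finset.smul_sum, smul_comm c])
    (by
      intro f h h'; funext m; ext x
      simp [twist, Finset.sum_add_distrib])
    (by
      intro c f h; funext m; ext x
      simp [twist, Finset.smul_sum, smul_comm c])

theorem circ_apply (e : ℤ) (f h : Big 𝒢) (m n : ℕ) :
    circ 𝒢 e f h m n = ∑ ab ∈ Finset.HasAntidiagonal.antidiagonal (n + 1),
      famCirc e (fun m => f m ab.1) (fun m => h m ab.2) m := by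
  simp only [famCirc, LinearMap.mk₂_apply]
  rw [Finset.sum_comm]
  rfl

theorem even_sum_congr {ι : Type*} (S : Finset ι) {d d' : ι → ℤ}
    (h : ∀ i, Even (d i) ↔ Even (d' i)) : Even (∑ i ∈ S, d i) ↔ Even (∑ i ∈ S, d' i) := by
  classical
  induction S using Finset.induction_on with
  | empty => simp
  | insert i S hi ih => rw [Finset.sum_insert hi, Finset.sum_insert hi, Int.even_add, Int.even_add,
      ih, h]

theorem famCirc_apply (e : ℤ) (F H : Fam 𝒢) {m : ℕ} {d : Fin m → ℤ} {x : Fin m → g}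
    (hx : ∀ i, x i ∈ shift 𝒢 1 (d i)) :
    famCirc e F H m x = ∑ S : Finset (Fin m), (koszul d S * (e * ∑ i ∈ S, d i).negOnePow) •
      der ((F (S.card + 1)).curryRight (sub x S)) (H Sᶜ.card (sub x Sᶜ)) := by
  rw [famCirc, LinearMap.mk₂_apply, sum_apply]
  refine Finset.sum_congr rfl fun S _ => ?_
  rw [twist_apply _ _ hx]
  · rfl
  · intro d d' h
    congr 1
    · refine Finset.prod_congr rfl fun i _ => Finset.prod_congr rfl fun j _ => ?_
      apply negOnePow_congr
      rw [Int.even_mul, Int.even_mul, h, h]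
    · apply negOnePow_congr
      rw [Int.even_mul, Int.even_mul, even_sum_congr S h]

/-- With no arguments there is a single unshuffle, and only the arity-zero value of `H` is fed into
the arity-one part of `F`. -/
theorem ev0_famCirc (e : ℤ) (F H : Fam 𝒢) : ev0 (famCirc e F H) = der (ev1 F) (ev0 H) := by
  change famCirc e F H 0 Fin.elim0 = _
  rw [famCirc_apply e F H (d := Fin.elim0) (fun i => i.elim0), Fintype.sum_unique]
  have h1 : (default : Finset (Fin 0)) = ∅ := Subsingleton.elim _ _
  have h2 : (∅ : Finset (Fin 0))ᶜ = ∅ := Subsingleton.elim _ _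
  rw [h1, h2, apply_sub_empty (fun n z => (F (n + 1)).curryRight z) _ Fin.elim0,
    apply_sub_empty (fun n z => H n z) _ Fin.elim0]
  simp only [koszul_fin_zero, Finset.sum_empty, mul_zero, Int.negOnePow_zero, mul_one, one_smul]
  congr 2
  ext y
  change F 1 _ = F 1 _
  congr 1
  funext i
  obtain rfl : i = 0 := Fin.fin_one_eq_zero i
  rfl

/-- The unshuffles are split by the block that receives `y`. If `y` goes to `F`, it passes `H`,
which gives the sign `e p`. If it goes to `H`, the sign of `y` passing `x_S` is absorbed by the new
degree `e + p` of the contracted `H`. -/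
theorem contract_famCirc (e : ℤ) (F H : Fam 𝒢) {p : ℤ} {y : g} (hy : y ∈ shift 𝒢 1 p) :
    contract y (famCirc e F H) =
      (e * p).negOnePow • famCirc e (contract y F) H + famCirc (e + p) F (contract y H) := by
  funext m
  refine mult_ext (𝒢 := 𝒢) fun d x hx => ?_
  have hx' := cons_mem hy hx
  rw [contract_apply, famCirc_apply _ _ _ hx', sum_finset_fin_succ]
  have e1 : ((e * p).negOnePow • famCirc e (contract y F) H + famCirc (e + p) F (contract y H)) m x
    = (e * p).negOnePow • famCirc e (contract y F) H m x +
      famCirc (e + p) F (contract y H) m x := rfl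
  rw [e1, famCirc_apply _ _ _ hx, famCirc_apply _ _ _ hx, Finset.smul_sum]
  congr 1
  · refine Finset.sum_congr rfl fun S _ => ?_
    rw [compl_consSet, apply_sub_consSet S (fun n z => (F (n + 1)).curryRight z),
      apply_sub_succSet _ (fun n z => H n z), koszul_consSet, sum_consSet, smul_smul]
    simp only [Fin.cons_zero, Fin.cons_succ]
    congr 1
    · rw [mul_add, Int.negOnePow_add]
      ac_rfl
    · congr 2
      ext z
      rw [MultilinearMap.curryRight_apply, MultilinearMap.curryRight_apply, contract_apply,
        Fin.cons_snoc_eq_snoc_cons]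
  · refine Finset.sum_congr rfl fun S _ => ?_
    rw [compl_succSet, apply_sub_succSet S (fun n z => (F (n + 1)).curryRight z),
      apply_sub_consSet _ (fun n z => H n z), koszul_succSet, sum_succSet]
    simp only [Fin.cons_zero, Fin.cons_succ]
    congr 1
    rw [add_mul, Int.negOnePow_add]
    ac_rfl

end Families

/-! ### The graded Jacobi identity -/

section FamilyBracket

variable {k : Type u} [Field k] {g : Type v} [AddCommGroup g] [Module k g]
  {𝒢 : ℤ → Submodule k g} [DirectSum.Decomposition 𝒢]

/-- Symmetry is obtained without permuting unshuffles: by `le_famHom` it suffices that contractions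
preserve circle products and commute up to sign on them, and that the arity-zero values have the
right degree. -/
theorem famCirc_mem {P Q R : ℤ → Submodule k (Sym 𝒢)}
    (hder : ∀ c p φ a, HasDegree P c φ → a ∈ Q p → der φ a ∈ R (p + c)) {e e' : ℤ} {F H : Fam 𝒢}
    (hF : F ∈ famHom P e) (hH : H ∈ famHom Q e') : famCirc e' F H ∈ famHom R (e + e') := by
  -- The span is needed because the contraction of one circle product is a sum of two.
  let ℳ : ℤ → Submodule k (Fam 𝒢) := fun E => Submodule.span k
    {X | ∃ e e' F H, F ∈ famHom P e ∧ H ∈ famHom Q e' ∧ e + e' = E ∧ X = famCirc e' F H}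
  have hℳ {e e' : ℤ} {F H : Fam 𝒢} (hF : F ∈ famHom P e) (hH : H ∈ famHom Q e') :
      famCirc e' F H ∈ ℳ (e + e') := Submodule.subset_span ⟨e, e', F, H, hF, hH, rfl, rfl⟩
  refine le_famHom (ℳ := ℳ) ⟨?_, ?_⟩ ?_ _ (hℳ hF hH)
  · intro E p y X hX hy
    refine Submodule.span_induction (p := fun X _ => contract y X ∈ ℳ (E + p)) ?_ ?_ ?_ ?_ hX
    · rintro _ ⟨e, e', F, H, hF, hH, rfl, rfl⟩
      rw [contract_famCirc _ _ _ hy]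
      refine add_mem (units_smul_mem _ ?_) ?_
      · rw [add_right_comm]
        exact hℳ (contract_mem hF hy) hH
      · rw [add_assoc]
        exact hℳ hF (contract_mem hH hy)
    · simp
    · intro X Y _ _ hX hY
      rw [map_add]
      exact add_mem hX hY
    · intro c X _ hX
      rw [map_smul]
      exact Submodule.smul_mem _ c hX
  · intro E p q y z X hX hy hz
    refine Submodule.span_induction (p := fun X _ => contract z (contract y X) =
      (p * q).negOnePow • contract y (contract z X)) ?_ ?_ ?_ ?_ hX
    · rintro _ ⟨e, e', F, H, hF, hH, rfl, rfl⟩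
      simp only [contract_famCirc _ _ _ hy, contract_famCirc _ _ _ hz, map_add, map_units_smul,
        (contract_gradedAction P).swap hF hy hz, (contract_gradedAction Q).swap hH hy hz,
        linear_units_smul_apply, add_right_comm e' q p, smul_add,
        add_mul, Int.negOnePow_add, mul_comm q p]
      rcases Int.units_eq_one_or (e' * p).negOnePow with h1 | h1 <;>
      rcases Int.units_eq_one_or (e' * q).negOnePow with h2 | h2 <;>
      rcases Int.units_eq_one_or (p * q).negOnePow with h3 | h3 <;>
      · simp only [h1, h2, h3, one_smul, mul_one, Units.neg_smul, mul_neg, neg_neg]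
        abel
    · simp
    · intro X Y _ _ hX hY
      simp only [map_add, smul_add, hX, hY]
    · intro c X _ hX
      rw [map_smul, map_smul, hX, map_smul, map_smul]
      exact (units_smul_comm _ c _).symm
  · intro E X hX
    refine Submodule.span_induction (p := fun X _ => ev0 X ∈ R (2 + E)) ?_ ?_ ?_ ?_ hX
    · rintro _ ⟨e, e', F, H, hF, hH, rfl, rfl⟩
      rw [ev0_famCirc, add_comm e e', ← add_assoc]
      exact hder _ _ _ _ (ev1_hasDegree hF) (ev0_mem hH)
    · simp
    · intro X Y _ _ hX hY
      rw [map_add]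
      exact add_mem hX hY
    · intro c X _ hX
      rw [map_smul]
      exact Submodule.smul_mem _ c hX

/-- The big bracket, for families with values in `S (g[-1])`. -/
def famBr (a b : ℤ) : Fam 𝒢 →ₗ[k] Fam 𝒢 →ₗ[k] Fam 𝒢 :=
  LinearMap.mk₂ k (fun F G => famCirc b F G - (a * b).negOnePow • famCirc a G F)
    (by intro f f' h; simp only [map_add, LinearMap.add_apply, smul_add]; abel)
    (by intro c f h; simp only [map_smul, LinearMap.smul_apply, smul_sub, smul_comm c])
    (by intro f h h'; simp only [map_add, LinearMap.add_apply, smul_add]; abel)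
    (by intro c f h; simp only [map_smul, LinearMap.smul_apply, smul_sub, smul_comm c])

theorem famBr_apply (a b : ℤ) (F G : Fam 𝒢) :
    famBr a b F G = famCirc b F G - (a * b).negOnePow • famCirc a G F := rfl

theorem famBr_mem {e e' : ℤ} {F H : Fam 𝒢} (hF : F ∈ famHom (symDeg 𝒢) e)
    (hH : H ∈ famHom (symDeg 𝒢) e') : famBr e e' F H ∈ famHom (symDeg 𝒢) (e + e') := by
  have hder : ∀ c p φ a, HasDegree (symDeg 𝒢) c φ → a ∈ symDeg 𝒢 p → der φ a ∈ symDeg 𝒢 (p + c) :=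
    fun _ _ _ _ => der_mem_symDeg
  rw [famBr_apply]
  refine _root_.sub_mem (famCirc_mem hder hF hH) (units_smul_mem _ ?_)
  rw [add_comm]
  exact famCirc_mem hder hH hF

theorem famBr_antisymm (a b : ℤ) (F G : Fam 𝒢) :
    famBr a b F G = -((a * b).negOnePow • famBr b a G F) := by
  rw [famBr_apply, famBr_apply, mul_comm b a]
  rcases Int.units_eq_one_or (a * b).negOnePow with h1 | h1 <;>
  · simp only [h1, one_smul, Units.neg_smul]
    abel

theorem contract_famBr (a b : ℤ) (F H : Fam 𝒢) {p : ℤ} {y : g} (hy : y ∈ shift 𝒢 1 p) :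
    contract y (famBr a b F H) =
      (b * p).negOnePow • famBr (a + p) b (contract y F) H + famBr a (b + p) F (contract y H) := by
  simp only [famBr_apply, map_sub, map_units_smul, contract_famCirc _ _ _ hy, mul_add, add_mul,
    Int.negOnePow_add, mul_comm p b]
  rcases Int.units_eq_one_or (a * b).negOnePow with h1 | h1 <;>
  rcases Int.units_eq_one_or (a * p).negOnePow with h2 | h2 <;>
  rcases Int.units_eq_one_or (b * p).negOnePow with h3 | h3 <;>
  · simp only [h1, h2, h3, one_smul, mul_one, Units.neg_smul, mul_neg, neg_neg]
    abel

/-- The Jacobiator of the big bracket. -/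
def famJac (a b c : ℤ) (F G H : Fam 𝒢) : Fam 𝒢 :=
  famBr a (b + c) F (famBr b c G H) - famBr (a + b) c (famBr a b F G) H -
    (a * b).negOnePow • famBr b (a + c) G (famBr a c F H)

/-- Contraction is a derivation of the bracket, so it distributes over the three entries of the
Jacobiator. This makes the induction on the arity possible. -/
theorem contract_famJac (a b c : ℤ) (F G H : Fam 𝒢) {p : ℤ} {y : g} (hy : y ∈ shift 𝒢 1 p) :
    contract y (famJac a b c F G H) =
      ((b + c) * p).negOnePow • famJac (a + p) b c (contract y F) G H +
      (c * p).negOnePow • famJac a (b + p) c F (contract y G) H +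
      famJac a b (c + p) F G (contract y H) := by
  simp only [famJac, map_sub, map_units_smul, contract_famBr _ _ _ _ hy, map_add,
    linear_units_smul_apply, LinearMap.add_apply, smul_add, smul_sub]
  rw [show a + p + b = a + b + p by ring, show b + p + c = b + c + p by ring,
    show b + (c + p) = b + c + p by ring, show a + (b + p) = a + b + p by ring,
    show a + p + c = a + c + p by ring, show a + (c + p) = a + c + p by ring]
  simp only [mul_add, add_mul, Int.negOnePow_add, mul_comm p b]
  rcases Int.units_eq_one_or (a * b).negOnePow with h1 | h1 <;>
  rcases Int.units_eq_one_or (a * p).negOnePow with h2 | h2 <;>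
  rcases Int.units_eq_one_or (b * p).negOnePow with h3 | h3 <;>
  rcases Int.units_eq_one_or (c * p).negOnePow with h4 | h4 <;>
  · simp only [h1, h2, h3, h4, one_smul, mul_one, Units.neg_smul, mul_neg, neg_neg]
    abel

/-! ### The Jacobi identity in arity zero -/

variable (𝒢) in
/-- The map `x ↦ (-1)^(b |x|) x` on `g`. -/
def parPow (b : ℤ) : g →ₗ[k] g := if Even b then LinearMap.id else parInv 𝒢

theorem parPow_mem (b : ℤ) {p : ℤ} {x : g} (hx : x ∈ shift 𝒢 (-1) p) :
    parPow 𝒢 b x = (b * p).negOnePow • x := by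
  unfold parPow
  split_ifs with h
  · rw [Int.negOnePow_even _ (h.mul_right p), one_smul]
    rfl
  · rw [parInv_mem 𝒢 hx]
    congr 1
    apply negOnePow_congr
    simp [Int.even_mul, h]

/-- The map `y ↦ ∑ (-1)^(b |y|) F (y, s₁) s₂`. -/
def doubleInsert (b : ℤ) (F : Fam 𝒢) (s : g ⊗[k] Sym 𝒢) : g →ₗ[k] Sym 𝒢 :=
  (pairing 𝒢).flip s ∘ₗ ev2 F ∘ₗ parPow 𝒢 b

theorem doubleInsert_apply (b : ℤ) (F : Fam 𝒢) (s : g ⊗[k] Sym 𝒢) (y : g) :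
    doubleInsert b F s y = pairing 𝒢 (ev2 F (parPow 𝒢 b y)) s := rfl

/-- On pure tensors this combines the graded symmetry of `F` in its first two arguments with the
graded commutativity of `S (g[-1])`. The second-order terms of the Jacobi identity cancel for this
reason. -/
theorem pairing_doubleInsert_symm {e b c : ℤ} {F : Fam 𝒢} (hF : F ∈ famHom (symDeg 𝒢) e)
    {s t : g ⊗[k] Sym 𝒢} (hs : s ∈ tens (symDeg 𝒢) (2 + b)) (ht : t ∈ tens (symDeg 𝒢) (2 + c)) :
    pairing 𝒢 (doubleInsert b F s) t =
      (b * c).negOnePow • pairing 𝒢 (doubleInsert c F t) s := by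
  have hadd (b : ℤ) (s t : g ⊗[k] Sym 𝒢) :
      doubleInsert b F (s + t) = doubleInsert b F s + doubleInsert b F t := by
    ext y
    simp [doubleInsert_apply]
  have hsmul (b : ℤ) (r : k) (s : g ⊗[k] Sym 𝒢) :
      doubleInsert b F (r • s) = r • doubleInsert b F s := by
    ext y
    simp [doubleInsert_apply]
  have hzero (b : ℤ) : doubleInsert b F 0 = 0 := by
    ext y
    simp [doubleInsert_apply]
  refine Submodule.span_induction (p := fun s _ => pairing 𝒢 (doubleInsert b F s) t =
      (b * c).negOnePow • pairing 𝒢 (doubleInsert c F t) s) ?_ ?_ ?_ ?_ hs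
  · rintro _ ⟨q, r, x, u, hx, hu, hqr, rfl⟩
    refine Submodule.span_induction (p := fun t _ => pairing 𝒢 (doubleInsert b F (x ⊗ₜ u)) t =
      (b * c).negOnePow • pairing 𝒢 (doubleInsert c F t) (x ⊗ₜ u)) ?_ ?_ ?_ ?_ ht
    · rintro _ ⟨q', r', y, w, hy, hw, hqr', rfl⟩
      have hx' : x ∈ shift 𝒢 1 (q - 2) := by rw [mem_shift_one]; simpa using hx
      have hy' : y ∈ shift 𝒢 1 (q' - 2) := by rw [mem_shift_one]; simpa using hy
      have hF2 := (contract_gradedAction (symDeg 𝒢)).swap hF hy' hx'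
      have e2 (x y : g) : ev2 F y x = ev0 (contract x (contract y F)) := rfl
      simp only [pairing_tmul, doubleInsert_apply, parPow_mem b hy, parPow_mem c hx,
        map_units_smul, linear_units_smul_apply, pairing_tmul, units_smul_mul, mul_assoc, e2, hF2]
      rw [symDeg_mul_comm hu hw, mul_units_smul, smul_smul, smul_smul, smul_smul]
      congr 1
      obtain rfl : b = q + r - 2 := by omega
      obtain rfl : c = q' + r' - 2 := by omega
      simp only [← Int.negOnePow_add]
      apply negOnePow_congr
      simp only [Int.even_add, Int.even_mul, Int.even_sub, even_two]
      by_cases h1 : Even q <;> by_cases h2 : Even r <;> by_cases h3 : Even q' <;>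
        by_cases h4 : Even r' <;> simp [h1, h2, h3, h4]
    · simp [hzero]
    · intro t t' _ _ h h'
      rw [map_add, h, h', hadd, map_add, LinearMap.add_apply, smul_add]
    · intro r t _ h
      rw [map_smul, h, hsmul, map_smul, LinearMap.smul_apply, units_smul_comm]
  · simp [hzero]
  · intro t t' _ _ h h'
    rw [map_add, smul_add, ← h, hadd, map_add, LinearMap.add_apply, h']
  · intro r t _ h
    rw [map_smul, hsmul, map_smul, LinearMap.smul_apply, h, units_smul_comm]

/-- The one argument `y` goes either to `F`, which then also receives a factor of the constant `ev0
G`, or to `G`. The first possibility is the second-order term, which is absent from a composition of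
derivations. -/
theorem ev1_famCirc (b : ℤ) (F G : Fam 𝒢) :
    ev1 (famCirc b F G) = doubleInsert b F (coprod 𝒢 (ev0 G)) + der (ev1 F) ∘ₗ ev1 G := by
  ext y
  induction y using homogeneous_induction (𝒢 := 𝒢) with
  | zero => simp
  | add y z hy hz => rw [map_add, map_add, hy, hz]
  | hom p y hy =>
    have hy' := mem_shift_one.1 hy
    have hs : (b * (2 + p)).negOnePow = (b * p).negOnePow := by
      apply negOnePow_congr
      simp [Int.even_mul, Int.even_add]
    rw [LinearMap.add_apply, doubleInsert_apply, parPow_mem b hy', map_units_smul,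
      map_units_smul, linear_units_smul_apply, ev1_apply, contract_famCirc _ _ _ hy, map_add, map_units_smul,
      ev0_famCirc, ev0_famCirc, hs]
    rfl

theorem ev0_associator {a b c : ℤ} {F G H : Fam 𝒢} (hF : F ∈ famHom (symDeg 𝒢) a)
    (hG : G ∈ famHom (symDeg 𝒢) b) (hH : H ∈ famHom (symDeg 𝒢) c) :
    der (ev1 F) (der (ev1 G) (ev0 H)) - (a * b).negOnePow • der (ev1 G) (der (ev1 F) (ev0 H)) =
      der (ev1 (famCirc b F G)) (ev0 H) - (a * b).negOnePow • der (ev1 (famCirc a G F)) (ev0 H) -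
      pairing 𝒢 (doubleInsert b F (coprod 𝒢 (ev0 G))) (coprod 𝒢 (ev0 H)) +
      (a * b).negOnePow •
        pairing 𝒢 (doubleInsert a G (coprod 𝒢 (ev0 F))) (coprod 𝒢 (ev0 H)) := by
  rw [der_der (ev1_hasDegree hF) (ev1_hasDegree hG) (ev0_mem hH), der_sub, der_units_smul,
    ev1_famCirc, ev1_famCirc, der_add, der_add, smul_add, ← der_apply, ← der_apply]
  abel

theorem ev0_famJac {a b c : ℤ} {F G H : Fam 𝒢} (hF : F ∈ famHom (symDeg 𝒢) a)
    (hG : G ∈ famHom (symDeg 𝒢) b) (hH : H ∈ famHom (symDeg 𝒢) c) :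
    ev0 (famJac a b c F G H) = 0 := by
  -- Each of the three instances produces two second-order terms. After the symmetries below are
  -- applied, each such term occurs in two of the instances, so a signed sum eliminates them all.
  have A1 := ev0_associator hF hG hH
  have A2 := ev0_associator hF hH hG
  have A3 := ev0_associator hG hH hF
  have tF := coprod_mem_tens_symDeg (ev0_mem hF)
  have tG := coprod_mem_tens_symDeg (ev0_mem hG)
  have tH := coprod_mem_tens_symDeg (ev0_mem hH)
  rw [pairing_doubleInsert_symm hF tG tH, pairing_doubleInsert_symm hG tF tH] at A1
  rw [pairing_doubleInsert_symm hH tF tG] at A2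
  simp only [famJac, famBr_apply, map_sub, map_units_smul, ev0_famCirc, LinearMap.sub_apply,
    linear_units_smul_apply, mul_add, add_mul, Int.negOnePow_add, mul_comm b a]
  rcases Int.units_eq_one_or (a * b).negOnePow with h1 | h1 <;>
  rcases Int.units_eq_one_or (a * c).negOnePow with h2 | h2 <;>
  rcases Int.units_eq_one_or (b * c).negOnePow with h3 | h3 <;>
  · simp only [h1, h2, h3, one_smul, mul_one, Units.neg_smul, mul_neg, neg_neg] at A1 A2 A3 ⊢
    -- The signs in this sum depend on the parities of `a`, `b` and `c`; four patterns cover the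
    -- eight cases.
    first
      | linear_combination (norm := module) A1 - A2 + A3
      | linear_combination (norm := module) A1 + A2 + A3
      | linear_combination (norm := module) A1 - A2 - A3
      | linear_combination (norm := module) A1 + A2 - A3

/-- In arity `m + 1` it suffices to contract once, and the contraction is a sum of Jacobiators of
contracted families in arity `m`. The induction therefore runs over all triples and degrees at once.
-/
theorem famJac_eq_zero {a b c : ℤ} {F G H : Fam 𝒢} (hF : F ∈ famHom (symDeg 𝒢) a)
    (hG : G ∈ famHom (symDeg 𝒢) b) (hH : H ∈ famHom (symDeg 𝒢) c) :
    famJac a b c F G H = 0 := by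
  funext m
  induction m generalizing a b c F G H with
  | zero =>
    ext x
    rw [Subsingleton.elim x Fin.elim0]
    exact ev0_famJac hF hG hH
  | succ m ih =>
    refine fam_apply_succ_eq_zero fun p y hy => ?_
    rw [contract_famJac _ _ _ _ _ _ hy]
    simp only [Pi.add_apply, Pi.smul_apply, ih (contract_mem hF hy) hG hH,
      ih hF (contract_mem hG hy) hH, ih hF hG (contract_mem hH hy)]
    simp

end FamilyBracket

/-! ### Derived brackets in a graded Lie algebra -/

section Derived

variable {k : Type*} [Field k] {E M : Type*} [AddCommGroup E] [Module k E] [AddCommGroup M]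
  [Module k M]

/-- A graded Lie algebra structure on the graded space `ℬ`. -/
structure IsGradedLie (ℬ : ℤ → Submodule k M) (br : ℤ → ℤ → M →ₗ[k] M →ₗ[k] M) : Prop where
  bracket_mem : ∀ {a b f g}, f ∈ ℬ a → g ∈ ℬ b → br a b f g ∈ ℬ (a + b)
  antisymm : ∀ a b f g, br a b f g = -((a * b).negOnePow • br b a g f)
  jacobi : ∀ {a b c f g h}, f ∈ ℬ a → g ∈ ℬ b → h ∈ ℬ c →
    br a (b + c) f (br b c g h) =
      br (a + b) c (br a b f g) h + (a * b).negOnePow • br b (a + c) g (br a c f h)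

/-- The right adjoint action of the elements `emb a`, which commute with each other. -/
structure IsDerivedAction (ℬ : ℤ → Submodule k M) (br : ℤ → ℤ → M →ₗ[k] M →ₗ[k] M)
    (𝒱 : ℤ → Submodule k E) (emb : E → M) (act : E → M →ₗ[k] M) : Prop where
  lie : IsGradedLie ℬ br
  emb_mem : ∀ {p a}, a ∈ 𝒱 p → emb a ∈ ℬ p
  act_eq : ∀ {e p F a}, F ∈ ℬ e → a ∈ 𝒱 p → act a F = br e p F (emb a)
  act_emb : ∀ {p q a b}, a ∈ 𝒱 p → b ∈ 𝒱 q → act b (emb a) = 0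

namespace IsDerivedAction

variable {ℬ : ℤ → Submodule k M} {br : ℤ → ℤ → M →ₗ[k] M →ₗ[k] M} {𝒱 : ℤ → Submodule k E}
  {emb : E → M} {act : E → M →ₗ[k] M}

theorem act_mem (h : IsDerivedAction ℬ br 𝒱 emb act) {e p : ℤ} {F : M} {a : E} (hF : F ∈ ℬ e)
    (ha : a ∈ 𝒱 p) : act a F ∈ ℬ (e + p) := by
  rw [h.act_eq hF ha]
  exact h.lie.bracket_mem hF (h.emb_mem ha)

/-- Since the embedded elements commute, the Jacobi identity leaves only the two orders of their
actions. -/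
theorem gradedAction (h : IsDerivedAction ℬ br 𝒱 emb act) : GradedAction 𝒱 ℬ act where
  mem := h.act_mem
  swap := by
    intro e p q a b F hF ha hb
    have hj := h.lie.jacobi hF (h.emb_mem ha) (h.emb_mem hb)
    rw [← h.act_eq (h.emb_mem ha) hb, h.act_emb ha hb, map_zero,
      h.lie.antisymm p (e + q), ← h.act_eq hF ha, ← h.act_eq hF hb,
      ← h.act_eq (h.act_mem hF ha) hb, ← h.act_eq (h.act_mem hF hb) ha, smul_neg, smul_smul,
      ← sub_eq_add_neg, eq_comm, sub_eq_zero] at hj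
    rw [hj, ← Int.negOnePow_add]
    congr 1
    apply negOnePow_congr
    simp only [Int.even_add, Int.even_mul]
    tauto

/-- The Jacobi identity says that a right adjoint action is a graded derivation. -/
theorem act_br (h : IsDerivedAction ℬ br 𝒱 emb act) {a b p : ℤ} {F G : M} {c : E} (hF : F ∈ ℬ a)
    (hG : G ∈ ℬ b) (hc : c ∈ 𝒱 p) :
    act c (br a b F G) =
      (b * p).negOnePow • br (a + p) b (act c F) G + br a (b + p) F (act c G) := by
  have hj := h.lie.jacobi hF hG (h.emb_mem hc)
  rw [h.lie.antisymm b (a + p), ← h.act_eq hF hc, ← h.act_eq hG hc,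
    ← h.act_eq (h.lie.bracket_mem hF hG) hc, smul_neg, smul_smul, ← Int.negOnePow_add] at hj
  rw [hj]
  have : (a * b + b * (a + p)).negOnePow = (b * p).negOnePow := by
    apply negOnePow_congr
    simp only [Int.even_add, Int.even_mul]
    tauto
  rw [this]
  abel

/-- This is the Leibniz rule for `n` successive derivations: each argument acts on `F` or on `G`.
The sign is that of the unshuffle times that of `x_S` passing `G`. -/
theorem iter_br (h : IsDerivedAction ℬ br 𝒱 emb act) {n : ℕ} {d : Fin n → ℤ} {x : Fin n → E}
    (hx : ∀ i, x i ∈ 𝒱 (d i)) {a b : ℤ} {F G : M} (hF : F ∈ ℬ a) (hG : G ∈ ℬ b) :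
    iter (fun a F => act a F) n x (br a b F G) =
      ∑ S : Finset (Fin n), (koszul d S * (b * ∑ i ∈ S, d i).negOnePow) •
        br (a + ∑ i ∈ S, d i) (b + ∑ i ∈ Sᶜ, d i)
          (iter (fun a F => act a F) S.card (sub x S) F)
          (iter (fun a F => act a F) Sᶜ.card (sub x Sᶜ) G) := by
  induction n generalizing a b F G with
  | zero =>
    rw [Fintype.sum_unique]
    have h1 : (default : Finset (Fin 0)) = ∅ := Subsingleton.elim _ _
    have h2 : (∅ : Finset (Fin 0))ᶜ = ∅ := Subsingleton.elim _ _
    rw [h1, h2]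
    simp [koszul_fin_zero, iter]
  | succ n ih =>
    have hx' : ∀ i : Fin n, x i.succ ∈ 𝒱 (d i.succ) := fun i => hx i.succ
    rw [sum_finset_fin_succ]
    simp only [iter]
    rw [h.act_br hF hG (hx 0), iter_add, iter_units_smul, ih hx' (h.act_mem hF (hx 0)) hG,
      ih hx' hF (h.act_mem hG (hx 0)), Finset.smul_sum]
    congr 1
    · refine Finset.sum_congr rfl fun S _ => ?_
      rw [compl_consSet, apply_sub_consSet S (fun n z => iter (fun a F => act a F) n z F),
        apply_sub_succSet _ (fun n z => iter (fun a F => act a F) n z G), koszul_consSet,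
        sum_consSet, sum_succSet, iter_cons, smul_smul, mul_add, Int.negOnePow_add, ← add_assoc]
      congr 1
      ac_rfl
    · refine Finset.sum_congr rfl fun S _ => ?_
      rw [compl_succSet, apply_sub_succSet S (fun n z => iter (fun a F => act a F) n z F),
        apply_sub_consSet _ (fun n z => iter (fun a F => act a F) n z G), koszul_succSet,
        sum_consSet, sum_succSet, iter_cons, add_mul, Int.negOnePow_add, ← add_assoc]
      congr 1
      ac_rfl

/-- The higher Jacobi identities of the derived brackets of a Maurer-Cartan element `l`. -/
theorem derived_identity (h : IsDerivedAction ℬ br 𝒱 emb act) {l : M} (hl : l ∈ ℬ 1)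
    (hll : br 1 1 l l = 0) (φ : ∀ n : ℕ, (Fin n → E) → M) (L : ∀ n : ℕ, (Fin n → E) → E)
    (hφ : ∀ {n : ℕ} {d : Fin n → ℤ} {x : Fin n → E}, (∀ i, x i ∈ 𝒱 (d i)) →
      φ n x ∈ ℬ (1 + ∑ i, d i))
    (hL : ∀ {n : ℕ} {d : Fin n → ℤ} {x : Fin n → E}, (∀ i, x i ∈ 𝒱 (d i)) →
      L n x ∈ 𝒱 (1 + ∑ i, d i))
    (hdec : ∀ (n : ℕ) (x : Fin n → E), iter (fun a F => act a F) n x l = φ n x + emb (L n x))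
    {n : ℕ} {d : Fin n → ℤ} {x : Fin n → E} (hx : ∀ i, x i ∈ 𝒱 (d i)) :
    ∑ S : Finset (Fin n), (koszul d S * (∑ i ∈ S, d i).negOnePow) •
        br (1 + ∑ i ∈ S, d i) (1 + ∑ i ∈ Sᶜ, d i) (φ S.card (sub x S)) (φ Sᶜ.card (sub x Sᶜ)) +
      (2 : ℤ) • ∑ S : Finset (Fin n), koszul d S • iter (fun a F => act a F) (Sᶜ.card + 1)
        (Fin.cons (L S.card (sub x S)) (sub x Sᶜ)) l = 0 := by
  have hφS (S : Finset (Fin n)) : φ S.card (sub x S) ∈ ℬ (1 + ∑ i ∈ S, d i) := by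
    have := hφ (sub_mem S hx)
    rwa [sum_sub] at this
  have hLS (S : Finset (Fin n)) : L S.card (sub x S) ∈ 𝒱 (1 + ∑ i ∈ S, d i) := by
    have := hL (sub_mem S hx)
    rwa [sum_sub] at this
  -- The action annihilates embedded elements, so `φ` may be replaced by the full iterated bracket.
  -- There the new element `L (x_S)` is moved to the front of the list.
  have key (S : Finset (Fin n)) :
      br (1 + ∑ i ∈ Sᶜ, d i) (1 + ∑ i ∈ S, d i) (φ Sᶜ.card (sub x Sᶜ)) (emb (L S.card (sub x S))) =
        ((1 + ∑ i ∈ S, d i) * ∑ i ∈ Sᶜ, d i).negOnePow • iter (fun a F => act a F) (Sᶜ.card + 1)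
          (Fin.cons (L S.card (sub x S)) (sub x Sᶜ)) l := by
    have h1 : act (L S.card (sub x S)) (φ Sᶜ.card (sub x Sᶜ)) =
        act (L S.card (sub x S)) (iter (fun a F => act a F) Sᶜ.card (sub x Sᶜ) l) := by
      rw [hdec, map_add, h.act_emb (hLS Sᶜ) (hLS S), add_zero]
    rw [← h.act_eq (hφS Sᶜ) (hLS S), h1, h.gradedAction.act_iter (sub_mem Sᶜ hx) hl (hLS S),
      sum_sub, iter_cons]
  have main := h.iter_br hx hl hl
  have hzero : iter (fun a F => act a F) n x (0 : M) = 0 := by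
    have := iter_add act x (0 : M) 0
    rwa [add_zero, left_eq_add] at this
  rw [hll, hzero] at main
  -- Both entries are expanded as `φ + emb L`. The bracket of the two embedded parts vanishes, and
  -- the mixed term with `emb L` on the left is brought to the form of `key` by antisymmetry.
  have hterm (S : Finset (Fin n)) :
      (koszul d S * (1 * ∑ i ∈ S, d i).negOnePow) •
        br (1 + ∑ i ∈ S, d i) (1 + ∑ i ∈ Sᶜ, d i)
          (iter (fun a F => act a F) S.card (sub x S) l)
          (iter (fun a F => act a F) Sᶜ.card (sub x Sᶜ) l) =
      (koszul d S * (∑ i ∈ S, d i).negOnePow) •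
        br (1 + ∑ i ∈ S, d i) (1 + ∑ i ∈ Sᶜ, d i) (φ S.card (sub x S)) (φ Sᶜ.card (sub x Sᶜ)) +
      (koszul d S * (∑ i ∈ S, d i).negOnePow) •
        br (1 + ∑ i ∈ S, d i) (1 + ∑ i ∈ Sᶜ, d i) (φ S.card (sub x S))
          (emb (L Sᶜ.card (sub x Sᶜ))) +
      koszul d S • iter (fun a F => act a F) (Sᶜ.card + 1)
        (Fin.cons (L S.card (sub x S)) (sub x Sᶜ)) l := by
    have h0 : br (1 + ∑ i ∈ S, d i) (1 + ∑ i ∈ Sᶜ, d i) (emb (L S.card (sub x S)))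
        (emb (L Sᶜ.card (sub x Sᶜ))) = 0 := by
      rw [← h.act_eq (h.emb_mem (hLS S)) (hLS Sᶜ), h.act_emb (hLS S) (hLS Sᶜ)]
    rw [hdec, hdec, map_add, LinearMap.map_add₂, LinearMap.map_add₂, h0, add_zero,
      h.lie.antisymm _ _ (emb _), key, smul_add, smul_add, smul_neg, smul_smul, smul_smul, one_mul,
      add_right_comm]
    congr 1
    rw [← Units.neg_smul]
    congr 1
    rw [mul_assoc, mul_assoc, ← mul_neg, ← Int.negOnePow_add, ← Int.negOnePow_add,
      ← Int.negOnePow_succ]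
    refine (congrArg (koszul d S * ·) ?_).trans (mul_one _)
    apply Int.negOnePow_even
    simp only [Int.even_add, Int.even_mul, Int.not_even_one]
    tauto
  rw [Finset.sum_congr rfl fun S _ => hterm S, Finset.sum_add_distrib, Finset.sum_add_distrib]
    at main
  -- Passing to complements turns the other mixed sum into the same one; this is the source of the
  -- factor `2`.
  have hre : ∑ S : Finset (Fin n), (koszul d S * (∑ i ∈ S, d i).negOnePow) •
        br (1 + ∑ i ∈ S, d i) (1 + ∑ i ∈ Sᶜ, d i) (φ S.card (sub x S))
          (emb (L Sᶜ.card (sub x Sᶜ))) =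
      ∑ S : Finset (Fin n), koszul d S • iter (fun a F => act a F) (Sᶜ.card + 1)
        (Fin.cons (L S.card (sub x S)) (sub x Sᶜ)) l := by
    rw [← Equiv.sum_comp (compl_involutive (α := Finset (Fin n))).toPerm]
    refine Finset.sum_congr rfl fun S _ => ?_
    rw [Function.Involutive.coe_toPerm, compl_compl, key, koszul_compl, smul_smul]
    congr 1
    rw [mul_assoc, mul_assoc, ← Int.negOnePow_add, ← Int.negOnePow_add]
    refine (congrArg (koszul d S * ·) ?_).trans (mul_one _)
    apply Int.negOnePow_even
    simp only [Int.even_add, Int.even_mul, Int.not_even_one]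
    tauto
  rw [hre] at main
  rw [two_zsmul, ← add_assoc]
  exact main.symm

end IsDerivedAction

end Derived

/-! ### Insertion of elements of the symmetric algebra -/

section Insertion

variable {k : Type u} [Field k] {g : Type v} [AddCommGroup g] [Module k g]
  {𝒢 : ℤ → Submodule k g} [DirectSum.Decomposition 𝒢]

theorem symInv_gen (v : g) : symInv 𝒢 (gen 𝒢 v) = gen 𝒢 (parInv 𝒢 v) := symLift_gen _ _ v

theorem symInv_symDeg {r : ℤ} {b : Sym 𝒢} (hb : b ∈ symDeg 𝒢 r) :
    symInv 𝒢 b = r.negOnePow • b := by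
  refine symDeg_induction (C := fun r b => symInv 𝒢 b = r.negOnePow • b) ?_ ?_ ?_ ?_ ?_ hb
  · simp
  · intro p q v a hv _ h
    rw [map_mul, h, symInv_gen, parInv_mem 𝒢 hv, map_units_smul, units_smul_mul, mul_units_smul,
      smul_smul, Int.negOnePow_add]
  · simp
  · intro p a b ha hb
    rw [map_add, ha, hb, smul_add]
  · intro p c a h
    rw [map_smul, h, units_smul_comm]

theorem symInv_pow_symDeg {r : ℤ} {b : Sym 𝒢} (hb : b ∈ symDeg 𝒢 r) (N : ℕ) :
    ((symInv 𝒢) ^ N) b = (N * r).negOnePow • b := by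
  induction N with
  | zero => simp
  | succ N ih =>
    rw [pow_succ, AlgHom.mul_apply, symInv_symDeg hb, map_units_smul, ih, smul_smul,
      ← Int.negOnePow_add]
    congr 2
    push_cast
    ring

/-- The number of odd entries of `d`. -/
def oddCount {n : ℕ} (d : Fin n → ℤ) : ℕ := ∑ i, if Even (d i) then 0 else 1

theorem even_oddCount {n : ℕ} (d : Fin n → ℤ) : Even (oddCount d : ℤ) ↔ Even (∑ i, d i) := by
  rw [oddCount, Nat.cast_sum]
  refine even_sum_congr _ fun i => ?_
  split_ifs with h <;> simp [h]

theorem insertArg_apply {n : ℕ} (a : Sym 𝒢) (F : Mult 𝒢 (n + 1)) {d : Fin n → ℤ} {x : Fin n → g}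
    (hx : ∀ i, x i ∈ shift 𝒢 1 (d i)) :
    insertArg 𝒢 n a F x = pairing 𝒢 (firstArg 𝒢 F x)
      (LinearMap.lTensor g ((symInv 𝒢) ^ oddCount d).toLinearMap (coprod 𝒢 a)) := by
  refine (sum_par_apply (fun e => ((pairing 𝒢).flip (LinearMap.lTensor g
    ((symInv 𝒢) ^ (∑ i, (e i : ℕ))).toLinearMap (coprod 𝒢 a))).compMultilinearMap
      (firstArg 𝒢 F)) hx).trans ?_
  have h : ∑ i, (((if Even (d i) then 0 else 1 : Fin 2)) : ℕ) = oddCount d :=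
    Finset.sum_congr rfl fun i _ => by split_ifs <;> rfl
  rw [h]
  rfl

/-- Insertion of `u` as the first argument, as a derivation in it. -/
def ins (u : Sym 𝒢) : Fam 𝒢 →ₗ[k] Fam 𝒢 where
  toFun F m := insertArg 𝒢 m u (F (m + 1))
  map_add' F G := funext fun m => map_add (insertArg 𝒢 m u) (F (m + 1)) (G (m + 1))
  map_smul' c F := funext fun m => map_smul (insertArg 𝒢 m u) c (F (m + 1))

theorem ins_gen (v : g) (F : Fam 𝒢) : ins (gen 𝒢 v) F = contract v F := by
  funext m
  refine mult_ext (𝒢 := 𝒢) fun d x hx => ?_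
  refine (insertArg_apply _ _ hx).trans ?_
  rw [coprod_gen, LinearMap.lTensor_tmul, pairing_tmul, AlgHom.toLinearMap_apply, map_one, mul_one]
  rfl

theorem ev0_ins (u : Sym 𝒢) (F : Fam 𝒢) : ev0 (ins u F) = der (ev1 F) u := by
  refine (insertArg_apply u (F 1) (d := Fin.elim0) (fun i => i.elim0)).trans ?_
  rw [der_apply, oddCount, Finset.univ_eq_empty, Finset.sum_empty, pow_zero]
  congr 1
  exact LinearMap.lTensor_id_apply _ _ _

/-- The argument `y` must pass all of `u`: it passes the inserted factor by the symmetry of `F`, and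
the remaining factor through the power of `symInv` in the definition of `insertArg`. -/
theorem contract_ins {e p q : ℤ} {u : Sym 𝒢} (hu : u ∈ symDeg 𝒢 (2 + p)) {F : Fam 𝒢}
    (hF : F ∈ famHom (symDeg 𝒢) e) {y : g} (hy : y ∈ shift 𝒢 1 q) :
    contract y (ins u F) = (p * q).negOnePow • ins u (contract y F) := by
  funext m
  refine mult_ext (𝒢 := 𝒢) fun d x hx => ?_
  refine (insertArg_apply u (F (m + 2)) (cons_mem hy hx)).trans ?_
  refine Eq.trans ?_
    (congrArg ((p * q).negOnePow • ·) (insertArg_apply u (contract y F (m + 1)) hx).symm)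
  refine Submodule.span_induction (p := fun t _ =>
    pairing 𝒢 (firstArg 𝒢 (F (m + 2)) (Fin.cons y x)) (LinearMap.lTensor g
      ((symInv 𝒢) ^ oddCount (Fin.cons q d : Fin (m + 1) → ℤ)).toLinearMap t) =
    (p * q).negOnePow • pairing 𝒢 (firstArg 𝒢 (contract y F (m + 1)) x) (LinearMap.lTensor g
      ((symInv 𝒢) ^ oddCount d).toLinearMap t)) ?_ ?_ ?_ ?_ (coprod_mem_tens_symDeg hu)
  · rintro _ ⟨r, s, z, b, hz, hb, hrs, rfl⟩
    have hz' : z ∈ shift 𝒢 1 (r - 2) := by rw [mem_shift_one]; simpa using hz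
    have hsw := congrFun (congrArg DFunLike.coe
      (congrFun ((contract_gradedAction (symDeg 𝒢)).swap hF hz' hy) m)) x
    have h1 : firstArg 𝒢 (F (m + 2)) (Fin.cons y x) z = contract y (contract z F) m x := rfl
    have h2 : firstArg 𝒢 (contract y F (m + 1)) x z = contract z (contract y F) m x := rfl
    rw [LinearMap.lTensor_tmul, LinearMap.lTensor_tmul, pairing_tmul, pairing_tmul,
      AlgHom.toLinearMap_apply, AlgHom.toLinearMap_apply, symInv_pow_symDeg hb,
      symInv_pow_symDeg hb, h1, h2, hsw]
    change ((r - 2) * q).negOnePow • contract z (contract y F) m x * _ = _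
    rw [units_smul_mul, mul_units_smul, mul_units_smul, smul_smul, smul_smul, ← Int.negOnePow_add,
      ← Int.negOnePow_add]
    congr 1
    apply negOnePow_congr
    obtain rfl : p = r + s - 2 := by omega
    simp only [Int.even_add, Int.even_mul, Int.even_sub, even_two, even_oddCount,
      Fin.sum_univ_succ, Fin.cons_zero, Fin.cons_succ]
    tauto
  · simp
  · intro s t _ _ hs ht
    simp only [map_add, hs, ht, smul_add]
  · intro c t _ ht
    simp only [map_smul, ht]
    exact (units_smul_comm _ c _).symm

/-- An element of `S (g[-1])` as a family, concentrated in arity zero. -/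
def famEmb (u : Sym 𝒢) : Fam 𝒢
  | 0 => MultilinearMap.constOfIsEmpty k _ u
  | _ + 1 => 0

theorem ev0_famEmb (u : Sym 𝒢) : ev0 (famEmb u) = u := rfl

theorem contract_famEmb (u : Sym 𝒢) (y : g) : contract y (famEmb u) = 0 := rfl

theorem famEmb_mem {P : ℤ → Submodule k (Sym 𝒢)} {p : ℤ} {u : Sym 𝒢} (hu : u ∈ P (2 + p)) :
    famEmb u ∈ famHom P p := by
  intro m
  rcases m with _ | m
  · refine ⟨fun d x hx i => i.elim0, fun d x hx => ?_⟩
    rw [Finset.univ_eq_empty, Finset.sum_empty, zero_add]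
    exact hu
  · refine ⟨fun d x hx i j hij => ?_, fun d x hx => zero_mem _⟩
    simp [famEmb]

/-- A family concentrated in arity zero has no argument that could receive anything. -/
theorem famCirc_famEmb_left (e : ℤ) (u : Sym 𝒢) (F : Fam 𝒢) : famCirc e (famEmb u) F = 0 := by
  funext m
  induction m generalizing e F with
  | zero =>
    ext x
    rw [Subsingleton.elim x Fin.elim0]
    refine (ev0_famCirc e (famEmb u) F).trans ?_
    have : ev1 (famEmb u) = 0 := rfl
    simp [this, der_apply]
  | succ m ih =>
    refine fam_apply_succ_eq_zero fun p y hy => ?_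
    rw [contract_famCirc _ _ _ hy, contract_famEmb, map_zero, LinearMap.zero_apply, smul_zero,
      zero_add, ih]
    rfl

/-- Both sides have the same arity-zero value and obey the same contraction rule. Insertion thereby
becomes a bracket with a constant, to which the Jacobi identity applies. -/
theorem ins_eq_famCirc {e p : ℤ} {u : Sym 𝒢} (hu : u ∈ symDeg 𝒢 (2 + p)) {F : Fam 𝒢}
    (hF : F ∈ famHom (symDeg 𝒢) e) : ins u F = famCirc p F (famEmb u) := by
  suffices h : ins u F - famCirc p F (famEmb u) = 0 from sub_eq_zero.1 h
  funext m
  induction m generalizing e F with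
  | zero =>
    ext x
    rw [Subsingleton.elim x Fin.elim0]
    change ev0 (ins u F - famCirc p F (famEmb u)) = 0
    rw [map_sub, ev0_ins, ev0_famCirc, ev0_famEmb, sub_self]
  | succ m ih =>
    refine fam_apply_succ_eq_zero fun q y hy => ?_
    rw [map_sub, contract_ins hu hF hy, contract_famCirc _ _ _ hy, contract_famEmb, map_zero,
      add_zero]
    have h : ins u (contract y F) m = famCirc p (contract y F) (famEmb u) m :=
      sub_eq_zero.1 (ih (contract_mem hF hy))
    change (p * q).negOnePow • ins u (contract y F) m -
      (p * q).negOnePow • famCirc p (contract y F) (famEmb u) m = 0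
    rw [h, sub_self]

theorem ins_eq_famBr {e p : ℤ} {u : Sym 𝒢} (hu : u ∈ symDeg 𝒢 (2 + p)) {F : Fam 𝒢}
    (hF : F ∈ famHom (symDeg 𝒢) e) : ins u F = famBr e p F (famEmb u) := by
  rw [famBr_apply, famCirc_famEmb_left, smul_zero, sub_zero, ins_eq_famCirc hu hF]

theorem ins_famEmb (u w : Sym 𝒢) : ins u (famEmb w) = 0 :=
  funext fun m => map_zero (insertArg 𝒢 m u)

theorem famBr_isGradedLie : IsGradedLie (famHom (symDeg 𝒢)) (famBr (𝒢 := 𝒢)) where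
  bracket_mem := famBr_mem
  antisymm := famBr_antisymm
  jacobi := by
    intro a b c F G H hF hG hH
    have := famJac_eq_zero hF hG hH
    rwa [famJac, sub_sub, sub_eq_zero] at this

theorem ins_isDerivedAction :
    IsDerivedAction (famHom (symDeg 𝒢)) (famBr (𝒢 := 𝒢)) (shift (symDeg 𝒢) 2) famEmb ins where
  lie := famBr_isGradedLie
  emb_mem := fun hu => famEmb_mem hu
  act_eq := fun hF hu => ins_eq_famBr hu hF
  act_emb := fun _ _ => ins_famEmb _ _

theorem ext_eq_iter (F : Fam 𝒢) (n : ℕ) (u : Fin n → Sym 𝒢) :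
    ext 𝒢 n (F n) u = ev0 (iter (fun u F => ins u F) n u F) := by
  induction n generalizing F with
  | zero => rfl
  | succ n ih => exact ih (ins (u 0) F) (fun i => u i.succ)

end Insertion

/-! ### The graded Lie algebra of the big bracket -/

section BigBracket

open Finset.HasAntidiagonal

theorem sum_antidiagonal_assoc {A : Type*} [AddCommMonoid A] (F : ℕ → ℕ → ℕ → A) (n : ℕ) :
    ∑ p ∈ antidiagonal n, ∑ q ∈ antidiagonal p.2, F p.1 q.1 q.2 =
      ∑ p ∈ antidiagonal n, ∑ q ∈ antidiagonal p.1, F q.1 q.2 p.2 := by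
  rw [Finset.sum_sigma', Finset.sum_sigma']
  refine Finset.sum_nbij' (fun x => ⟨(x.1.1 + x.2.1, x.2.2), (x.1.1, x.2.1)⟩)
    (fun x => ⟨(x.2.1, x.2.2 + x.1.2), (x.2.2, x.1.2)⟩) ?_ ?_ ?_ ?_ ?_
  · rintro ⟨⟨i, r⟩, ⟨j, l⟩⟩ h
    simp only [Finset.mem_sigma, mem_antidiagonal, and_true] at h ⊢
    omega
  · rintro ⟨⟨i, r⟩, ⟨j, l⟩⟩ h
    simp only [Finset.mem_sigma, mem_antidiagonal, and_true] at h ⊢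
    omega
  · rintro ⟨⟨i, r⟩, ⟨j, l⟩⟩ h
    simp only [Finset.mem_sigma, mem_antidiagonal] at h
    obtain ⟨-, rfl⟩ := h
    rfl
  · rintro ⟨⟨i, r⟩, ⟨j, l⟩⟩ h
    simp only [Finset.mem_sigma, mem_antidiagonal] at h
    obtain ⟨-, rfl⟩ := h
    rfl
  · rintro ⟨⟨i, r⟩, ⟨j, l⟩⟩ h
    rfl

theorem sum_antidiagonal_left_comm {A : Type*} [AddCommMonoid A] (F : ℕ → ℕ → ℕ → A) (n : ℕ) :
    ∑ p ∈ antidiagonal n, ∑ q ∈ antidiagonal p.2, F q.1 p.1 q.2 =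
      ∑ p ∈ antidiagonal n, ∑ q ∈ antidiagonal p.2, F p.1 q.1 q.2 := by
  rw [sum_antidiagonal_assoc, sum_antidiagonal_assoc (fun i j l => F j i l)]
  refine Finset.sum_congr rfl fun p _ => ?_
  rw [← Finset.Nat.sum_antidiagonal_swap]
  rfl

variable {k : Type u} [Field k] {g : Type v} [AddCommGroup g] [Module k g]
  {𝒢 : ℤ → Submodule k g}

/-- The components of `f` with values in `S^n (g[-1])`. -/
def slice (n : ℕ) : Big 𝒢 →ₗ[k] Fam 𝒢 where
  toFun f m := f m n
  map_add' _ _ := rfl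
  map_smul' _ _ := rfl

theorem big_ext {f h : Big 𝒢} (H : ∀ n, slice n f = slice n h) : f = h :=
  funext fun m => funext fun n => congrFun (H n) m

/-- The elements of degree `e` of `∏_{m ≥ 0, n ≥ 1} Hom (S^m (g[1]), S^n (g[-1]))[2]`. -/
def bigHom (e : ℤ) : Submodule k (Big 𝒢) where
  carrier := {f | slice 0 f = 0 ∧ ∀ n, slice n f ∈ famHom (symPart 𝒢 n) e}
  add_mem' := fun hf hh => ⟨by rw [map_add, hf.1, hh.1, add_zero], fun n => by
    rw [map_add]; exact add_mem (hf.2 n) (hh.2 n)⟩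
  zero_mem' := ⟨map_zero _, fun n => by rw [map_zero]; exact zero_mem _⟩
  smul_mem' := fun c f hf => ⟨by rw [map_smul, hf.1, smul_zero], fun n => by
    rw [map_smul]; exact Submodule.smul_mem _ c (hf.2 n)⟩

theorem slice_mem_symDeg {e : ℤ} {f : Big 𝒢} (hf : f ∈ bigHom e) (n : ℕ) :
    slice n f ∈ famHom (symDeg 𝒢) e :=
  famHom_mono (symPart_le_symDeg n) e (hf.2 n)

theorem mem_bigPlus_iff {e : ℤ} {f : Big 𝒢} :
    f ∈ bigPlus 𝒢 e ↔ f ∈ bigHom e ∧ ∀ n, f 0 n = 0 := by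
  constructor
  · intro hf
    exact ⟨⟨funext fun m => (hf m 0).1 (Or.inr rfl), fun n m => ⟨(hf m n).2.1, (hf m n).2.2⟩⟩,
      fun n => (hf 0 n).1 (Or.inl rfl)⟩
  · rintro ⟨hf, h0⟩ m n
    refine ⟨?_, (hf.2 n m).1, (hf.2 n m).2⟩
    rintro (rfl | rfl)
    · exact h0 n
    · exact congrFun hf.1 m

variable [DirectSum.Decomposition 𝒢]

theorem slice_circ (e : ℤ) (f h : Big 𝒢) (n : ℕ) :
    slice n (circ 𝒢 e f h) =
      ∑ ij ∈ antidiagonal (n + 1), famCirc e (slice ij.1 f) (slice ij.2 h) := by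
  funext m
  rw [Finset.sum_apply]
  exact circ_apply e f h m n

/-- A circle product uses up one generator of the output of `h`, so components in `S^(i+1)` and
`S^(j+1)` give one in `S^(i+j+1)`. With the index shifted by one this is an ordinary convolution;
the boundary terms vanish because there is no component in `S^0`. -/
theorem slice_circ_succ (e : ℤ) {f h : Big 𝒢} (hf : slice 0 f = 0) (hh : slice 0 h = 0) (n : ℕ) :
    slice (n + 1) (circ 𝒢 e f h) =
      ∑ ij ∈ antidiagonal n, famCirc e (slice (ij.1 + 1) f) (slice (ij.2 + 1) h) := by
  rw [slice_circ, Finset.Nat.sum_antidiagonal_succ, Finset.Nat.sum_antidiagonal_succ', hf, hh]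
  simp

theorem slice_circ_zero (e : ℤ) {f h : Big 𝒢} (hf : slice 0 f = 0) (hh : slice 0 h = 0) :
    slice 0 (circ 𝒢 e f h) = 0 := by
  rw [slice_circ, Finset.Nat.sum_antidiagonal_succ, Finset.Nat.antidiagonal_zero,
    Finset.sum_singleton, hf, hh]
  simp

theorem bigBracket_apply (a b : ℤ) (f h : Big 𝒢) :
    bigBracket 𝒢 a b f h = circ 𝒢 b f h - (a * b).negOnePow • circ 𝒢 a h f := rfl

theorem slice_bigBracket_succ (a b : ℤ) {f h : Big 𝒢} (hf : slice 0 f = 0) (hh : slice 0 h = 0)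
    (n : ℕ) :
    slice (n + 1) (bigBracket 𝒢 a b f h) =
      ∑ ij ∈ antidiagonal n, famBr a b (slice (ij.1 + 1) f) (slice (ij.2 + 1) h) := by
  rw [bigBracket_apply, map_sub, map_units_smul, slice_circ_succ _ hf hh, slice_circ_succ _ hh hf,
    ← Finset.Nat.sum_antidiagonal_swap (n := n) (f := fun ij : ℕ × ℕ =>
      famCirc a (slice (ij.1 + 1) h) (slice (ij.2 + 1) f)), Finset.smul_sum,
    ← Finset.sum_sub_distrib]
  rfl

theorem slice_bigBracket_zero (a b : ℤ) {f h : Big 𝒢} (hf : slice 0 f = 0) (hh : slice 0 h = 0) :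
    slice 0 (bigBracket 𝒢 a b f h) = 0 := by
  rw [bigBracket_apply, map_sub, map_units_smul, slice_circ_zero _ hf hh, slice_circ_zero _ hh hf,
    smul_zero, sub_zero]

theorem circ_mem {a b : ℤ} {f h : Big 𝒢} (hf : f ∈ bigHom a) (hh : h ∈ bigHom b) :
    circ 𝒢 b f h ∈ bigHom (a + b) := by
  refine ⟨slice_circ_zero _ hf.1 hh.1, fun n => ?_⟩
  rcases n with _ | n
  · rw [slice_circ_zero _ hf.1 hh.1]
    exact zero_mem _
  · rw [slice_circ_succ _ hf.1 hh.1]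
    refine Submodule.sum_mem _ fun ij hij => ?_
    rw [mem_antidiagonal] at hij
    refine famCirc_mem (P := symPart 𝒢 (ij.1 + 1)) (Q := symPart 𝒢 (ij.2 + 1))
      (fun c p φ u hφ hu => ?_) (hf.2 _) (hh.2 _)
    have := der_mem_symPart hφ hu
    rwa [add_right_comm, hij] at this

theorem bigBracket_mem {a b : ℤ} {f h : Big 𝒢} (hf : f ∈ bigHom a) (hh : h ∈ bigHom b) :
    bigBracket 𝒢 a b f h ∈ bigHom (a + b) := by
  rw [bigBracket_apply]
  refine _root_.sub_mem (circ_mem hf hh) (units_smul_mem _ ?_)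
  rw [add_comm]
  exact circ_mem hh hf

theorem bigBracket_antisymm (a b : ℤ) (f h : Big 𝒢) :
    bigBracket 𝒢 a b f h = -((a * b).negOnePow • bigBracket 𝒢 b a h f) := by
  rw [bigBracket_apply, bigBracket_apply, mul_comm b a]
  rcases Int.units_eq_one_or (a * b).negOnePow with h1 | h1 <;>
  · simp only [h1, one_smul, Units.neg_smul]
    abel

/-- After reindexing the double convolutions over the same triples of components, the identity is
that of `famBr` term by term. -/
theorem bigBracket_jacobi {a b c : ℤ} {f h j : Big 𝒢} (hf : f ∈ bigHom a) (hh : h ∈ bigHom b)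
    (hj : j ∈ bigHom c) :
    bigBracket 𝒢 a (b + c) f (bigBracket 𝒢 b c h j) =
      bigBracket 𝒢 (a + b) c (bigBracket 𝒢 a b f h) j +
        (a * b).negOnePow • bigBracket 𝒢 b (a + c) h (bigBracket 𝒢 a c f j) := by
  have hhj := bigBracket_mem hh hj
  have hfh := bigBracket_mem hf hh
  have hfj := bigBracket_mem hf hj
  refine big_ext fun n => ?_
  rcases n with _ | n
  · rw [map_add, map_units_smul, slice_bigBracket_zero _ _ hf.1 hhj.1,
      slice_bigBracket_zero _ _ hfh.1 hj.1, slice_bigBracket_zero _ _ hh.1 hfj.1, smul_zero,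
      add_zero]
  · rw [map_add, map_units_smul, slice_bigBracket_succ _ _ hf.1 hhj.1,
      slice_bigBracket_succ _ _ hfh.1 hj.1, slice_bigBracket_succ _ _ hh.1 hfj.1]
    simp only [slice_bigBracket_succ _ _ hf.1 hh.1, slice_bigBracket_succ _ _ hf.1 hj.1,
      slice_bigBracket_succ _ _ hh.1 hj.1, map_sum, LinearMap.sum_apply]
    rw [← sum_antidiagonal_assoc (fun x y z => famBr (a + b) c
        (famBr a b (slice (x + 1) f) (slice (y + 1) h)) (slice (z + 1) j)),
      sum_antidiagonal_left_comm (fun x y z => famBr b (a + c) (slice (y + 1) h)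
        (famBr a c (slice (x + 1) f) (slice (z + 1) j))), Finset.smul_sum,
      ← Finset.sum_add_distrib]
    refine Finset.sum_congr rfl fun p _ => ?_
    rw [Finset.smul_sum, ← Finset.sum_add_distrib]
    refine Finset.sum_congr rfl fun q _ => ?_
    exact famBr_isGradedLie.jacobi (slice_mem_symDeg hf _) (slice_mem_symDeg hh _)
      (slice_mem_symDeg hj _)

theorem bigBracket_isGradedLie : IsGradedLie (bigHom (𝒢 := 𝒢)) (bigBracket 𝒢) where
  bracket_mem := bigBracket_mem
  antisymm := bigBracket_antisymm
  jacobi := bigBracket_jacobi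

/-- An element of `Ŝ (g[-1])`, without its component in `S^0`, as an element concentrated in
arity zero. -/
def bigEmb (a : ℕ → Sym 𝒢) : Big 𝒢 := fun m n => if n = 0 then 0 else famEmb (a n) m

theorem slice_zero_bigEmb (a : ℕ → Sym 𝒢) : slice 0 (bigEmb a) = 0 := rfl

theorem slice_succ_bigEmb (a : ℕ → Sym 𝒢) (n : ℕ) :
    slice (n + 1) (bigEmb a) = famEmb (a (n + 1)) := rfl

/-- Insertion of an element of `Ŝ (g[-1])` as the first argument, as a derivation in it. -/
def bigIns (a : ℕ → Sym 𝒢) : Big 𝒢 →ₗ[k] Big 𝒢 where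
  toFun f m n := match n with
    | 0 => 0
    | n + 1 => ∑ ij ∈ antidiagonal n, ins (a (ij.2 + 1)) (slice (ij.1 + 1) f) m
  map_add' f h := by
    funext m n
    rcases n with _ | n
    · simp
    · simp [Finset.sum_add_distrib]
  map_smul' c f := by
    funext m n
    rcases n with _ | n
    · simp
    · simp [Finset.smul_sum]

theorem slice_zero_bigIns (a : ℕ → Sym 𝒢) (f : Big 𝒢) : slice 0 (bigIns a f) = 0 := rfl

theorem slice_succ_bigIns (a : ℕ → Sym 𝒢) (f : Big 𝒢) (n : ℕ) :
    slice (n + 1) (bigIns a f) =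
      ∑ ij ∈ antidiagonal n, ins (a (ij.2 + 1)) (slice (ij.1 + 1) f) := by
  funext m
  rw [Finset.sum_apply]
  rfl

variable (𝒢) in
/-- The grading of `Ŝ (g[-1])[2]`. -/
abbrev hatShift : ℤ → Submodule k (ℕ → Sym 𝒢) := shift (shift (hatDeg 𝒢) 1) 1

theorem mem_hatShift {p : ℤ} {a : ℕ → Sym 𝒢} :
    a ∈ hatShift 𝒢 p ↔ ∀ n, a n ∈ symPart 𝒢 n (2 + p) := by
  have : (1 : ℤ) + (1 + p) = 2 + p := by ring
  change (∀ n, a n ∈ symPart 𝒢 n (1 + (1 + p))) ↔ _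
  rw [this]

/-- `Ŝ (g[-1])[2]` acts on the big Lie algebra as an abelian subalgebra. Its component in `S^0`
plays no role: `bigEmb` discards it and `bigIns` never uses it. -/
theorem bigIns_isDerivedAction :
    IsDerivedAction (bigHom (𝒢 := 𝒢)) (bigBracket 𝒢) (hatShift 𝒢) bigEmb bigIns where
  lie := bigBracket_isGradedLie
  emb_mem := by
    intro p a ha
    rw [mem_hatShift] at ha
    refine ⟨slice_zero_bigEmb a, fun n => ?_⟩
    rcases n with _ | n
    · rw [slice_zero_bigEmb]
      exact zero_mem _
    · rw [slice_succ_bigEmb]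
      exact famEmb_mem (ha _)
  act_eq := by
    intro e p f a hf ha
    rw [mem_hatShift] at ha
    refine big_ext fun n => ?_
    rcases n with _ | n
    · rw [slice_bigBracket_zero _ _ hf.1 (slice_zero_bigEmb a), slice_zero_bigIns]
    · rw [slice_bigBracket_succ _ _ hf.1 (slice_zero_bigEmb a), slice_succ_bigIns]
      refine Finset.sum_congr rfl fun ij _ => ?_
      rw [slice_succ_bigEmb]
      exact ins_eq_famBr (symPart_le_symDeg _ _ (ha _)) (slice_mem_symDeg hf _)
  act_emb := by
    intro p q a b _ _
    refine big_ext fun n => ?_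
    rcases n with _ | n
    · rfl
    · rw [slice_succ_bigIns, map_zero]
      refine Finset.sum_eq_zero fun ij _ => ?_
      rw [slice_succ_bigEmb, ins_famEmb]

end BigBracket

/-! ### The brackets as derived brackets -/

section Brackets

open Finset.HasAntidiagonal Finset.Nat

theorem sum_antidiagonalTuple_succ {A : Type*} [AddCommMonoid A] (n q : ℕ)
    (G : (Fin (n + 1) → ℕ) → A) :
    ∑ ν ∈ antidiagonalTuple (n + 1) q, G ν =
      ∑ p ∈ antidiagonal q, ∑ ν ∈ antidiagonalTuple n p.2, G (Fin.cons p.1 ν) := by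
  rw [Finset.sum_sigma']
  refine Finset.sum_nbij' (fun ν => ⟨(ν 0, ∑ i : Fin n, ν i.succ), fun i => ν i.succ⟩)
    (fun x => Fin.cons x.1.1 x.2) ?_ ?_ ?_ ?_ ?_
  · intro ν h
    rw [mem_antidiagonalTuple, Fin.sum_univ_succ] at h
    simp [mem_antidiagonalTuple, h]
  · rintro ⟨⟨i, r⟩, ν⟩ h
    simp only [Finset.mem_sigma, mem_antidiagonal, mem_antidiagonalTuple] at h ⊢
    simp [Fin.sum_univ_succ, h]
  · intro ν _
    exact Fin.cons_self_tail ν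
  · rintro ⟨⟨i, r⟩, ν⟩ h
    simp only [Finset.mem_sigma, mem_antidiagonal, mem_antidiagonalTuple] at h
    obtain ⟨-, rfl⟩ := h
    simp
  · intro ν _
    exact congrArg G (Fin.cons_self_tail ν).symm

variable {k : Type u} [Field k] {g : Type v} [AddCommGroup g] [Module k g]
  {𝒢 : ℤ → Submodule k g} [DirectSum.Decomposition 𝒢]

theorem ev0_iter_bigIns (n : ℕ) (x : Fin n → ℕ → Sym 𝒢) (f : Big 𝒢) (q : ℕ) :
    ev0 (slice (q + 1) (iter (fun a f => bigIns a f) n x f)) =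
      ∑ p ∈ antidiagonal q, ∑ ν ∈ antidiagonalTuple n p.2,
        ext 𝒢 n (f n (p.1 + 1)) (fun i => x i (ν i + 1)) := by
  induction n generalizing f q with
  | zero =>
    rw [Finset.sum_eq_single (q, 0)]
    · rw [antidiagonalTuple_zero_zero, Finset.sum_singleton]
      rfl
    · rintro ⟨i, j⟩ h h'
      rcases j with _ | j
      · simp only [mem_antidiagonal, add_zero] at h
        exact absurd (by rw [h]) h'
      · simp
    · simp
  | succ n ih =>
    rw [iter, ih]
    simp only [sum_antidiagonalTuple_succ n]
    rw [sum_antidiagonal_assoc (fun a b c => ∑ ν ∈ antidiagonalTuple n c,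
      ext 𝒢 (n + 1) (f (n + 1) (a + 1))
        (fun i => x i ((Fin.cons b ν : Fin (n + 1) → ℕ) i + 1)))]
    refine Finset.sum_congr rfl fun p _ => ?_
    rw [Finset.sum_comm]
    refine Finset.sum_congr rfl fun ν _ => ?_
    have h : bigIns (x 0) f n (p.1 + 1) =
      ∑ ij ∈ antidiagonal p.1, insertArg 𝒢 n (x 0 (ij.2 + 1)) (f (n + 1) (ij.1 + 1)) := rfl
    rw [h, map_sum, sum_apply]
    rfl

theorem slice_zero_iter_bigIns (n : ℕ) (x : Fin n → ℕ → Sym 𝒢) {f : Big 𝒢} (hf : slice 0 f = 0) :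
    slice 0 (iter (fun a f => bigIns a f) n x f) = 0 := by
  induction n generalizing f with
  | zero => exact hf
  | succ n ih => exact ih _ (slice_zero_bigIns _ _)

theorem slice_bigIns_hatGen (y : g) (f : Big 𝒢) (n : ℕ) :
    slice (n + 1) (bigIns (hatGen 𝒢 y) f) = contract y (slice (n + 1) f) := by
  rw [slice_succ_bigIns, Finset.sum_eq_single (n, 0)]
  · have : hatGen 𝒢 y (0 + 1) = gen 𝒢 y := by simp [hatGen]
    rw [this, ins_gen]
  · rintro ⟨i, j⟩ h h'
    rcases j with _ | j
    · simp only [mem_antidiagonal, add_zero] at h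
      exact absurd (by rw [h]) h'
    · have : hatGen 𝒢 y (j + 1 + 1) = 0 := by simp [hatGen]
      rw [this]
      funext m
      exact LinearMap.map_zero₂ (insertArg 𝒢 m) _
  · simp

theorem slice_iter_bigIns_hatGen (m : ℕ) (y : Fin m → g) (f : Big 𝒢) (q : ℕ) :
    slice (q + 1) (iter (fun a f => bigIns a f) m (fun i => hatGen 𝒢 (y i)) f) =
      iter (fun y F => contract y F) m y (slice (q + 1) f) := by
  induction m generalizing f with
  | zero => rfl
  | succ m ih =>
    refine (ih (fun i => y i.succ) _).trans ?_
    rw [slice_bigIns_hatGen]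
    rfl

/-! ### Iterated insertions into `l₁ + l₂ + ⋯` -/

variable (l : ∀ n : ℕ, MultilinearMap k (fun _ : Fin n => g) g)

variable (𝒢) in
/-- The brackets of `g`, with values in `S (g[-1])`. -/
def famL : Fam 𝒢 := fun m => (gen 𝒢).compMultilinearMap (l m)

theorem slice_bigElement_of_ne {n : ℕ} (hn : n ≠ 1) : slice n (bigElement 𝒢 l) = 0 := by
  funext m
  exact if_neg hn

theorem hatBracket_eq_ev0 (n : ℕ) (x : Fin n → ℕ → Sym 𝒢) (q : ℕ) :
    hatBracket 𝒢 l n x q =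
      ev0 (slice q (iter (fun a f => bigIns a f) n x (bigElement 𝒢 l))) := by
  rcases q with _ | q
  · rw [slice_zero_iter_bigIns n x (slice_bigElement_of_ne l zero_ne_one), map_zero]
    rfl
  -- Only the index `0`, that is `S^1`, contributes, because the brackets of `g` take values in the
  -- generators.
  · rw [ev0_iter_bigIns, Finset.sum_eq_single (0, q)]
    · have h : hatBracket 𝒢 l n x (q + 1) = (∑ ν ∈ antidiagonalTuple n q,
        (symBracket 𝒢 l n).compLinearMap fun i => LinearMap.proj (ν i + 1)) x := rfl
      rw [h, sum_apply]
      rfl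
    · rintro ⟨i, j⟩ h h'
      rcases i with _ | i
      · simp only [mem_antidiagonal, zero_add] at h
        exact absurd (by rw [h]) h'
      · have : bigElement 𝒢 l n (i + 1 + 1) = 0 := if_neg (by omega)
        simp [this]
    · simp

/-- Evaluation on `y` is iterated contraction, and contraction with a generator is its insertion.
The arguments `y` thus simply prolong the list of inserted elements. -/
theorem iter_bigIns_apply (n : ℕ) (x : Fin n → ℕ → Sym 𝒢) (m q : ℕ) (y : Fin m → g) :
    iter (fun a f => bigIns a f) n x (bigElement 𝒢 l) m q y =
      hatBracket 𝒢 l (n + m) (Fin.append x (fun i => hatGen 𝒢 (y i))) q := by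
  rcases q with _ | q
  · have := congrFun (slice_zero_iter_bigIns n x
      (slice_bigElement_of_ne (𝒢 := 𝒢) l zero_ne_one)) m
    exact congrArg (fun f => f y) this
  · rw [hatBracket_eq_ev0, iter_append, slice_iter_bigIns_hatGen, ← apply_eq_iter]
    rfl

theorem phi_zero_apply (n : ℕ) (x : Fin n → ℕ → Sym 𝒢) (q : ℕ) : phi 𝒢 l n x 0 q = 0 := by
  simp [phi]

theorem phi_succ_apply (n : ℕ) (x : Fin n → ℕ → Sym 𝒢) (m q : ℕ) :
    phi 𝒢 l n x (m + 1) q = iter (fun a f => bigIns a f) n x (bigElement 𝒢 l) (m + 1) q := by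
  ext y
  rw [phi_apply 𝒢 l n x (m + 1) q (Nat.succ_ne_zero m), iter_bigIns_apply]

/-- The decomposition behind the theorem: the derived bracket with values in the big Lie algebra
splits by arity into the morphism and the bracket of the source. -/
theorem iter_bigIns_eq (n : ℕ) (x : Fin n → ℕ → Sym 𝒢) :
    iter (fun a f => bigIns a f) n x (bigElement 𝒢 l) =
      phi 𝒢 l n x + bigEmb (hatBracket 𝒢 l n x) := by
  funext m q
  rcases m with _ | m
  · rw [Pi.add_apply, Pi.add_apply, phi_zero_apply, zero_add]
    ext y
    rw [Subsingleton.elim y Fin.elim0]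
    change ev0 (slice q _) = _
    rw [← hatBracket_eq_ev0]
    rcases q with _ | q <;> rfl
  · rw [Pi.add_apply, Pi.add_apply, phi_succ_apply]
    have : bigEmb (hatBracket 𝒢 l n x) (m + 1) q = 0 := by
      simp [bigEmb, famEmb]
    rw [this, add_zero]

/-! ### The Maurer-Cartan equation of `l₁ + l₂ + ⋯` -/

variable {l}

theorem famL_mem (hl : IsLInfinity 𝒢 l) : famL 𝒢 l ∈ famHom (symPart 𝒢 1) 1 := by
  intro m
  refine ⟨fun d x hx i j hij => ?_, fun d x hx => ?_⟩
  · change gen 𝒢 (l m _) = _ • gen 𝒢 (l m x)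
    rw [hl.symm m d x hx i j hij, map_units_smul]
  · exact gen_mem_symPart (mem_shift_one.1 (hl.degree m d x hx))

theorem bigElement_mem (hl : IsLInfinity 𝒢 l) : bigElement 𝒢 l ∈ bigHom 1 := by
  refine ⟨slice_bigElement_of_ne l zero_ne_one, fun n => ?_⟩
  by_cases hn : n = 1
  · subst hn
    exact famL_mem hl
  · rw [slice_bigElement_of_ne l hn]
    exact zero_mem _

theorem bigElement_mem_bigPlus (hl : IsLInfinity 𝒢 l) : bigElement 𝒢 l ∈ bigPlus 𝒢 1 := by
  refine mem_bigPlus_iff.2 ⟨bigElement_mem hl, fun n => ?_⟩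
  unfold bigElement
  split_ifs
  · rw [hl.zero]
    ext
    simp
  · rfl

/-- The circle product feeds the inner value into the last slot, whereas the higher Jacobi identity
has it in the first one. -/
theorem famL_snoc (hl : IsLInfinity 𝒢 l)
    {n : ℕ} {d : Fin n → ℤ} {x : Fin n → g} (hx : ∀ i, x i ∈ shift 𝒢 1 (d i))
    {q : ℤ} {y : g} (hy : y ∈ shift 𝒢 1 q) :
    famL 𝒢 l (n + 1) (Fin.snoc (α := fun _ => g) x y) =
      (q * ∑ i, d i).negOnePow • famL 𝒢 l (n + 1) (Fin.cons y x) := by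
  rw [apply_eq_iter, apply_eq_iter, iter_snoc, iter_cons,
    (contract_gradedAction _).act_iter hx (famL_mem hl) hy, map_units_smul]

/-- The inner bracket is a generator, on which a derivation is plain evaluation, so the sum is the
higher Jacobi identity reindexed by complements. The sign of exchanging the blocks cancels that of
moving the inner bracket. -/
theorem famCirc_famL (hl : IsLInfinity 𝒢 l) : famCirc 1 (famL 𝒢 l) (famL 𝒢 l) = 0 := by
  funext m
  refine mult_ext (𝒢 := 𝒢) fun d x hx => ?_
  have hj := congrArg (gen 𝒢) (hl.jacobi m d x hx)
  rw [map_zero, map_sum, ← Equiv.sum_comp (compl_involutive (α := Finset (Fin m))).toPerm] at hj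
  rw [famCirc_apply _ _ _ hx]
  refine Eq.trans (Finset.sum_congr rfl fun S _ => ?_) hj
  rw [Function.Involutive.coe_toPerm, compl_compl]
  have hv := hl.degree _ _ _ (sub_mem Sᶜ hx)
  have hL : famL 𝒢 l Sᶜ.card (sub x Sᶜ) = gen 𝒢 (l Sᶜ.card (sub x Sᶜ)) := rfl
  rw [hL, der_gen, MultilinearMap.curryRight_apply, famL_snoc hl (sub_mem S hx) hv, smul_smul,
    map_units_smul, koszul_compl, sum_sub, sum_sub]
  congr 1
  rw [mul_assoc, ← Int.negOnePow_add]
  congr 1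
  apply negOnePow_congr
  simp only [Int.even_add, Int.even_mul, Int.not_even_one]
  tauto

theorem bigBracket_bigElement (hl : IsLInfinity 𝒢 l) :
    bigBracket 𝒢 1 1 (bigElement 𝒢 l) (bigElement 𝒢 l) = 0 := by
  have h0 := slice_bigElement_of_ne (𝒢 := 𝒢) l zero_ne_one
  have hc : circ 𝒢 1 (bigElement 𝒢 l) (bigElement 𝒢 l) = 0 := by
    refine big_ext fun n => ?_
    rcases n with _ | n
    · rw [slice_circ_zero _ h0 h0, map_zero]
    · rw [slice_circ_succ _ h0 h0, map_zero]
      refine Finset.sum_eq_zero fun ij _ => ?_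
      by_cases h1 : ij.1 = 0
      · by_cases h2 : ij.2 = 0
        · rw [h1, h2]
          exact famCirc_famL hl
        · rw [slice_bigElement_of_ne l (n := ij.2 + 1) (by omega), map_zero]
      · rw [slice_bigElement_of_ne l (n := ij.1 + 1) (by omega), map_zero, LinearMap.zero_apply]
  rw [bigBracket_apply, hc, smul_zero, sub_zero]

end Brackets

/-! ### The multiderivations of the symmetric algebra -/

section Morphism

open Finset.HasAntidiagonal

variable {k : Type u} [Field k] {g : Type v} [AddCommGroup g] [Module k g]
  {𝒢 : ℤ → Submodule k g} [DirectSum.Decomposition 𝒢]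
  {l : ∀ n : ℕ, MultilinearMap k (fun _ : Fin n => g) g}

theorem symBracket_eq_ev0 (n : ℕ) (u : Fin n → Sym 𝒢) :
    symBracket 𝒢 l n u = ev0 (iter (fun u F => ins u F) n u (famL 𝒢 l)) :=
  ext_eq_iter (famL 𝒢 l) n u

theorem iter_ins_gen (n : ℕ) (x : Fin n → g) (F : Fam 𝒢) :
    iter (fun u F => ins u F) n (fun i => gen 𝒢 (x i)) F = iter (fun y F => contract y F) n x F := by
  induction n generalizing F with
  | zero => rfl
  | succ n ih =>
    refine (ih (fun i => x i.succ) _).trans ?_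
    exact congrArg (iter (fun y F => contract y F) n fun i => x i.succ) (ins_gen (x 0) F)

theorem symBracket_isMultiderivationExtension (hl : IsLInfinity 𝒢 l) :
    IsMultiderivationExtension 𝒢 l (symBracket 𝒢 l) := by
  have hL : famL 𝒢 l ∈ famHom (symDeg 𝒢) 1 :=
    famHom_mono (symPart_le_symDeg 1) 1 (famL_mem hl)
  refine ⟨fun n x => ?_, fun n d x hx i j hij => ?_, fun n d a ha => ?_,
    fun n d a p b c ha hb => ?_⟩
  · rw [symBracket_eq_ev0, iter_ins_gen, ← apply_eq_iter]
    rfl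
  · rw [symBracket_eq_ev0, symBracket_eq_ev0,
      ins_isDerivedAction.gradedAction.iter_swap hx hL hij, map_units_smul]
  · rw [symBracket_eq_ev0, add_comm _ (1 : ℤ)]
    exact ev0_mem (ins_isDerivedAction.gradedAction.iter_mem ha hL)
  -- The last argument is inserted last, so as a function of it the bracket is a derivation `der` of
  -- degree `1 + ∑ i, d i`.
  · have hd := ev1_hasDegree (ins_isDerivedAction.gradedAction.iter_mem ha hL)
    simp only [symBracket_eq_ev0, iter_snoc, ev0_ins]
    rw [der_mul hd hb, mul_comm p]

/-! ### The components of the morphism -/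

theorem hatBracket_eq_zero {n : ℕ} (h : l n = 0) : hatBracket 𝒢 l n = 0 := by
  have h0 : symBracket 𝒢 l n = 0 := by
    have : (gen 𝒢).compMultilinearMap (l n) = 0 := by
      rw [h]
      ext
      simp
    rw [symBracket, this, map_zero]
  refine MultilinearMap.ext fun x => funext fun q => ?_
  rcases q with _ | q
  · rfl
  · have h : hatBracket 𝒢 l n x (q + 1) = (∑ ν ∈ Finset.Nat.antidiagonalTuple n q,
        (symBracket 𝒢 l n).compLinearMap fun i => LinearMap.proj (ν i + 1)) x := rfl
    rw [h, sum_apply]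
    exact Finset.sum_eq_zero fun ν _ => by rw [h0]; rfl

theorem iter_bigIns_mem (hl : IsLInfinity 𝒢 l) {n : ℕ} {d : Fin n → ℤ} {x : Fin n → ℕ → Sym 𝒢}
    (hx : ∀ i, x i ∈ hatShift 𝒢 (d i)) :
    iter (fun a f => bigIns a f) n x (bigElement 𝒢 l) ∈ bigHom (1 + ∑ i, d i) :=
  bigIns_isDerivedAction.gradedAction.iter_mem hx (bigElement_mem hl)

theorem hatBracket_mem (hl : IsLInfinity 𝒢 l) {n : ℕ} {d : Fin n → ℤ} {x : Fin n → ℕ → Sym 𝒢}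
    (hx : ∀ i, x i ∈ hatShift 𝒢 (d i)) : hatBracket 𝒢 l n x ∈ hatShift 𝒢 (1 + ∑ i, d i) := by
  refine mem_hatShift.2 fun q => ?_
  rw [hatBracket_eq_ev0]
  exact ev0_mem ((iter_bigIns_mem hl hx).2 q)

theorem phi_mem (hl : IsLInfinity 𝒢 l) {n : ℕ} {d : Fin n → ℤ} {x : Fin n → ℕ → Sym 𝒢}
    (hx : ∀ i, x i ∈ hatShift 𝒢 (d i)) : phi 𝒢 l n x ∈ bigPlus 𝒢 (1 + ∑ i, d i) := by
  have h := iter_bigIns_mem hl hx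
  refine mem_bigPlus_iff.2 ⟨⟨funext fun m => ?_, fun q m => ?_⟩, phi_zero_apply l n x⟩
  · change phi 𝒢 l n x m 0 = 0
    rcases m with _ | m
    · exact phi_zero_apply l n x 0
    · rw [phi_succ_apply]
      exact congrFun h.1 (m + 1)
  · have hs : slice q (phi 𝒢 l n x) m = phi 𝒢 l n x m q := rfl
    rw [hs]
    rcases m with _ | m
    · rw [phi_zero_apply]
      exact (zero_mem (famHom (symPart 𝒢 q) (1 + ∑ i, d i))) 0
    · rw [phi_succ_apply]
      exact h.2 q (m + 1)

/-- As `l₀ = 0`, nothing is lost when arity zero is dropped. Terms with an empty block thereby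
become the differential. -/
theorem phi_zero (hl : IsLInfinity 𝒢 l) (x : Fin 0 → ℕ → Sym 𝒢) :
    phi 𝒢 l 0 x = bigElement 𝒢 l := by
  funext m q
  rcases m with _ | m
  · rw [phi_zero_apply, (mem_bigPlus_iff.1 (bigElement_mem_bigPlus hl)).2]
  · rw [phi_succ_apply]
    rfl

theorem phi_isGradedSymm (hl : IsLInfinity 𝒢 l) (n : ℕ) :
    IsGradedSymm (hatShift 𝒢) (phi 𝒢 l n) := by
  intro d x hx i j hij
  funext m q
  change _ = (d i * d j).negOnePow • phi 𝒢 l n x m q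
  rcases m with _ | m
  · rw [phi_zero_apply, phi_zero_apply, smul_zero]
  · rw [phi_succ_apply, phi_succ_apply,
      bigIns_isDerivedAction.gradedAction.iter_swap hx (bigElement_mem hl) hij]
    rfl

theorem hatBracket_isGradedSymm (hl : IsLInfinity 𝒢 l) (n : ℕ) :
    IsGradedSymm (hatShift 𝒢) (hatBracket 𝒢 l n) := by
  intro d x hx i j hij
  funext q
  change _ = (d i * d j).negOnePow • hatBracket 𝒢 l n x q
  rw [hatBracket_eq_ev0, hatBracket_eq_ev0,
    bigIns_isDerivedAction.gradedAction.iter_swap hx (bigElement_mem hl) hij, map_units_smul,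
    map_units_smul]

/-! ### The dg Lie algebra of the big bracket -/

/-- Without arguments, `h` can contribute only its arity-zero part. Hence `ℬ⁺` is closed under the
bracket. -/
theorem circ_zero_apply (e : ℤ) (f : Big 𝒢) {h : Big 𝒢} (hh : ∀ n, h 0 n = 0) (n : ℕ) :
    circ 𝒢 e f h 0 n = 0 := by
  ext x
  rw [Subsingleton.elim x Fin.elim0]
  change ev0 (slice n (circ 𝒢 e f h)) = 0
  rw [slice_circ, map_sum]
  refine Finset.sum_eq_zero fun ij _ => ?_
  have h0 : ev0 (slice ij.2 h) = 0 := by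
    change h 0 ij.2 Fin.elim0 = 0
    rw [hh]
    rfl
  rw [ev0_famCirc, h0, map_zero]

theorem bigBracket_mem_bigPlus {a b : ℤ} {f h : Big 𝒢} (hf : f ∈ bigPlus 𝒢 a)
    (hh : h ∈ bigPlus 𝒢 b) : bigBracket 𝒢 a b f h ∈ bigPlus 𝒢 (a + b) := by
  rw [mem_bigPlus_iff] at hf hh ⊢
  refine ⟨bigBracket_mem hf.1 hh.1, fun n => ?_⟩
  change circ 𝒢 b f h 0 n - (a * b).negOnePow • circ 𝒢 a h f 0 n = 0
  rw [circ_zero_apply b f hh.2, circ_zero_apply a h hf.2, smul_zero, sub_zero]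

variable [CharZero k]

theorem bigPlus_isDGLie (hl : IsLInfinity 𝒢 l) :
    IsDGLie (bigPlus 𝒢) (bigBracket 𝒢) (bigD 𝒢 l) := by
  have hL := bigElement_mem hl
  refine ⟨fun a b f h hf hh => bigBracket_mem_bigPlus hf hh, fun a f hf => ?_,
    fun a b f h _ _ => bigBracket_antisymm a b f h, fun a b c f h j hf hh hj => ?_,
    fun a f hf => ?_, fun a b f h hf hh => ?_⟩
  · rw [add_comm a]
    exact bigBracket_mem_bigPlus (bigElement_mem_bigPlus hl) hf
  · rw [mem_bigPlus_iff] at hf hh hj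
    exact bigBracket_jacobi hf.1 hh.1 hj.1
  · rw [mem_bigPlus_iff] at hf
    -- With `[l, l] = 0` the Jacobi identity reads `[l, [l, f]] = -[l, [l, f]]`, so characteristic
    -- zero gives `d² = 0`.
    have hj := bigBracket_jacobi hL hL hf.1
    rw [bigBracket_bigElement hl, map_zero, LinearMap.zero_apply, zero_add, mul_one,
      Int.negOnePow_one, Units.neg_smul, one_smul, eq_neg_iff_add_eq_zero, ← two_smul k,
      smul_eq_zero_iff_right two_ne_zero] at hj
    rw [add_comm a]
    exact hj
  · rw [mem_bigPlus_iff] at hf hh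
    -- The Leibniz rule is the Jacobi identity with `l` as first entry.
    have hj := bigBracket_jacobi hL hf.1 hh.1
    rw [one_mul] at hj
    rw [add_comm a 1, add_comm b 1]
    exact hj

/-! ### The morphism -/

/-- This is the arity-zero part of the derived identity. The brackets of values of `φ` lie in `ℬ⁺`
and drop out, and the factor `2` is cancelled. -/
theorem hatBracket_jacobi (hl : IsLInfinity 𝒢 l) {n : ℕ} {d : Fin n → ℤ}
    {x : Fin n → ℕ → Sym 𝒢} (hx : ∀ i, x i ∈ hatShift 𝒢 (d i)) :
    ∑ S : Finset (Fin n), koszul d S • hatBracket 𝒢 l (Sᶜ.card + 1)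
      (Fin.cons (hatBracket 𝒢 l S.card (sub x S)) (sub x Sᶜ)) = 0 := by
  have key := bigIns_isDerivedAction.derived_identity (bigElement_mem hl)
    (bigBracket_bigElement hl) (fun n x => phi 𝒢 l n x) (fun n x => hatBracket 𝒢 l n x)
    (fun hx => (mem_bigPlus_iff.1 (phi_mem hl hx)).1) (fun hx => hatBracket_mem hl hx)
    (iter_bigIns_eq l) hx
  funext q
  have h := congrArg (fun f => ev0 (slice q f)) key
  simp only [map_add, map_sum, map_units_smul, map_zsmul, map_zero, ← hatBracket_eq_ev0] at h
  rw [Finset.sum_eq_zero, zero_add, ← Int.cast_smul_eq_zsmul k,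
    smul_eq_zero_iff_right (by simp)] at h
  · rw [Finset.sum_apply]
    exact h
  · intro S _
    have hS := bigBracket_mem_bigPlus (phi_mem hl (sub_mem S hx)) (phi_mem hl (sub_mem Sᶜ hx))
    rw [sum_sub, sum_sub, mem_bigPlus_iff] at hS
    have h0 : ev0 (slice q (bigBracket 𝒢 (1 + ∑ i ∈ S, d i) (1 + ∑ i ∈ Sᶜ, d i)
        (phi 𝒢 l S.card (sub x S)) (phi 𝒢 l Sᶜ.card (sub x Sᶜ)))) = 0 :=
      congrArg (fun f => f Fin.elim0) (hS.2 q)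
    rw [h0, smul_zero]

theorem hatBracket_isLInfinity (hl : IsLInfinity 𝒢 l) :
    IsLInfinity (shift (hatDeg 𝒢) 1) (hatBracket 𝒢 l) where
  zero := hatBracket_eq_zero hl.zero
  symm := hatBracket_isGradedSymm hl
  degree := fun n d x hx => by
    rw [add_comm _ (1 : ℤ)]
    exact hatBracket_mem hl hx
  jacobi := fun _ _ _ hx => hatBracket_jacobi hl hx

/-- In positive arity the iterated brackets of the derived identity are the values of `φ`; in arity
zero every term vanishes. -/
theorem phi_identity (hl : IsLInfinity 𝒢 l) {n : ℕ} {d : Fin n → ℤ}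
    {x : Fin n → ℕ → Sym 𝒢} (hx : ∀ i, x i ∈ hatShift 𝒢 (d i)) :
    ∑ S : Finset (Fin n), (koszul d S * (∑ i ∈ S, d i).negOnePow) •
        bigBracket 𝒢 (1 + ∑ i ∈ S, d i) (1 + ∑ i ∈ Sᶜ, d i)
          (phi 𝒢 l S.card (sub x S)) (phi 𝒢 l Sᶜ.card (sub x Sᶜ)) +
      (2 : ℤ) • ∑ S : Finset (Fin n), koszul d S • phi 𝒢 l (Sᶜ.card + 1)
        (Fin.cons (hatBracket 𝒢 l S.card (sub x S)) (sub x Sᶜ)) = 0 := by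
  have key := bigIns_isDerivedAction.derived_identity (bigElement_mem hl)
    (bigBracket_bigElement hl) (fun n x => phi 𝒢 l n x) (fun n x => hatBracket 𝒢 l n x)
    (fun hx => (mem_bigPlus_iff.1 (phi_mem hl hx)).1) (fun hx => hatBracket_mem hl hx)
    (iter_bigIns_eq l) hx
  funext m q
  rcases m with _ | m
  · simp only [Pi.add_apply, Pi.smul_apply, Finset.sum_apply, Pi.zero_apply]
    rw [Finset.sum_eq_zero, Finset.sum_eq_zero, smul_zero, add_zero]
    · intro S _
      exact (congrArg (koszul d S • ·) (phi_zero_apply l _ _ q)).trans (smul_zero _)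
    · intro S _
      have hS := bigBracket_mem_bigPlus (phi_mem hl (sub_mem S hx)) (phi_mem hl (sub_mem Sᶜ hx))
      rw [sum_sub, sum_sub, mem_bigPlus_iff] at hS
      exact (congrArg (_ • ·) (hS.2 q)).trans (smul_zero _)
  · have h := congrFun (congrFun key (m + 1)) q
    simp only [Pi.add_apply, Pi.smul_apply, Finset.sum_apply] at h ⊢
    refine Eq.trans ?_ h
    congr 2
    refine Finset.sum_congr rfl fun S _ => ?_
    exact congrArg (koszul d S • ·) (phi_succ_apply l _ _ m q)

theorem phi_compat (hl : IsLInfinity 𝒢 l) {n : ℕ} (hn : 1 ≤ n) {d : Fin n → ℤ}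
    {x : Fin n → ℕ → Sym 𝒢} (hx : ∀ i, x i ∈ hatShift 𝒢 (d i)) :
    -bigD 𝒢 l (1 + ∑ i, d i) (phi 𝒢 l n x)
      + (2⁻¹ : k) • ∑ S : Finset (Fin n) with S.Nonempty ∧ Sᶜ.Nonempty,
          koszul d S • (1 + ∑ i ∈ S, d i).negOnePow •
            bigBracket 𝒢 (1 + ∑ i ∈ S, d i) (1 + ∑ i ∈ Sᶜ, d i)
              (phi 𝒢 l S.card (sub x S)) (phi 𝒢 l Sᶜ.card (sub x Sᶜ))
    = ∑ S : Finset (Fin n) with S.Nonempty,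
        koszul d S • phi 𝒢 l (Sᶜ.card + 1)
          (Fin.cons (hatBracket 𝒢 l S.card (sub x S)) (sub x Sᶜ)) := by
  have key := phi_identity hl hx
  set T : Finset (Fin n) → Big 𝒢 := fun S => (koszul d S * (∑ i ∈ S, d i).negOnePow) •
        bigBracket 𝒢 (1 + ∑ i ∈ S, d i) (1 + ∑ i ∈ Sᶜ, d i)
          (phi 𝒢 l S.card (sub x S)) (phi 𝒢 l Sᶜ.card (sub x Sᶜ)) with hT
  set U : Finset (Fin n) → Big 𝒢 := fun S => koszul d S • phi 𝒢 l (Sᶜ.card + 1)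
        (Fin.cons (hatBracket 𝒢 l S.card (sub x S)) (sub x Sᶜ)) with hU
  -- The empty block would contribute the bracket `l₀`, which is zero.
  have hU0 : ∑ S : Finset (Fin n), U S = ∑ S : Finset (Fin n) with S.Nonempty, U S := by
    refine (Finset.sum_filter_of_ne fun S _ hS => ?_).symm
    by_contra h
    rw [Finset.not_nonempty_iff_eq_empty] at h
    subst h
    apply hS
    have h0 : hatBracket 𝒢 l (∅ : Finset (Fin n)).card (sub x ∅) = 0 := by
      rw [hatBracket_eq_zero (by rw [Finset.card_empty, hl.zero])]
      rfl
    simp only [hU]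
    rw [h0, (phi 𝒢 l _).map_coord_zero 0 rfl, smul_zero]
  have hTe : T ∅ = bigD 𝒢 l (1 + ∑ i, d i) (phi 𝒢 l n x) := by
    simp only [hT]
    rw [apply_sub_empty (fun n z => phi 𝒢 l n z) x Fin.elim0, Finset.compl_empty,
      apply_sub_univ (fun n z => phi 𝒢 l n z), phi_zero hl, koszul_empty, Finset.sum_empty,
      add_zero, Int.negOnePow_zero, mul_one, one_smul]
    rfl
  have hTu : T Finset.univ = bigD 𝒢 l (1 + ∑ i, d i) (phi 𝒢 l n x) := by
    simp only [hT]
    rw [apply_sub_univ (fun n z => phi 𝒢 l n z), Finset.compl_univ,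
      apply_sub_empty (fun n z => phi 𝒢 l n z) x Fin.elim0, phi_zero hl, koszul_univ,
      Finset.sum_empty, add_zero, one_mul, bigBracket_antisymm, smul_neg, smul_smul, ← Units.neg_smul,
      ← Int.negOnePow_add, ← Int.negOnePow_succ, Int.negOnePow_even, one_smul]
    · rfl
    · simp only [Int.even_add, Int.even_mul, Int.not_even_one]
      tauto
  have hne : (∅ : Finset (Fin n)) ≠ Finset.univ := by
    intro h
    have := h ▸ Finset.mem_univ (⟨0, hn⟩ : Fin n)
    simp at this
  -- The empty and the full subset each give `[l, φₙ]`. The resulting factor `2` matches the one in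
  -- front of `U` and the `1/2` in the statement.
  have hsplit : ∑ S : Finset (Fin n), T S =
      (2 : ℤ) • bigD 𝒢 l (1 + ∑ i, d i) (phi 𝒢 l n x) +
        ∑ S : Finset (Fin n) with S.Nonempty ∧ Sᶜ.Nonempty, T S := by
    rw [← Finset.sum_filter_add_sum_filter_not Finset.univ
      (fun S : Finset (Fin n) => S.Nonempty ∧ Sᶜ.Nonempty), add_comm]
    congr 1
    have : (Finset.univ : Finset (Finset (Fin n))).filter
        (fun S => ¬(S.Nonempty ∧ Sᶜ.Nonempty)) = {∅, Finset.univ} := by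
      ext S
      simp only [Finset.mem_filter, Finset.mem_univ, true_and, Finset.mem_insert,
        Finset.mem_singleton, not_and_or, Finset.not_nonempty_iff_eq_empty,
        Finset.compl_eq_empty_iff]
    rw [this, Finset.sum_pair hne, hTe, hTu, two_zsmul]
  -- The statement has the degree of `φ (x_S)` in `ℬ⁺` in its sign, one more than the degree of
  -- `x_S`; this accounts for the minus.
  have hneg : ∑ S : Finset (Fin n) with S.Nonempty ∧ Sᶜ.Nonempty,
          koszul d S • (1 + ∑ i ∈ S, d i).negOnePow •
            bigBracket 𝒢 (1 + ∑ i ∈ S, d i) (1 + ∑ i ∈ Sᶜ, d i)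
              (phi 𝒢 l S.card (sub x S)) (phi 𝒢 l Sᶜ.card (sub x Sᶜ)) =
      -∑ S : Finset (Fin n) with S.Nonempty ∧ Sᶜ.Nonempty, T S := by
    rw [← Finset.sum_neg_distrib]
    refine Finset.sum_congr rfl fun S _ => ?_
    simp only [hT]
    rw [smul_smul, ← Units.neg_smul, add_comm (1 : ℤ), Int.negOnePow_succ, mul_neg]
  rw [hneg, ← hU0]
  rw [hsplit] at key
  have h2 : (2 : k) • ∑ S : Finset (Fin n), U S = (2 : ℤ) • ∑ S : Finset (Fin n), U S := by
    rw [← Int.cast_smul_eq_zsmul k]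
    norm_num
  have h3 : (2 : k) • bigD 𝒢 l (1 + ∑ i, d i) (phi 𝒢 l n x) =
      (2 : ℤ) • bigD 𝒢 l (1 + ∑ i, d i) (phi 𝒢 l n x) := by
    rw [← Int.cast_smul_eq_zsmul k]
    norm_num
  rw [← h2, ← h3] at key
  have h4 : ∑ S : Finset (Fin n) with S.Nonempty ∧ Sᶜ.Nonempty, T S =
      -((2 : k) • (bigD 𝒢 l (1 + ∑ i, d i) (phi 𝒢 l n x) + ∑ S : Finset (Fin n), U S)) := by
    rw [eq_neg_iff_add_eq_zero, smul_add, ← key]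
    abel
  rw [h4, neg_neg, smul_smul, inv_mul_cancel₀ two_ne_zero, one_smul, neg_add_cancel_left]

theorem phi_isLInfinityMorphism (hl : IsLInfinity 𝒢 l) :
    IsLInfinityMorphism (shift (hatDeg 𝒢) 1) (hatBracket 𝒢 l) (bigPlus 𝒢) (bigBracket 𝒢)
      (bigD 𝒢 l) (phi 𝒢 l) where
  source := hatBracket_isLInfinity hl
  target := bigPlus_isDGLie hl
  symm := fun n _ => phi_isGradedSymm hl n
  degree := fun _ _ _ _ hx => phi_mem hl hx
  compat := fun _ hn _ _ hx => phi_compat hl hn hx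

end Morphism

/-! ### Exponentials of the derived action -/

section Exponential

open Finset.HasAntidiagonal

variable {k : Type*} [Field k] {E M : Type*} [AddCommGroup E] [Module k E] [AddCommGroup M]
  [Module k M]

/-- The action of the power series `r` on power series with coefficients in `M`. -/
def seriesAct (act : E → M →ₗ[k] M) (r : ℕ → E) : (ℕ → M) →ₗ[k] (ℕ → M) where
  toFun F N := ∑ ij ∈ antidiagonal N, act (r ij.1) (F ij.2)
  map_add' F G := by
    funext N
    simp [Finset.sum_add_distrib]
  map_smul' c F := by
    funext N
    simp [Finset.smul_sum]

/-- The bracket of degree one elements extended to power series. -/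
def seriesBr (br : ℤ → ℤ → M →ₗ[k] M →ₗ[k] M) : (ℕ → M) →ₗ[k] (ℕ → M) →ₗ[k] (ℕ → M) :=
  LinearMap.mk₂ k (fun F G N => ∑ ij ∈ antidiagonal N, br 1 1 (F ij.1) (G ij.2))
    (by intro F F' G; funext N; simp [Finset.sum_add_distrib])
    (by intro c F G; funext N; simp [Finset.smul_sum])
    (by intro F G G'; funext N; simp [Finset.sum_add_distrib])
    (by intro c F G; funext N; simp [Finset.smul_sum])

theorem seriesAct_apply (act : E → M →ₗ[k] M) (r : ℕ → E) (F : ℕ → M) (N : ℕ) :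
    seriesAct act r F N = ∑ ij ∈ antidiagonal N, act (r ij.1) (F ij.2) := rfl

theorem seriesBr_apply (br : ℤ → ℤ → M →ₗ[k] M →ₗ[k] M) (F G : ℕ → M) (N : ℕ) :
    seriesBr br F G N = ∑ ij ∈ antidiagonal N, br 1 1 (F ij.1) (G ij.2) := rfl

theorem iter_sum (act : E → M →ₗ[k] M) {n : ℕ} (x : Fin n → E) {ι : Type*} (s : Finset ι)
    (F : ι → M) :
    iter (fun a F => act a F) n x (∑ i ∈ s, F i) =
      ∑ i ∈ s, iter (fun a F => act a F) n x (F i) := by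
  induction n generalizing F with
  | zero => rfl
  | succ n ih => simp only [iter, map_sum, ih]

theorem seriesAct_iterate_apply (act : E → M →ₗ[k] M) (r : ℕ → E) (n : ℕ) (F : ℕ → M) (N : ℕ) :
    (seriesAct act r)^[n] F N = ∑ p ∈ antidiagonal N, ∑ ν ∈ Finset.Nat.antidiagonalTuple n p.1,
      iter (fun a F => act a F) n (fun i => r (ν i)) (F p.2) := by
  induction n generalizing F with
  | zero =>
    rw [Finset.sum_eq_single (0, N)]
    · rw [Finset.Nat.antidiagonalTuple_zero_zero, Finset.sum_singleton]
      rfl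
    · rintro ⟨i, j⟩ h h'
      rcases i with _ | i
      · simp only [mem_antidiagonal, zero_add] at h
        exact absurd (by rw [h]) h'
      · simp
    · simp
  | succ n ih =>
    rw [Function.iterate_succ_apply, ih]
    simp only [seriesAct_apply, iter_sum, sum_antidiagonalTuple_succ n]
    have h1 (p : ℕ × ℕ) : ∑ ν ∈ Finset.Nat.antidiagonalTuple n p.1, ∑ q ∈ antidiagonal p.2,
        iter (fun a F => act a F) n (fun i => r (ν i)) (act (r q.1) (F q.2)) =
      ∑ q ∈ antidiagonal p.2, ∑ ν ∈ Finset.Nat.antidiagonalTuple n p.1,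
        iter (fun a F => act a F) n (fun i => r (ν i)) (act (r q.1) (F q.2)) := Finset.sum_comm
    rw [Finset.sum_congr rfl fun p _ => h1 p, sum_antidiagonal_assoc (fun a b c =>
      ∑ ν ∈ Finset.Nat.antidiagonalTuple n a,
        iter (fun a F => act a F) n (fun i => r (ν i)) (act (r b) (F c)))]
    refine Finset.sum_congr rfl fun p _ => ?_
    rw [← Finset.Nat.sum_antidiagonal_swap]
    rfl

namespace IsDerivedAction

variable {ℬ : ℤ → Submodule k M} {br : ℤ → ℤ → M →ₗ[k] M →ₗ[k] M} {𝒱 : ℤ → Submodule k E}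
  {emb : E → M} {act : E → M →ₗ[k] M} {r : ℕ → E}

theorem seriesAct_mem (h : IsDerivedAction ℬ br 𝒱 emb act) (hr : ∀ i, r i ∈ 𝒱 0) {F : ℕ → M}
    (hF : ∀ i, F i ∈ ℬ 1) (N : ℕ) : seriesAct act r F N ∈ ℬ 1 := by
  rw [seriesAct_apply]
  refine Submodule.sum_mem _ fun ij _ => ?_
  simpa using h.act_mem (hF ij.2) (hr ij.1)

/-- An element `r` of degree zero acts as a derivation without signs, coefficient by coefficient. -/
theorem seriesAct_seriesBr (h : IsDerivedAction ℬ br 𝒱 emb act) (hr : ∀ i, r i ∈ 𝒱 0)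
    {F G : ℕ → M} (hF : ∀ i, F i ∈ ℬ 1) (hG : ∀ i, G i ∈ ℬ 1) :
    seriesAct act r (seriesBr br F G) =
      seriesBr br (seriesAct act r F) G + seriesBr br F (seriesAct act r G) := by
  funext N
  rw [Pi.add_apply]
  simp only [seriesAct_apply, seriesBr_apply, map_sum, LinearMap.sum_apply]
  rw [← sum_antidiagonal_assoc (fun a b c => br 1 1 (act (r a) (F b)) (G c)),
    sum_antidiagonal_left_comm (fun a b c => br 1 1 (F b) (act (r a) (G c))),
    ← Finset.sum_add_distrib]
  refine Finset.sum_congr rfl fun p _ => ?_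
  rw [← Finset.sum_add_distrib]
  refine Finset.sum_congr rfl fun q _ => ?_
  have := h.act_br (hF q.1) (hG q.2) (hr p.1)
  rwa [mul_zero, Int.negOnePow_zero, one_smul, add_zero] at this

variable [CharZero k]

/-- The coefficients `(1/n!) rⁿ l` of the exponential of the action of `r`. -/
def expTerm (act : E → M →ₗ[k] M) (r : ℕ → E) (l : M) (n : ℕ) : ℕ → M :=
  (n.factorial : k)⁻¹ • (seriesAct act r)^[n] (Pi.single 0 l)

theorem seriesAct_expTerm (act : E → M →ₗ[k] M) (r : ℕ → E) (l : M) (n : ℕ) :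
    seriesAct act r (expTerm act r l n) = ((n + 1 : ℕ) : k) • expTerm act r l (n + 1) := by
  rw [expTerm, expTerm, map_smul, ← Function.iterate_succ_apply' (seriesAct act r),
    smul_smul]
  congr 1
  rw [Nat.factorial_succ, Nat.cast_mul, mul_inv, mul_inv_cancel_left₀]
  exact Nat.cast_ne_zero.2 n.succ_ne_zero

theorem expTerm_mem (h : IsDerivedAction ℬ br 𝒱 emb act) (hr : ∀ i, r i ∈ 𝒱 0) {l : M}
    (hl : l ∈ ℬ 1) (n i : ℕ) : expTerm act r l n i ∈ ℬ 1 := by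
  have (n i : ℕ) : (seriesAct act r)^[n] (Pi.single 0 l) i ∈ ℬ 1 := by
    induction n generalizing i with
    | zero =>
      rcases i with _ | i
      · simpa using hl
      · simp
    | succ n ih =>
      rw [Function.iterate_succ_apply']
      exact h.seriesAct_mem hr ih i
  exact Submodule.smul_mem _ _ (this n i)

/-- As `r 0` acts by zero, each action raises the order in `λ`. The exponential is therefore a
finite sum in each order. -/
theorem expTerm_eq_zero (act : E → M →ₗ[k] M) {r : ℕ → E} (hr0 : act (r 0) = 0) (l : M)
    {n i : ℕ} (hi : i < n) : expTerm act r l n i = 0 := by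
  have (n i : ℕ) (hi : i < n) : (seriesAct act r)^[n] (Pi.single 0 l) i = 0 := by
    induction n generalizing i with
    | zero => omega
    | succ n ih =>
      rw [Function.iterate_succ_apply', seriesAct_apply]
      refine Finset.sum_eq_zero fun p hp => ?_
      rw [mem_antidiagonal] at hp
      by_cases h0 : p.1 = 0
      · rw [h0, hr0, LinearMap.zero_apply]
      · rw [ih p.2 (by omega), map_zero]
  rw [expTerm, Pi.smul_apply, this n i hi, smul_zero]

/-- This is the part of order `n` in `r` of `[exp(r) l, exp(r) l] = exp(r) [l, l] = 0`. The action
of `r` on the sum of order `n` gives `n + 1` times the sum of order `n + 1`, and characteristic zero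
permits division. -/
theorem sum_seriesBr_expTerm (h : IsDerivedAction ℬ br 𝒱 emb act) (hr : ∀ i, r i ∈ 𝒱 0) {l : M}
    (hl : l ∈ ℬ 1) (hll : br 1 1 l l = 0) (n : ℕ) :
    ∑ p ∈ antidiagonal n, seriesBr br (expTerm act r l p.1) (expTerm act r l p.2) = 0 := by
  have hm := h.expTerm_mem hr hl
  induction n with
  | zero =>
    rw [Finset.Nat.antidiagonal_zero, Finset.sum_singleton]
    funext N
    rw [seriesBr_apply]
    refine Finset.sum_eq_zero fun ij _ => ?_
    simp only [expTerm, Nat.factorial_zero, Nat.cast_one, inv_one, one_smul, Function.iterate_zero,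
      id_eq]
    rcases ij with ⟨_ | i, _ | j⟩ <;> simp [hll]
  | succ n ih =>
    set B : ℕ → ℕ → ℕ → M := fun p q => seriesBr br (expTerm act r l p) (expTerm act r l q) with hB
    have e1 := congrArg (seriesAct act r) ih
    rw [map_zero, map_sum] at e1
    have e2 (p : ℕ × ℕ) : seriesAct act r (B p.1 p.2) =
        ((p.1 + 1 : ℕ) : k) • B (p.1 + 1) p.2 + ((p.2 + 1 : ℕ) : k) • B p.1 (p.2 + 1) := by
      simp only [hB]
      rw [h.seriesAct_seriesBr hr (hm _) (hm _), seriesAct_expTerm, seriesAct_expTerm, map_smul,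
        map_smul, LinearMap.smul_apply]
    rw [Finset.sum_congr rfl fun p _ => e2 p, Finset.sum_add_distrib] at e1
    have e3 : ∑ p ∈ antidiagonal n, ((p.1 + 1 : ℕ) : k) • B (p.1 + 1) p.2 =
        ∑ p ∈ antidiagonal (n + 1), (p.1 : k) • B p.1 p.2 := by
      rw [Finset.Nat.sum_antidiagonal_succ]
      simp
    have e4 : ∑ p ∈ antidiagonal n, ((p.2 + 1 : ℕ) : k) • B p.1 (p.2 + 1) =
        ∑ p ∈ antidiagonal (n + 1), (p.2 : k) • B p.1 p.2 := by
      rw [Finset.Nat.sum_antidiagonal_succ']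
      simp
    rw [e3, e4, ← Finset.sum_add_distrib] at e1
    have e5 : ∑ p ∈ antidiagonal (n + 1), ((p.1 : k) • B p.1 p.2 + (p.2 : k) • B p.1 p.2) =
        ((n + 1 : ℕ) : k) • ∑ p ∈ antidiagonal (n + 1), B p.1 p.2 := by
      rw [Finset.smul_sum]
      refine Finset.sum_congr rfl fun p hp => ?_
      rw [mem_antidiagonal] at hp
      rw [← add_smul, ← Nat.cast_add, hp]
    rw [e5] at e1
    exact (smul_eq_zero.1 e1).resolve_left (Nat.cast_ne_zero.2 n.succ_ne_zero)

theorem seriesBr_exp (h : IsDerivedAction ℬ br 𝒱 emb act) (hr : ∀ i, r i ∈ 𝒱 0)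
    (hr0 : act (r 0) = 0) {l : M} (hl : l ∈ ℬ 1) (hll : br 1 1 l l = 0) {μ : ℕ → M}
    (hμ : ∀ N, μ N = ∑ n ∈ Finset.range (N + 1), expTerm act r l n N) :
    seriesBr br μ μ = 0 := by
  -- The same truncation serves all coefficients up to order `N`, because the additional terms
  -- vanish.
  have hμ' {i N : ℕ} (hi : i ≤ N) :
      μ i = ∑ n ∈ Finset.range (N + 1), expTerm act r l n i := by
    rw [hμ]
    refine Finset.sum_subset (Finset.range_subset_range.2 (by omega)) fun n _ hn => ?_
    rw [Finset.mem_range, not_lt] at hn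
    exact expTerm_eq_zero act hr0 l hn
  funext N
  have e1 : seriesBr br μ μ N = ∑ p ∈ Finset.range (N + 1), ∑ q ∈ Finset.range (N + 1),
      seriesBr br (expTerm act r l p) (expTerm act r l q) N := by
    simp only [seriesBr_apply]
    rw [Finset.sum_congr rfl fun p _ => Finset.sum_comm, Finset.sum_comm]
    refine Finset.sum_congr rfl fun ij hij => ?_
    rw [mem_antidiagonal] at hij
    rw [hμ' (show ij.1 ≤ N by omega), hμ' (show ij.2 ≤ N by omega)]
    simp only [map_sum, LinearMap.sum_apply]
    exact Finset.sum_comm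
  have e2 (p q : ℕ) (hpq : N < p + q) :
      seriesBr br (expTerm act r l p) (expTerm act r l q) N = 0 := by
    rw [seriesBr_apply]
    refine Finset.sum_eq_zero fun ij hij => ?_
    rw [mem_antidiagonal] at hij
    by_cases hp : ij.1 < p
    · rw [expTerm_eq_zero act hr0 l hp, map_zero, LinearMap.zero_apply]
    · rw [expTerm_eq_zero act hr0 l (show ij.2 < q by omega), map_zero]
  -- The square of index pairs is cut down to the triangle `p + q ≤ N`, which is then summed along
  -- its antidiagonals.
  have e3 : ∑ p ∈ Finset.range (N + 1), ∑ q ∈ Finset.range (N + 1),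
      seriesBr br (expTerm act r l p) (expTerm act r l q) N =
      ∑ p ∈ Finset.range (N + 1), ∑ q ∈ Finset.range (N + 1 - p),
      seriesBr br (expTerm act r l p) (expTerm act r l q) N := by
    refine Finset.sum_congr rfl fun p hp => (Finset.sum_subset
      (Finset.range_subset_range.2 (by omega)) fun q _ hq => e2 p q ?_).symm
    rw [Finset.mem_range] at hp hq
    omega
  rw [e1, e3, ← Finset.sum_range_diag_flip (N + 1) (fun p q =>
    seriesBr br (expTerm act r l p) (expTerm act r l q) N), Pi.zero_apply]
  refine Finset.sum_eq_zero fun n _ => ?_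
  rw [← Finset.Nat.sum_antidiagonal_eq_sum_range_succ (fun p q =>
    seriesBr br (expTerm act r l p) (expTerm act r l q) N)]
  have := congrFun (h.sum_seriesBr_expTerm hr hl hll n) N
  rwa [Finset.sum_apply] at this

end IsDerivedAction

end Exponential

/-! ### Graded Lie algebras -/

section Triangular

open Finset.HasAntidiagonal

variable {k : Type u} [Field k] {g : Type v} [AddCommGroup g] [Module k g]
  {𝒢 : ℤ → Submodule k g} [DirectSum.Decomposition 𝒢]
  {l : ∀ n : ℕ, MultilinearMap k (fun _ : Fin n => g) g}

/-- The component of arity `p ≥ 1` involves the bracket of `n + p ≥ 3` elements. -/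
theorem phi_eq_zero_of_lie (h2 : ∀ n, n ≠ 2 → l n = 0) {n : ℕ} (hn : 2 ≤ n) :
    phi 𝒢 l n = 0 := by
  refine MultilinearMap.ext fun x => funext fun m => funext fun q => ?_
  rcases m with _ | m
  · exact phi_zero_apply l n x q
  · ext y
    rw [phi_apply 𝒢 l n x (m + 1) q (Nat.succ_ne_zero m),
      hatBracket_eq_zero (h2 (n + (m + 1)) (by omega))]
    rfl

theorem bigEmb_zero : bigEmb (0 : ℕ → Sym 𝒢) = 0 := by
  funext m n
  rcases n with _ | n
  · rfl
  · rcases m with _ | m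
    · ext
      rfl
    · rfl

theorem bigIns_bigElement_of_lie (h2 : ∀ n, n ≠ 2 → l n = 0) (x : ℕ → Sym 𝒢) :
    bigIns x (bigElement 𝒢 l) = phi 𝒢 l 1 ![x] := by
  have h := iter_bigIns_eq (𝒢 := 𝒢) l 1 ![x]
  rw [hatBracket_eq_zero (h2 1 (by norm_num)), zero_apply, bigEmb_zero, add_zero] at h
  exact h

theorem mem_hatShift_sub_one {p : ℤ} {x : ℕ → Sym 𝒢} (hx : x ∈ shift (hatDeg 𝒢) 1 p) :
    x ∈ hatShift 𝒢 (p - 1) := by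
  have : (1 : ℤ) + (1 + (p - 1)) = 1 + p := by ring
  change x ∈ hatDeg 𝒢 (1 + (1 + (p - 1)))
  rw [this]
  exact hx

theorem phi_one_mem (hl : IsLInfinity 𝒢 l) {p : ℤ} {x : ℕ → Sym 𝒢}
    (hx : x ∈ shift (hatDeg 𝒢) 1 p) : phi 𝒢 l 1 ![x] ∈ bigHom p := by
  have h := phi_mem hl (d := ![p - 1]) (x := ![x]) (fun i => by
    fin_cases i
    exact mem_hatShift_sub_one hx)
  simpa using (mem_bigPlus_iff.1 h).1

/-- As `l₁ = 0`, `φ₁(x)` is the whole of `[l, x]`. The action of `x` on `[l, l] = 0` then gives `2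
[l, [l, x]] = 0`. -/
theorem bigD_phi_of_lie [CharZero k] (hl : IsLInfinity 𝒢 l) (h2 : ∀ n, n ≠ 2 → l n = 0) {p : ℤ}
    {x : ℕ → Sym 𝒢} (hx : x ∈ shift (hatDeg 𝒢) 1 p) :
    bigD 𝒢 l p (phi 𝒢 l 1 ![x]) = 0 := by
  have h := bigIns_isDerivedAction.act_br (bigElement_mem hl) (bigElement_mem hl)
    (mem_hatShift_sub_one hx)
  rw [bigBracket_bigElement hl, map_zero, bigIns_bigElement_of_lie h2, add_sub_cancel,
    bigBracket_antisymm p 1, smul_neg, smul_smul, ← Int.negOnePow_add, ← Units.neg_smul,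
    ← Int.negOnePow_succ, Int.negOnePow_even, one_smul, ← two_smul k] at h
  · exact (smul_eq_zero.1 h.symm).resolve_left two_ne_zero
  · simp only [Int.even_add, Int.even_mul, Int.even_sub, Int.not_even_one]
    tauto

/-- Let `y` act on `[l, φ₁(x)] = 0`. One term is `± [φ₁(y), φ₁(x)]`, and the other is the bracket of
`l` with the embedded `l₂(x ⊙ y)`, that is, `φ₁` of it. -/
theorem bigBracket_phi_of_lie [CharZero k] (hl : IsLInfinity 𝒢 l) (h2 : ∀ n, n ≠ 2 → l n = 0)
    {p q : ℤ} {x y : ℕ → Sym 𝒢} (hx : x ∈ shift (hatDeg 𝒢) 1 p)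
    (hy : y ∈ shift (hatDeg 𝒢) 1 q) :
    bigBracket 𝒢 p q (phi 𝒢 l 1 ![x]) (phi 𝒢 l 1 ![y]) =
      phi 𝒢 l 1 ![p.negOnePow • hatBracket 𝒢 l 2 ![x, y]] := by
  have hx' := mem_hatShift_sub_one hx
  have hy' := mem_hatShift_sub_one hy
  have hz : hatBracket 𝒢 l 2 ![x, y] ∈ hatShift 𝒢 (p + (q - 1)) := by
    have := hatBracket_mem hl (d := ![p - 1, q - 1]) (x := ![x, y]) (fun i => by
      fin_cases i
      · exact hx'
      · exact hy')
    have e : 1 + ∑ i, (![p - 1, q - 1] : Fin 2 → ℤ) i = p + (q - 1) := by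
      simp [Fin.sum_univ_two]
      ring
    rwa [e] at this
  -- Since `φ₂ = 0`, the element `[[l, x], y]` has only its arity-zero part.
  have hxy : bigIns y (phi 𝒢 l 1 ![x]) = bigEmb (hatBracket 𝒢 l 2 ![x, y]) := by
    have h := iter_bigIns_eq (𝒢 := 𝒢) l 2 ![x, y]
    rw [phi_eq_zero_of_lie h2 le_rfl, zero_apply, zero_add] at h
    rw [← h, ← bigIns_bigElement_of_lie h2]
    rfl
  have h := bigIns_isDerivedAction.act_br (bigElement_mem hl) (phi_one_mem hl hx) hy'
  have hd : bigBracket 𝒢 1 p (bigElement 𝒢 l) (phi 𝒢 l 1 ![x]) = 0 := bigD_phi_of_lie hl h2 hx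
  rw [hd, map_zero, hxy, ← bigIns_isDerivedAction.act_eq (bigElement_mem hl) hz,
    bigIns_bigElement_of_lie h2, bigIns_bigElement_of_lie h2, add_sub_cancel,
    bigBracket_antisymm q p, smul_neg, smul_smul, ← Int.negOnePow_add, neg_add_eq_sub, eq_comm,
    sub_eq_zero] at h
  have hs : phi 𝒢 l 1 ![p.negOnePow • hatBracket 𝒢 l 2 ![x, y]] =
      p.negOnePow • phi 𝒢 l 1 ![hatBracket 𝒢 l 2 ![x, y]] := by
    have e (z w : ℕ → Sym 𝒢) : ![w] = Function.update ![z] 0 w := by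
      funext i
      rw [Subsingleton.elim i 0]
      rfl
    rcases Int.units_eq_one_or p.negOnePow with hp | hp
    · rw [hp, one_smul, one_smul]
    · rw [hp, Units.neg_smul, one_smul, Units.neg_smul, one_smul,
        e (hatBracket 𝒢 l 2 ![x, y]) (-hatBracket 𝒢 l 2 ![x, y]), MultilinearMap.map_update_neg,
        ← e]
  rw [hs, h, smul_smul, ← Int.negOnePow_add, Int.negOnePow_even, one_smul]
  simp only [Int.even_add, Int.even_mul, Int.even_sub, Int.not_even_one]
  tauto

/-! ### Triangular `L_∞`-bialgebras -/

theorem bigIns_zero : bigIns (0 : ℕ → Sym 𝒢) = 0 := by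
  refine LinearMap.ext fun f => big_ext fun n => ?_
  rcases n with _ | n
  · rfl
  · rw [slice_succ_bigIns, LinearMap.zero_apply, map_zero]
    refine Finset.sum_eq_zero fun ij _ => ?_
    funext m
    exact LinearMap.map_zero₂ (insertArg 𝒢 m) _

theorem expTerm_bigIns (r : ℕ → ℕ → Sym 𝒢) (f : Big 𝒢) (n N : ℕ) :
    IsDerivedAction.expTerm bigIns r f n N = ((n.factorial : k)⁻¹) •
      ∑ ν ∈ Finset.Nat.antidiagonalTuple n N,
        iter (fun a f => bigIns a f) n (fun i => r (ν i)) f := by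
  rw [IsDerivedAction.expTerm, Pi.smul_apply, seriesAct_iterate_apply,
    Finset.sum_eq_single (N, 0)]
  · rw [Pi.single_eq_same]
  · rintro ⟨i, j⟩ h h'
    rcases j with _ | j
    · simp only [mem_antidiagonal, add_zero] at h
      exact absurd (by rw [h]) h'
    · refine Finset.sum_eq_zero fun ν _ => ?_
      have h0 : (Pi.single 0 f : ℕ → Big 𝒢) (j + 1) = 0 := by simp
      have := iter_sum bigIns (fun i => r (ν i)) (∅ : Finset ℕ) (fun _ => (0 : Big 𝒢))
      rw [Finset.sum_empty, Finset.sum_empty] at this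
      rw [h0, this]
  · simp

theorem expTerm_zero (r : ℕ → ℕ → Sym 𝒢) (f : Big 𝒢) :
    IsDerivedAction.expTerm bigIns r f 0 = Pi.single 0 f := by
  simp [IsDerivedAction.expTerm]

/-- The right side is `exp(r) l`. Its term `n = 0` is `l`, the rest in positive arity is `φ(e^r)`,
and the rest in arity zero is the left side of the equation of an `r_∞`-matrix, hence zero. -/
theorem transfer_add_single {r : ℕ → ℕ → Sym 𝒢} (hr : IsRInfinityMatrix 𝒢 l r) (N : ℕ) :
    (transfer 𝒢 l r + (Pi.single 0 (bigElement 𝒢 l) : ℕ → Big 𝒢)) N =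
      ∑ n ∈ Finset.range (N + 1), IsDerivedAction.expTerm bigIns r (bigElement 𝒢 l) n N := by
  have hrange : Finset.range (N + 1) = insert 0 (Finset.Icc 1 N) := by
    ext i
    simp only [Finset.mem_range, Finset.mem_insert, Finset.mem_Icc]
    omega
  rw [hrange, Finset.sum_insert (by simp), expTerm_zero, Pi.add_apply, add_comm]
  congr 1
  rw [Finset.sum_congr rfl fun n _ => expTerm_bigIns r (bigElement 𝒢 l) n N]
  funext m q
  rcases m with _ | m
  · ext y
    rw [Subsingleton.elim y Fin.elim0]
    change ev0 (slice q (∑ n ∈ Finset.Icc 1 N, _)) = ev0 (slice q (∑ n ∈ Finset.Icc 1 N, _))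
    simp only [map_sum, map_smul, ← hatBracket_eq_ev0]
    have h := congrFun (hr.2.2 N) q
    simp only [expSeries, Finset.sum_apply, Pi.smul_apply] at h
    rw [h]
    refine Finset.sum_eq_zero fun n _ => ?_
    rw [Finset.sum_eq_zero, smul_zero]
    intro ν _
    exact congrArg (fun f => f Fin.elim0) (phi_zero_apply (𝒢 := 𝒢) l n (fun i => r (ν i)) q)
  · simp only [transfer, expSeries, Finset.sum_apply, Pi.smul_apply, phi_succ_apply]

variable [CharZero k]

theorem transfer_mem (hl : IsLInfinity 𝒢 l) {r : ℕ → ℕ → Sym 𝒢} (hr : IsRInfinityMatrix 𝒢 l r)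
    (N : ℕ) : transfer 𝒢 l r N ∈ bigPlus 𝒢 1 := by
  unfold transfer expSeries
  refine Submodule.sum_mem _ fun n _ => Submodule.smul_mem _ _ (Submodule.sum_mem _ fun ν _ => ?_)
  have := phi_mem hl (d := fun _ => 0) (x := fun i => r (ν i)) (fun i => hr.2.1 (ν i))
  simpa using this

theorem sum_bigBracket_transfer (hl : IsLInfinity 𝒢 l) {r : ℕ → ℕ → Sym 𝒢}
    (hr : IsRInfinityMatrix 𝒢 l r) :
    seriesBr (bigBracket 𝒢) (transfer 𝒢 l r + Pi.single 0 (bigElement 𝒢 l))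
      (transfer 𝒢 l r + Pi.single 0 (bigElement 𝒢 l)) = 0 :=
  bigIns_isDerivedAction.seriesBr_exp (r := r) (fun i => hr.2.1 i)
    (by rw [hr.1, bigIns_zero]) (bigElement_mem hl) (bigBracket_bigElement hl)
    (transfer_add_single hr)

theorem transfer_isLInfinityBialgebra (hl : IsLInfinity 𝒢 l) {r : ℕ → ℕ → Sym 𝒢}
    (hr : IsRInfinityMatrix 𝒢 l r) :
    IsLInfinityBialgebra 𝒢 (transfer 𝒢 l r + Pi.single 0 (bigElement 𝒢 l)) := by
  refine ⟨fun i => ?_, fun N => congrFun (sum_bigBracket_transfer hl hr) N⟩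
  rw [Pi.add_apply]
  refine add_mem (transfer_mem hl hr i) ?_
  rcases i with _ | i
  · rw [Pi.single_eq_same]
    exact bigElement_mem_bigPlus hl
  · rw [Pi.single_eq_of_ne (Nat.succ_ne_zero i)]
    exact zero_mem _

/-- Expand `[μ' + l, μ' + l] = 0`: the bracket is symmetric in degree one, so the mixed terms give
`2 d μ'`, while `[l, l] = 0`. -/
theorem transfer_maurerCartan (hl : IsLInfinity 𝒢 l) {r : ℕ → ℕ → Sym 𝒢}
    (hr : IsRInfinityMatrix 𝒢 l r) (N : ℕ) :
    bigD 𝒢 l 1 (transfer 𝒢 l r N) + (2⁻¹ : k) • ∑ ij ∈ antidiagonal N,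
      bigBracket 𝒢 1 1 (transfer 𝒢 l r ij.1) (transfer 𝒢 l r ij.2) = 0 := by
  have h := congrFun (sum_bigBracket_transfer hl hr) N
  rw [map_add, map_add, LinearMap.add_apply, LinearMap.add_apply] at h
  simp only [Pi.add_apply] at h
  have hc (f h : Big 𝒢) : bigBracket 𝒢 1 1 f h = bigBracket 𝒢 1 1 h f := by
    rw [bigBracket_antisymm, mul_one, Int.negOnePow_one, Units.neg_smul, one_smul, neg_neg]
  have h1 (F : ℕ → Big 𝒢) : seriesBr (bigBracket 𝒢) (Pi.single 0 (bigElement 𝒢 l)) F N =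
      bigD 𝒢 l 1 (F N) := by
    rw [seriesBr_apply, Finset.sum_eq_single (0, N)]
    · rw [Pi.single_eq_same]
      rfl
    · rintro ⟨i, j⟩ h h'
      rcases i with _ | i
      · simp only [mem_antidiagonal, zero_add] at h
        exact absurd (by rw [h]) h'
      · rw [Pi.single_eq_of_ne (Nat.succ_ne_zero i), map_zero, LinearMap.zero_apply]
    · simp
  have h3 : seriesBr (bigBracket 𝒢) (transfer 𝒢 l r) (Pi.single 0 (bigElement 𝒢 l)) N =
      bigD 𝒢 l 1 (transfer 𝒢 l r N) := by
    rw [← h1, seriesBr_apply, seriesBr_apply, ← Finset.Nat.sum_antidiagonal_swap]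
    exact Finset.sum_congr rfl fun ij _ => hc _ _
  have h4 : bigD 𝒢 l 1 ((Pi.single 0 (bigElement 𝒢 l) : ℕ → Big 𝒢) N) = 0 := by
    rcases N with _ | N
    · rw [Pi.single_eq_same]
      exact bigBracket_bigElement hl
    · rw [Pi.single_eq_of_ne (Nat.succ_ne_zero N), map_zero]
  rw [h1, h1, h3, h4, add_zero, add_assoc, ← two_smul k, Pi.zero_apply] at h
  rw [seriesBr_apply, add_eq_zero_iff_eq_neg] at h
  rw [h, smul_neg, smul_smul, inv_mul_cancel₀ two_ne_zero, one_smul, add_neg_cancel]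

end Triangular

end RInf

end

theorem mainTheorem1 {k : Type*} [Field k] [CharZero k] {g : Type*} [AddCommGroup g] [Module k g]
    (𝒢 : ℤ → Submodule k g) [DirectSum.Decomposition 𝒢]
    (l : ∀ n : ℕ, MultilinearMap k (fun _ : Fin n => g) g) (hl : RInf.IsLInfinity 𝒢 l) :
    -- the brackets on `S (g[-1])` are the multiderivations that extend those of `g`
    RInf.IsMultiderivationExtension 𝒢 l (RInf.symBracket 𝒢 l) ∧
    -- `φ` is an `L_∞`-morphism from the `L_∞`-algebra `Ŝ (g[-1])[1]` to the dg Lie algebra `ℬ⁺`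
    RInf.IsLInfinityMorphism (RInf.shift (RInf.hatDeg 𝒢) 1) (RInf.hatBracket 𝒢 l)
      (RInf.bigPlus 𝒢) (RInf.bigBracket 𝒢) (RInf.bigD 𝒢 l) (RInf.phi 𝒢 l) ∧
    -- the case of a graded Lie algebra: `φ = φ₁` is a morphism of graded Lie algebras, where the
    -- Lie bracket of `Ŝ (g[-1])[1]` is `(-1)^|x| l₂ (x ⊙ y)`
    ((∀ n, n ≠ 2 → l n = 0) →
      (∀ n, 2 ≤ n → RInf.phi 𝒢 l n = 0) ∧
      (∀ (p : ℤ) (x : ℕ → RInf.Sym 𝒢), x ∈ RInf.shift (RInf.hatDeg 𝒢) 1 p →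
        RInf.bigD 𝒢 l p (RInf.phi 𝒢 l 1 ![x]) = 0) ∧
      (∀ (p q : ℤ) (x y : ℕ → RInf.Sym 𝒢), x ∈ RInf.shift (RInf.hatDeg 𝒢) 1 p →
        y ∈ RInf.shift (RInf.hatDeg 𝒢) 1 q →
        RInf.bigBracket 𝒢 p q (RInf.phi 𝒢 l 1 ![x]) (RInf.phi 𝒢 l 1 ![y]) =
          RInf.phi 𝒢 l 1 ![p.negOnePow • RInf.hatBracket 𝒢 l 2 ![x, y]])) ∧
    -- an `r_∞`-matrix gives a Maurer-Cartan element and an `L_∞`-bialgebra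
    (∀ r : ℕ → ℕ → RInf.Sym 𝒢, RInf.IsRInfinityMatrix 𝒢 l r →
      RInf.transfer 𝒢 l r 0 = 0 ∧
      (∀ N, RInf.transfer 𝒢 l r N ∈ RInf.bigPlus 𝒢 1) ∧
      (∀ N, RInf.bigD 𝒢 l 1 (RInf.transfer 𝒢 l r N) +
        (2⁻¹ : k) • ∑ ij ∈ Finset.HasAntidiagonal.antidiagonal N,
          RInf.bigBracket 𝒢 1 1 (RInf.transfer 𝒢 l r ij.1) (RInf.transfer 𝒢 l r ij.2) = 0) ∧
      RInf.IsLInfinityBialgebra 𝒢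
        (RInf.transfer 𝒢 l r + Pi.single 0 (RInf.bigElement 𝒢 l))) := by
  refine ⟨RInf.symBracket_isMultiderivationExtension hl, RInf.phi_isLInfinityMorphism hl,
    fun h2 => ⟨fun n hn => RInf.phi_eq_zero_of_lie h2 hn,
      fun p x hx => RInf.bigD_phi_of_lie hl h2 hx,
      fun p q x y hx hy => RInf.bigBracket_phi_of_lie hl h2 hx hy⟩,
    -- The coefficient of `λ^0` is a sum over the empty interval from `1` to `0`, hence `rfl`.
    fun r hr => ⟨rfl, RInf.transfer_mem hl hr, RInf.transfer_maurerCartan hl hr,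
      RInf.transfer_isLInfinityBialgebra hl hr⟩⟩
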